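/- Let $c\in(0,1/2]$ be a constant. For $n\ge 1$ and $\mu\in[-1+2c,1-2c]^n$ let $\mu$ also denote the product distribution on $\{-1,1\}^n$ with $\mathbb E_{x\sim\mu}[x_i]=\mu_i$, and write $\mathrm{err}_\mu(h,f)=\Pr_{x\sim\mu}[h(x)\ne f(x)]$. All constants and polynomials below depend only on $c$; $\log$ is to base $2$. (a) Decision trees with at most $t$ leaves are PAC-learnable under these distributions with local membership queries. That is, there is a learning algorithm which, given $n$, $t$, $\lceil 1/\epsilon\rceil$, $\lceil 1/\delta\rceil$ with $\epsilon,\delta\in(0,1)$, and for every target $f:\{-1,1\}^n\to\{-1,1\}$ computed by a decision tree with at most $t$ leaves and every such $\mu$ (neither of which it is given), draws at most $\mathrm{poly}(n,t,1/\epsilon,1/\delta)$ independent examples $(x,f(x))$, $x\sim\mu$; queries the value of $f$ only at points within Hamming distance $r=O(\log(2nt/\epsilon))$ of an example drawn before; always halts within $\mathrm{poly}(n,t,1/\epsilon,1/\delta)$ steps; and outputs a hypothesis $h:\{-1,1\}^n\to\{-1,1\}$ that can be evaluated in time $\mathrm{poly}(n,t,1/\epsilon,1/\delta)$ and satisfies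 $\mathrm{err}_\mu(h,f)\le\epsilon$ with probability at least $1-\delta$ over the examples. (Time is counted on a random access machine on integers with unit-cost addition, subtraction and comparison, where an oracle call costs at least $n$ steps.) (b) Put $\chi^\mu_S(x)=\prod_{i\in S}\frac{x_i-\mu_i}{\sqrt{1-\mu_i^2}}$, $\hat f^\mu(S)=\mathbb E_{x\sim\mu}[f(x)\chi^\mu_S(x)]$ and $f_S(x)=\sum_{T\supseteq S}\hat f^\mu(T)\chi^\mu_{T\setminus S}(x)$. For $\epsilon\in(0,1)$ let $$\theta=\sqrt{\frac{\epsilon}{2t\,(8t/\epsilon)^{1/\log(1/(1-c))}}},\qquad d=\left\lfloor\frac{\log(8t/\epsilon)}{\log(1/(1-c))}\right\rfloor .$$ Consider the following algorithm, in which expectations and Fourier coefficients are exact. Start with $\mathcal S=\{\emptyset\}$; for $i=1,\dots,d$, for every $S'\in\mathcal S$ with $|S'|=i-1$ and every $j\in[n]\setminus S'$, add $S=S'\cup\{j\}$ to $\mathcal S$ if $\mathbb E_{x\sim\mu}[f_S(x)^2]>\theta^2$; finally output $\mathrm{sign}(h)$ with $h=\sum_{S\in\mathcal S}\hat f^\mu(S)\chi^\mu_S$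 (and $\mathrm{sign}(0)=1$). For every $f$ computed by a decision tree with at most $t$ leaves and every $\mu$ as above, $\mathrm{err}_\mu(\mathrm{sign}(h),f)\le\epsilon$. The final $|\mathcal S|$ and the number of tests performed are at most $\mathrm{poly}(n,t,1/\epsilon)$. For every tested set $S$ and every $x$, the value $f_S(x)$ equals $\mathbb E_{x_S\sim\mu_S}[f(x)\chi^\mu_S(x)]$ (the bits outside $S$ being held fixed), and so is obtained from the values of $f$ at the points that agree with $x$ outside $S$; there are at most $\mathrm{poly}(n,t,1/\epsilon)$ of these points, and all are within Hamming distance $O(\log(2nt/\epsilon))$ of $x$. -/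

import Mathlib

namespace LocalMQ

open Finset

/-! ### The cube, product distributions, decision trees -/

/-- The cube `{-1, 1}^n`; the two units of `ℤ` are exactly `1` and `-1`. -/
abbrev Cube (n : ℕ) : Type := Fin n → ℤˣ

/-- A bit of a point as a real number. -/
def bit {n : ℕ} (x : Cube n) (i : Fin n) : ℝ := ((x i : ℤ) : ℝ)

/-- The probability mass function of the product distribution on `{-1, 1}^n` with
`E[x_i] = μ i`. -/
noncomputable def prodDist {n : ℕ} (μ : Fin n → ℝ) (x : Cube n) : ℝ :=
  ∏ i, (1 + μ i * bit x i) / 2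

/-- `E_{x ∼ μ}[g(x)]`. -/
noncomputable def expect {n : ℕ} (μ : Fin n → ℝ) (g : Cube n → ℝ) : ℝ :=
  ∑ x, prodDist μ x * g x

/-- `err_D(h, f) = Pr_{x ∼ D}[h(x) ≠ f(x)]`, for a mass function `D`. -/
noncomputable def err {n : ℕ} (D : Cube n → ℝ) (h f : Cube n → ℤˣ) : ℝ :=
  ∑ x with h x ≠ f x, D x

/-- Decision trees over `n` variables with leaves labelled by `±1`. -/
inductive DecTree (n : ℕ) : Type
  | leaf (b : ℤˣ) : DecTree n
  | node (i : Fin n) (neg pos : DecTree n) : DecTree n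

/-- The number of leaves. -/
def DecTree.leaves {n : ℕ} : DecTree n → ℕ
  | .leaf _ => 1
  | .node _ a b => a.leaves + b.leaves

/-- The function computed by a tree. -/
def DecTree.eval {n : ℕ} : DecTree n → Cube n → ℤˣ
  | .leaf b, _ => b
  | .node i a b, x => if x i = 1 then b.eval x else a.eval x

/-! ### Fourier analysis over a product distribution and the idealized algorithm -/

/-- `χ^μ_S(x) = ∏_{i ∈ S} (x_i - μ_i) / √(1 - μ_i²)`. -/
noncomputable def chi {n : ℕ} (μ : Fin n → ℝ) (S : Finset (Fin n)) (x : Cube n) : ℝ :=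
  ∏ i ∈ S, (bit x i - μ i) / Real.sqrt (1 - μ i ^ 2)

/-- A `±1`-valued function as a real-valued one. -/
def toReal {n : ℕ} (f : Cube n → ℤˣ) (x : Cube n) : ℝ := ((f x : ℤ) : ℝ)

/-- The Fourier coefficient of `f` at `S` under `μ`. -/
noncomputable def coeff {n : ℕ} (μ : Fin n → ℝ) (f : Cube n → ℤˣ) (S : Finset (Fin n)) : ℝ :=
  expect μ (fun x => toReal f x * chi μ S x)

/-- `f^μ_S(x) = ∑_{T ⊇ S} f̂^μ(T) χ^μ_{T \ S}(x)`. -/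
noncomputable def fSub {n : ℕ} (μ : Fin n → ℝ) (f : Cube n → ℤˣ) (S : Finset (Fin n))
    (x : Cube n) : ℝ :=
  ∑ T with S ⊆ T, coeff μ f T * chi μ (T \ S) x

/-- The points obtained from `x` by changing only bits in `S`. -/
def flips {n : ℕ} (S : Finset (Fin n)) (x : Cube n) : Finset (Cube n) :=
  univ.filter (fun y => ∀ i, i ∉ S → y i = x i)

/-- `E_{x_S ∼ μ_S}[f(x) χ^μ_S(x)]` with the bits of `x` outside `S` held fixed: the value that
the algorithm obtains from membership queries at the points of `flips S x`. -/
noncomputable def queryAvg {n : ℕ} (μ : Fin n → ℝ) (f : Cube n → ℤˣ) (S : Finset (Fin n))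
    (x : Cube n) : ℝ :=
  ∑ y ∈ flips S x, (∏ i ∈ S, (1 + μ i * bit y i) / 2) * (toReal f y * chi μ S y)

open Classical in
/-- The collection `𝒮` after `i` rounds. Round `i + 1` goes through all `S' ∈ 𝒮` with `|S'| = i`
and all `j ∉ S'`, and adds `S = S' ∪ {j}` if it passes the `L₂` test `E_μ[f_S²] > θ²`. -/
noncomputable def collected {n : ℕ} (μ : Fin n → ℝ) (f : Cube n → ℤˣ) (θ : ℝ) :
    ℕ → Finset (Finset (Fin n))
  | 0 => {∅}
  | i + 1 => collected μ f θ i ∪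
      univ.filter (fun S => ∃ S' ∈ collected μ f θ i, S'.card = i ∧ ∃ j, j ∉ S' ∧
        S = insert j S' ∧ θ ^ 2 < expect μ (fun x => fSub μ f S x ^ 2))

/-- The pairs `(S', j)` for which the algorithm performs an `L₂` test within `d` rounds. -/
noncomputable def tests {n : ℕ} (μ : Fin n → ℝ) (f : Cube n → ℤˣ) (θ : ℝ) (d : ℕ) :
    Finset (Finset (Fin n) × Fin n) :=
  univ.filter (fun p => p.1 ∈ collected μ f θ d ∧ p.1.card < d ∧ p.2 ∉ p.1)

/-- The sign of a real number, as an element of `{-1, 1}`. -/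
noncomputable def sgn (a : ℝ) : ℤˣ := if 0 ≤ a then 1 else -1

/-- The output `sign(h(x))`, `h = ∑_{S ∈ 𝒮} f̂^μ(S) χ^μ_S`, of the algorithm. -/
noncomputable def output {n : ℕ} (μ : Fin n → ℝ) (f : Cube n → ℤˣ) (θ : ℝ) (d : ℕ) :
    Cube n → ℤˣ :=
  fun x => sgn (∑ S ∈ collected μ f θ d, coeff μ f S * chi μ S x)

/-- `log(8t/ε) / log(1/(1-c))`, the number of rounds. -/
noncomputable def depthParam (c ε : ℝ) (t : ℕ) : ℝ :=
  Real.logb 2 (8 * t / ε) / Real.logb 2 (1 / (1 - c))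

/-- `√(ε / (2t (8t/ε)^{1/log(1/(1-c))}))`, the threshold. -/
noncomputable def thetaParam (c ε : ℝ) (t : ℕ) : ℝ :=
  Real.sqrt (ε / (2 * t * (8 * t / ε) ^ (1 / Real.logb 2 (1 / (1 - c)))))

/-! ### Learning programs and their running time

The machine model is a structured random access machine on integers, with addition and
subtraction as its only arithmetic. An elementary operation has unit cost; a number grows by a
bounded number of bits per step, so that this cost is polynomially related to Turing machine time.
The memory consists of arrays `0, 1, 2, …` (a program names finitely many of them),
each with cells indexed by integers. -/

/-- Memory contents: `mem a i` is cell `i` of array `a`. -/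
abbrev Mem : Type := ℕ → ℤ → ℤ

/-- Integer expressions. `get a e` is the cell of array `a` whose index is the value of `e`. -/
inductive Expr : Type
  | const (z : ℤ) : Expr
  | get (a : ℕ) (e : Expr) : Expr
  | add (e₁ e₂ : Expr) : Expr
  | sub (e₁ e₂ : Expr) : Expr

/-- The value of an expression. -/
def Expr.val (M : Mem) : Expr → ℤ
  | .const z => z
  | .get a e => M a (e.val M)
  | .add e₁ e₂ => e₁.val M + e₂.val M
  | .sub e₁ e₂ => e₁.val M - e₂.val M

/-- The cost of evaluating an expression: the number of its operations. -/
def Expr.cost : Expr → ℕ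
  | .const _ => 1
  | .get _ e => e.cost + 1
  | .add e₁ e₂ => e₁.cost + e₂.cost + 1
  | .sub e₁ e₂ => e₁.cost + e₂.cost + 1

/-- Programs. -/
inductive Cmd : Type
  | skip : Cmd
  /-- `set a i e`: write the value of `e` into cell `i` of array `a`. -/
  | set (a : ℕ) (i e : Expr) : Cmd
  | seq (p q : Cmd) : Cmd
  /-- `ite e p q`: run `p` if `0 < e`, else `q`. -/
  | ite (e : Expr) (p q : Cmd) : Cmd
  /-- `loop e p`: while `0 < e`, run `p`. -/
  | loop (e : Expr) (p : Cmd) : Cmd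
  /-- `ex a i`: draw an example `(x, f(x))`, write the bits of `x` into the `n` cells of array `a`
  from index `i` on, and the label `f(x)` into the cell after them. -/
  | ex (a : ℕ) (i : Expr) : Cmd
  /-- `mq a i b j`: query `f` at the point stored in the `n` cells of array `a` from index `i` on,
  and write the answer into cell `j` of array `b`. -/
  | mq (a : ℕ) (i : Expr) (b : ℕ) (j : Expr) : Cmd

/-- The memory with all cells `0`. -/
def Mem.zero : Mem := fun _ _ => 0

/-- Overwrite one cell. -/
def Mem.write (M : Mem) (a : ℕ) (i v : ℤ) : Mem :=
  fun a' i' => if a' = a ∧ i' = i then v else M a' i'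

/-- Write a point into `n` consecutive cells of array `a`, from index `i` on. -/
def Mem.writePoint {n : ℕ} (M : Mem) (a : ℕ) (i : ℤ) (x : Cube n) : Mem :=
  fun a' i' =>
    if h : a' = a ∧ i ≤ i' ∧ i' < i + n then
      ((x ⟨(i' - i).toNat, by omega⟩ : ℤˣ) : ℤ)
    else M a' i'

/-- A state of a computation: the memory and the number of examples drawn so far. -/
structure State : Type where
  mem : Mem
  drawn : ℕ

/-- `Exec f r ω p s s' k`: with target `f`, with `ω 0, ω 1, …` as the points that the example
oracle returns one after the other, and with a membership oracle that answers only queries within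
Hamming distance `r` of an example drawn before, the program `p` leads from the state `s`
to the state `s'` in exactly `k` steps. A program that asks for a further example after the `m`-th,
or that makes a query which is not `r`-local, gets stuck: it has no execution. -/
inductive Exec {n m : ℕ} (f : Cube n → ℤˣ) (r : ℕ) (ω : Fin m → Cube n) :
    Cmd → State → State → ℕ → Prop
  | skip (s : State) : Exec f r ω .skip s s 1
  | set (s : State) (a : ℕ) (i e : Expr) :
      Exec f r ω (.set a i e) s ⟨s.mem.write a (i.val s.mem) (e.val s.mem), s.drawn⟩
        (i.cost + e.cost + 1)
  | seq {p q : Cmd} {s s' s'' : State} {k l : ℕ} :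
      Exec f r ω p s s' k → Exec f r ω q s' s'' l → Exec f r ω (.seq p q) s s'' (k + l)
  | ite_pos {e : Expr} {p q : Cmd} {s s' : State} {k : ℕ} :
      0 < e.val s.mem → Exec f r ω p s s' k → Exec f r ω (.ite e p q) s s' (e.cost + 1 + k)
  | ite_neg {e : Expr} {p q : Cmd} {s s' : State} {k : ℕ} :
      ¬ 0 < e.val s.mem → Exec f r ω q s s' k → Exec f r ω (.ite e p q) s s' (e.cost + 1 + k)
  | loop_done {e : Expr} {p : Cmd} {s : State} :
      ¬ 0 < e.val s.mem → Exec f r ω (.loop e p) s s (e.cost + 1)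
  | loop_step {e : Expr} {p : Cmd} {s s' s'' : State} {k l : ℕ} :
      0 < e.val s.mem → Exec f r ω p s s' k → Exec f r ω (.loop e p) s' s'' l →
      Exec f r ω (.loop e p) s s'' (e.cost + 1 + k + l)
  | ex (s : State) (a : ℕ) (i : Expr) (h : s.drawn < m) :
      Exec f r ω (.ex a i) s
        ⟨(s.mem.writePoint a (i.val s.mem) (ω ⟨s.drawn, h⟩)).write a (i.val s.mem + n)
          (f (ω ⟨s.drawn, h⟩) : ℤˣ), s.drawn + 1⟩
        (i.cost + n + 1)
  | mq (s : State) (a : ℕ) (i : Expr) (b : ℕ) (j : Expr) (q : Cube n) :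
      (∀ v : Fin n, s.mem a (i.val s.mem + (v : ℕ)) = (q v : ℤ)) →
      (∃ u : Fin m, (u : ℕ) < s.drawn ∧ hammingDist (ω u) q ≤ r) →
      Exec f r ω (.mq a i b j) s ⟨s.mem.write b (j.val s.mem) (f q : ℤˣ), s.drawn⟩
        (i.cost + j.cost + n + 1)

/-- The initial state of a learner: cells `0, 1, 2, 3` of array `0` hold `n`, `t`, `⌈1/ε⌉` and
`⌈1/δ⌉`, and every other cell holds `0`. -/
noncomputable def initial (n t : ℕ) (ε δ : ℝ) : State :=
  ⟨(((Mem.zero.write 0 0 n).write 0 1 t).write 0 2 ⌈1 / ε⌉).write 0 3 ⌈1 / δ⌉, 0⟩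

/-- The hypothesis left in the memory `M` is `h`: for every `x`, the evaluator `E`, run on the
memory `M` with `x` written into the cells `0, …, n-1` of array `1`, halts after at most `B` steps
with `h(x)` in cell `0` of array `2`. The evaluator has no oracles: its sample is empty, so
an example request or a membership query gets stuck, and the target plays no role. -/
def Evaluates {n : ℕ} (E : Cmd) (M : Mem) (h : Cube n → ℤˣ) (B : ℝ) : Prop :=
  ∀ x : Cube n, ∃ (s : State) (k : ℕ),
    Exec (fun _ : Cube n => (1 : ℤˣ)) 0 (fun u : Fin 0 => u.elim0) E
      ⟨M.writePoint 1 0 x, 0⟩ s k ∧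
    (k : ℝ) ≤ B ∧ s.mem 2 0 = (h x : ℤ)

open Classical in
/-- The learner `L`, with evaluator `E` for its hypotheses, learns the target `f` under the
distribution `D` to error `ε` with confidence `1 - δ`, from at most `m` independent
examples and `r`-local membership queries. On every sample it halts after at most `B` steps, and
its hypothesis can be evaluated in at most `B` steps. -/
def Learns (L E : Cmd) {n : ℕ} (t : ℕ) (ε δ : ℝ) (m r : ℕ) (B : ℝ)
    (D : Cube n → ℝ) (f : Cube n → ℤˣ) : Prop :=
  ∃ h : (Fin m → Cube n) → Cube n → ℤˣ,
    (∀ ω : Fin m → Cube n, ∃ (s : State) (k : ℕ),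
      Exec f r ω L (initial n t ε δ) s k ∧ (k : ℝ) ≤ B ∧ Evaluates E s.mem (h ω) B) ∧
    1 - δ ≤ ∑ ω : Fin m → Cube n with err D (h ω) f ≤ ε, ∏ u, D (ω u)

end LocalMQ

/-! Let `f` be a tree with `s` leaves. For a set `S` let the alternating sum of `f` at `x` run over
the points that agree with `x` outside `S` (`altSum`), and call `S` sensitive at `x` if it is
nonzero; `sensProb` is the probability of this event. Three facts carry both halves of the theorem.

Link to Fourier analysis. Up to a factor depending on `μ` and a sign, `f_S(x)` is the alternating
sum (`fSub_eq_altSum`), and the factor makes `|f_S| ≤ 1`. Hence `E[f_S²]` is at most the sensitivity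
probability (`expect_fSub_sq_le_sensProb`). Since `E[f_S²]` is the Fourier weight of `f` above `S`,
it decreases when `S` grows and dominates the squared coefficient at `S`, so a heavy coefficient can
be reached by adding one coordinate at a time.

Few sensitive sets. Weighting `S` by `c^|S|`, the sensitivity probabilities of a tree sum to at most
`s` (`sum_sensProb_le`). At the root `i`, a set without `i` sees an average of the two subtrees with
weights at most `1 - c`, while a set with `i` is sensitive only if its rest is sensitive for a
subtree; the factors `1 - c` and `c` add up to `1`. So at most `s / (c^d τ)` sets of size at most
`d` have sensitivity at least `τ` (`card_mul_le_leaves`).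

Sparse approximation. Replacing a tree by `0` below depth `d` costs squared error at most `s (1 -
c)^d` and leaves at most `s 2^d` Fourier coefficients, all of degree at most `d`
(`exists_sparse_approx`). So a family containing all low-degree coefficients above a threshold
misses little weight (`sum_coeff_sq_compl_le`), and the sign of the corresponding partial sum has
small error (`err_sgn_le`). With the stated parameters this is the exact algorithm
(`exact_algorithm`).

The learner does not know `μ`, and needs it nowhere. It accepts a set when the fraction of sample
points at which it is sensitive exceeds `1/w`; and `f̂(S) χ_S(x)` is the expectation over `y` of the
alternating sum at `y` restricted to those `y` opposite to `x` on all of `S` (`coeff_mul_chi`),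
which a sample estimates by an integer vote. A Chernoff bound (`le_sum_sample`) makes all these
averages accurate at once, and a cap on storage bounds the running time even on bad samples.
`err_hypothesis_le` and `le_sum_good_sample` give the accuracy.

What remains is to write the learner as a concrete program. A small program logic (`Runs`, frames, a
loop rule) yields correctness together with step counts (`runs_learner`, `evaluates_hypothesis`).
One enumeration routine, `growCmd`, serves both for collecting the accepted sets and for listing the
subsets of a set. All parameters are fixed powers of sums of the inputs, except the degree bound,
which is a multiple of a rounded logarithm. -/

namespace LocalMQ

open Finset

/-! ### Fourier analysis over a product distribution -/

section Fourier

variable {n : ℕ} {μ : Fin n → ℝ}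

/-- The mass that the `i`-th marginal gives to `b`. -/
noncomputable def marg (μ : Fin n → ℝ) (i : Fin n) (b : ℤˣ) : ℝ := (1 + μ i * ((b : ℤ) : ℝ)) / 2

/-- The character of a single coordinate. -/
noncomputable def chiOne (μ : Fin n → ℝ) (i : Fin n) (b : ℤˣ) : ℝ :=
  (((b : ℤ) : ℝ) - μ i) / Real.sqrt (1 - μ i ^ 2)

lemma prodDist_eq (x : Cube n) : prodDist μ x = ∏ i, marg μ i (x i) := rfl

lemma chi_eq (S : Finset (Fin n)) (x : Cube n) : chi μ S x = ∏ i ∈ S, chiOne μ i (x i) := rfl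

lemma chi_eq_univ (S : Finset (Fin n)) (x : Cube n) :
    chi μ S x = ∏ i, if i ∈ S then chiOne μ i (x i) else 1 := by
  rw [Fintype.prod_ite_mem, chi_eq]

lemma sum_units (φ : ℤˣ → ℝ) : ∑ b, φ b = φ 1 + φ (-1) := by
  rw [show (univ : Finset ℤˣ) = {1, -1} from rfl, sum_pair (by decide)]

lemma sum_cube_prod (φ : Fin n → ℤˣ → ℝ) :
    ∑ x : Cube n, ∏ i, φ i (x i) = ∏ i, (φ i 1 + φ i (-1)) := by
  simp_rw [← sum_units]
  rw [prod_univ_sum, Fintype.piFinset_univ]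

lemma sum_flips_prod (S : Finset (Fin n)) (x : Cube n) (φ : Fin n → ℤˣ → ℝ) :
    ∑ y ∈ flips S x, ∏ i, φ i (y i) =
      ∏ i, if i ∈ S then φ i 1 + φ i (-1) else φ i (x i) := by
  have h : flips S x = Fintype.piFinset (fun i => if i ∈ S then univ else {x i}) := by
    ext y
    simp only [flips, mem_filter, mem_univ, true_and, Fintype.mem_piFinset]
    refine forall_congr' fun i => ?_
    by_cases hi : i ∈ S <;> simp [hi, Int.units_eq_one_or]
  rw [h, ← prod_univ_sum]
  refine prod_congr rfl fun i _ => ?_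
  by_cases hi : i ∈ S
  · simp only [hi, if_true]
    exact sum_units _
  · simp [hi]

lemma bit_sq (x : Cube n) (i : Fin n) : bit x i * bit x i = 1 := by
  rcases Int.units_eq_one_or (x i) with h | h <;> simp [bit, h]

lemma marg_nonneg (hμ : ∀ i, μ i ^ 2 < 1) (i : Fin n) (b : ℤˣ) : 0 ≤ marg μ i b := by
  have := abs_lt.1 ((sq_lt_one_iff_abs_lt_one _).1 (hμ i))
  rcases Int.units_eq_one_or b with h | h <;> simp [marg, h] <;> linarith

lemma prodDist_nonneg (hμ : ∀ i, μ i ^ 2 < 1) (x : Cube n) : 0 ≤ prodDist μ x :=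
  prod_nonneg fun i _ => marg_nonneg hμ i _

lemma marg_add (i : Fin n) : marg μ i 1 + marg μ i (-1) = 1 := by
  simp [marg]; ring

lemma sum_prodDist : ∑ x, prodDist μ x = 1 := by
  simp_rw [prodDist_eq]
  rw [sum_cube_prod]
  simp [marg_add]

lemma sqrt_pos (hμ : ∀ i, μ i ^ 2 < 1) (i : Fin n) : 0 < Real.sqrt (1 - μ i ^ 2) :=
  Real.sqrt_pos.2 (by linarith [hμ i])

lemma marg_mul_chiOne_add (hμ : ∀ i, μ i ^ 2 < 1) (i : Fin n) :
    marg μ i 1 * chiOne μ i 1 + marg μ i (-1) * chiOne μ i (-1) = 0 := by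
  have := (sqrt_pos hμ i).ne'
  simp [marg, chiOne]; field_simp; ring

lemma marg_mul_chiOne_sq_add (hμ : ∀ i, μ i ^ 2 < 1) (i : Fin n) :
    marg μ i 1 * (chiOne μ i 1 * chiOne μ i 1)
      + marg μ i (-1) * (chiOne μ i (-1) * chiOne μ i (-1)) = 1 := by
  have h := (sqrt_pos hμ i).ne'
  have h2 := Real.sq_sqrt (show (0 : ℝ) ≤ 1 - μ i ^ 2 by linarith [hμ i])
  simp only [marg, chiOne, Units.val_one, Int.cast_one, Units.val_neg, Int.cast_neg, mul_one]
  field_simp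
  rw [h2]; ring

/-- The mass times the character is the same constant for both values of the bit, up to the sign of
the bit. This is why averaging against `chi` becomes an alternating sum without reference to `μ`. -/
lemma marg_mul_chiOne (hμ : ∀ i, μ i ^ 2 < 1) (i : Fin n) (b : ℤˣ) :
    marg μ i b * chiOne μ i b = Real.sqrt (1 - μ i ^ 2) / 2 * ((b : ℤ) : ℝ) := by
  have h := (sqrt_pos hμ i).ne'
  have h2 := Real.sq_sqrt (show (0 : ℝ) ≤ 1 - μ i ^ 2 by linarith [hμ i])
  rcases Int.units_eq_one_or b with hb | hb <;>
    simp only [marg, chiOne, hb, Units.val_one, Int.cast_one, Units.val_neg, Int.cast_neg,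
      mul_one] <;>
    field_simp <;> rw [h2] <;> ring

/-- The expectation factors over coordinates. A coordinate in exactly one of the two sets
contributes the mean of its character, which vanishes; every other coordinate contributes `1`. -/
lemma expect_chi_mul_chi (hμ : ∀ i, μ i ^ 2 < 1) (S T : Finset (Fin n)) :
    expect μ (fun x => chi μ S x * chi μ T x) = if S = T then 1 else 0 := by
  have h : ∀ x : Cube n, prodDist μ x * (chi μ S x * chi μ T x) = ∏ i, (marg μ i (x i) *
      ((if i ∈ S then chiOne μ i (x i) else 1) * (if i ∈ T then chiOne μ i (x i) else 1))) := by
    intro x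
    rw [prod_mul_distrib, prod_mul_distrib, ← chi_eq_univ, ← chi_eq_univ, prodDist_eq]
  rw [expect, sum_congr rfl fun x _ => h x,
    sum_cube_prod (fun i b => marg μ i b *
      ((if i ∈ S then chiOne μ i b else 1) * (if i ∈ T then chiOne μ i b else 1)))]
  split_ifs with hST
  · subst hST
    refine prod_eq_one fun i _ => ?_
    by_cases hi : i ∈ S
    · simpa [hi] using marg_mul_chiOne_sq_add hμ i
    · simpa [hi] using marg_add i
  · have : ∃ i, ¬ (i ∈ S ↔ i ∈ T) := by
      by_contra hcon
      push Not at hcon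
      exact hST (Finset.ext hcon)
    obtain ⟨i, hi⟩ := this
    refine prod_eq_zero (mem_univ i) ?_
    by_cases h1 : i ∈ S <;> by_cases h2 : i ∈ T <;> simp [h1, h2] at hi ⊢ <;>
      exact marg_mul_chiOne_add hμ i

/-- The Fourier coefficient of a real-valued function. -/
noncomputable def fourier (μ : Fin n → ℝ) (g : Cube n → ℝ) (S : Finset (Fin n)) : ℝ :=
  expect μ (fun x => g x * chi μ S x)

/-! ### Expectations and the orthonormal expansion -/

lemma expect_add (g h : Cube n → ℝ) :
    expect μ (fun x => g x + h x) = expect μ g + expect μ h := by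
  simp [expect, mul_add, sum_add_distrib]

lemma expect_sub (g h : Cube n → ℝ) :
    expect μ (fun x => g x - h x) = expect μ g - expect μ h := by
  simp [expect, mul_sub, sum_sub_distrib]

lemma expect_const_mul (a : ℝ) (g : Cube n → ℝ) :
    expect μ (fun x => a * g x) = a * expect μ g := by
  simp only [expect, mul_sum]
  exact sum_congr rfl fun x _ => by ring

lemma expect_sum {ι : Type*} (s : Finset ι) (g : ι → Cube n → ℝ) :
    expect μ (fun x => ∑ k ∈ s, g k x) = ∑ k ∈ s, expect μ (g k) := by
  simp only [expect, mul_sum]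
  exact sum_comm

lemma expect_const (a : ℝ) : expect μ (fun _ => a) = a := by
  rw [expect, ← sum_mul, sum_prodDist, one_mul]

lemma expect_mono (hμ : ∀ i, μ i ^ 2 < 1) {g h : Cube n → ℝ} (H : ∀ x, g x ≤ h x) :
    expect μ g ≤ expect μ h :=
  sum_le_sum fun x _ => mul_le_mul_of_nonneg_left (H x) (prodDist_nonneg hμ x)

lemma expect_nonneg (hμ : ∀ i, μ i ^ 2 < 1) {g : Cube n → ℝ} (H : ∀ x, 0 ≤ g x) :
    0 ≤ expect μ g :=
  sum_nonneg fun x _ => mul_nonneg (prodDist_nonneg hμ x) (H x)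

/-- Completeness of the characters: the sum over `S` is the expansion of a product of factors `1 +
χ_i(y) χ_i(x)`, and each factor times the mass of `y i` is the indicator of `y i = x i`. -/
lemma sum_chi_mul_chi (hμ : ∀ i, μ i ^ 2 < 1) (x y : Cube n) :
    prodDist μ y * ∑ S, chi μ S y * chi μ S x = if y = x then 1 else 0 := by
  have h1 : ∑ S, chi μ S y * chi μ S x = ∏ i, (1 + chiOne μ i (y i) * chiOne μ i (x i)) := by
    rw [prod_one_add, powerset_univ]
    refine sum_congr rfl fun S _ => ?_
    rw [prod_mul_distrib, chi_eq, chi_eq]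
  have h2 : ∀ i, marg μ i (y i) * (1 + chiOne μ i (y i) * chiOne μ i (x i)) =
      if y i = x i then 1 else 0 := by
    intro i
    rw [mul_add, ← mul_assoc, marg_mul_chiOne hμ]
    have h := (sqrt_pos hμ i).ne'
    rcases Int.units_eq_one_or (y i) with hy | hy <;>
      rcases Int.units_eq_one_or (x i) with hx | hx <;>
      simp [marg, chiOne, hx, hy] <;> field_simp <;> ring
  rw [h1, prodDist_eq, ← prod_mul_distrib, prod_congr rfl fun i _ => h2 i]
  split_ifs with hyx
  · simp [hyx]
  · obtain ⟨i, hi⟩ := Function.ne_iff.1 hyx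
    exact prod_eq_zero (mem_univ i) (by simp [hi])

/-- Fourier inversion. -/
lemma sum_fourier (hμ : ∀ i, μ i ^ 2 < 1) (g : Cube n → ℝ) (x : Cube n) :
    ∑ S, fourier μ g S * chi μ S x = g x := by
  have : ∀ S, fourier μ g S * chi μ S x =
      ∑ y, g y * (prodDist μ y * (chi μ S y * chi μ S x)) := by
    intro S
    rw [fourier, expect, sum_mul]
    exact sum_congr rfl fun y _ => by ring
  simp_rw [this]
  rw [sum_comm]
  simp_rw [← mul_sum, sum_chi_mul_chi hμ]
  simp

/-- Pythagoras for the characters. The injective reindexing `φ` is there for `T ↦ T \ S`, which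
occurs in the expansion of `fSub`. -/
lemma expect_sq_sum_chi {ι : Type*} (hμ : ∀ i, μ i ^ 2 < 1) (A : Finset ι) (a : ι → ℝ)
    (φ : ι → Finset (Fin n)) (hφ : Set.InjOn φ A) :
    expect μ (fun x => (∑ k ∈ A, a k * chi μ (φ k) x) ^ 2) = ∑ k ∈ A, a k ^ 2 := by
  have : ∀ x, (∑ k ∈ A, a k * chi μ (φ k) x) ^ 2 =
      ∑ k ∈ A, ∑ l ∈ A, (a k * a l) * (chi μ (φ k) x * chi μ (φ l) x) := by
    intro x
    rw [sq, sum_mul_sum]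
    exact sum_congr rfl fun k _ => sum_congr rfl fun l _ => by ring
  simp_rw [this]
  rw [expect_sum]
  refine sum_congr rfl fun k hk => ?_
  rw [expect_sum, sum_eq_single_of_mem k hk]
  · rw [expect_const_mul, expect_chi_mul_chi hμ]
    simp [sq]
  · intro l hl hlk
    rw [expect_const_mul, expect_chi_mul_chi hμ, if_neg, mul_zero]
    exact fun h => hlk (hφ hl hk h.symm)

/-- Parseval's identity. -/
lemma expect_sq (hμ : ∀ i, μ i ^ 2 < 1) (g : Cube n → ℝ) :
    expect μ (fun x => g x ^ 2) = ∑ S, fourier μ g S ^ 2 := by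
  rw [← expect_sq_sum_chi hμ univ (fourier μ g) id Function.injective_id.injOn]
  simp [sum_fourier hμ]

/-- The squared distance between `f` and a part of its Fourier expansion. -/
lemma expect_sq_sub_sum (hμ : ∀ i, μ i ^ 2 < 1) (g : Cube n → ℝ) (A : Finset (Finset (Fin n))) :
    expect μ (fun x => (∑ S ∈ A, fourier μ g S * chi μ S x - g x) ^ 2) =
      ∑ S ∈ Aᶜ, fourier μ g S ^ 2 := by
  rw [← expect_sq_sum_chi hμ Aᶜ (fourier μ g) id Function.injective_id.injOn]
  congr 1
  funext x
  have := sum_fourier hμ g x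
  rw [← sum_add_sum_compl A] at this
  rw [← this]
  simp

lemma expect_fSub_sq (hμ : ∀ i, μ i ^ 2 < 1) (f : Cube n → ℤˣ) (S : Finset (Fin n)) :
    expect μ (fun x => fSub μ f S x ^ 2) = ∑ T with S ⊆ T, coeff μ f T ^ 2 := by
  rw [← expect_sq_sum_chi hμ _ _ (fun T => T \ S)]
  · rfl
  · intro T hT U hU h
    simp only [coe_filter, mem_univ, true_and, Set.mem_ofPred_eq] at hT hU h
    rw [← sdiff_union_of_subset hT, h, sdiff_union_of_subset hU]

lemma coeff_sq_le_expect (hμ : ∀ i, μ i ^ 2 < 1) (f : Cube n → ℤˣ) (S : Finset (Fin n)) :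
    coeff μ f S ^ 2 ≤ expect μ (fun x => fSub μ f S x ^ 2) := by
  rw [expect_fSub_sq hμ]
  exact single_le_sum (f := fun T => coeff μ f T ^ 2) (fun T _ => sq_nonneg _) (by simp)

/-- Supersets of `S` are supersets of `S'`, so the weight above `S` is part of the weight above
`S'`. This monotonicity justifies growing sets greedily. -/
lemma expect_fSub_sq_anti (hμ : ∀ i, μ i ^ 2 < 1) (f : Cube n → ℤˣ) {S S' : Finset (Fin n)}
    (h : S' ⊆ S) :
    expect μ (fun x => fSub μ f S x ^ 2) ≤ expect μ (fun x => fSub μ f S' x ^ 2) := by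
  rw [expect_fSub_sq hμ, expect_fSub_sq hμ]
  refine sum_le_sum_of_subset_of_nonneg (fun T hT => ?_) fun _ _ _ => sq_nonneg _
  simp only [mem_filter, mem_univ, true_and] at hT ⊢
  exact h.trans hT

/-- The part of the Fourier expansion above `S` is a local average of `f`. -/
theorem fSub_eq_queryAvg (hμ : ∀ i, μ i ^ 2 < 1) (f : Cube n → ℤˣ) (S : Finset (Fin n))
    (x : Cube n) : fSub μ f S x = queryAvg μ f S x := by
  -- Only the coordinates in `S` are averaged. Those outside `T` contribute the mean `0` of a
  -- character, those inside `T` contribute `1`, and the fixed coordinates leave `χ_{T \ S}(x)`.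
  have key : ∀ T, ∑ y ∈ flips S x, (∏ i ∈ S, (1 + μ i * bit y i) / 2) *
      (chi μ T y * chi μ S y) = if S ⊆ T then chi μ (T \ S) x else 0 := by
    intro T
    have h : ∀ y : Cube n, (∏ i ∈ S, (1 + μ i * bit y i) / 2) * (chi μ T y * chi μ S y) =
        ∏ i, ((if i ∈ S then marg μ i (y i) else 1) *
          ((if i ∈ T then chiOne μ i (y i) else 1) *
            (if i ∈ S then chiOne μ i (y i) else 1))) := by
      intro y
      rw [prod_mul_distrib, prod_mul_distrib, ← chi_eq_univ, ← chi_eq_univ, Fintype.prod_ite_mem]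
      rfl
    rw [sum_congr rfl fun y _ => h y, sum_flips_prod S x (fun i b =>
      ((if i ∈ S then marg μ i b else 1) * ((if i ∈ T then chiOne μ i b else 1) *
            (if i ∈ S then chiOne μ i b else 1))))]
    split_ifs with hST
    · rw [chi_eq_univ]
      refine prod_congr rfl fun i _ => ?_
      by_cases hi : i ∈ S
      · simpa [hi, hST hi] using marg_mul_chiOne_sq_add hμ i
      · simp [hi]
    · obtain ⟨i, hiS, hiT⟩ := not_subset.1 hST
      refine prod_eq_zero (mem_univ i) ?_
      simpa [hiS, hiT] using marg_mul_chiOne_add hμ i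
  have hf : ∀ y, toReal f y = ∑ T, coeff μ f T * chi μ T y :=
    fun y => (sum_fourier hμ (toReal f) y).symm
  rw [queryAvg]
  simp_rw [hf, sum_mul, mul_sum]
  rw [sum_comm, fSub, sum_filter]
  refine sum_congr rfl fun T _ => ?_
  have := congrArg (coeff μ f T * ·) (key T)
  simp only [mul_sum] at this
  rw [sum_congr rfl fun y _ => ?_, this]
  · split_ifs <;> simp
  · ring

/-- Flip the bits in `T`. -/
def flipOn (T : Finset (Fin n)) (x : Cube n) : Cube n := fun i => if i ∈ T then -x i else x i

/-- The alternating sum of `f` over the points that agree with `x` outside `S`. -/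
def altSum (f : Cube n → ℤˣ) (S : Finset (Fin n)) (x : Cube n) : ℤ :=
  ∑ T ∈ S.powerset, (-1) ^ (S \ T).card * (f (flipOn T x) : ℤ)

lemma sum_flips (S : Finset (Fin n)) (x : Cube n) (φ : Cube n → ℝ) :
    ∑ y ∈ flips S x, φ y = ∑ T ∈ S.powerset, φ (flipOn T x) := by
  symm
  refine sum_bij (fun T _ => flipOn T x) ?_ ?_ ?_ fun _ _ => rfl
  · intro T hT
    simp only [flips, mem_filter, mem_univ, true_and]
    intro i hi
    have : i ∉ T := fun h => hi (mem_powerset.1 hT h)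
    simp [flipOn, this]
  · intro T _ U _ h
    ext i
    have := congrFun h i
    simp only [flipOn] at this
    by_cases h1 : i ∈ T <;> by_cases h2 : i ∈ U <;> simp [h1, h2] at this ⊢
  · intro y hy
    simp only [flips, mem_filter, mem_univ, true_and] at hy
    refine ⟨S.filter (fun i => y i ≠ x i), by simp, ?_⟩
    funext i
    by_cases hi : i ∈ S
    · by_cases h : y i = x i
      · simp [flipOn, hi, h]
      · simp only [flipOn, hi, mem_filter, true_and, ne_eq, h, not_false_eq_true, if_true]
        rcases Int.units_eq_one_or (y i) with h1 | h1 <;>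
          rcases Int.units_eq_one_or (x i) with h2 | h2 <;> simp_all
    · simp [flipOn, hi, hy i hi]

lemma card_flips (S : Finset (Fin n)) (x : Cube n) : (flips S x).card = 2 ^ S.card := by
  have := sum_flips S x (fun _ => 1)
  simp only [sum_const, nsmul_eq_mul, mul_one, card_powerset] at this
  exact_mod_cast this

lemma hammingDist_flips {S : Finset (Fin n)} {x y : Cube n} (hy : y ∈ flips S x) :
    hammingDist x y ≤ S.card := by
  refine card_le_card fun i hi => ?_
  by_contra h
  simp only [flips, mem_filter, mem_univ, true_and] at hy hi
  exact hi (hy i h).symm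

lemma flipOn_mem_flips {S T : Finset (Fin n)} (h : T ⊆ S) (x : Cube n) :
    flipOn T x ∈ flips S x := by
  simp only [flips, mem_filter, mem_univ, true_and]
  intro i hi
  have : i ∉ T := fun h' => hi (h h')
  simp [flipOn, this]

/-- Each of the `2^|S|` points of the local average carries the same weight up to sign, by
`marg_mul_chiOne`. The dependence on `μ` therefore comes out as a factor, and the integer `altSum`
is available without knowing `μ`. -/
lemma fSub_eq_altSum (hμ : ∀ i, μ i ^ 2 < 1) (f : Cube n → ℤˣ) (S : Finset (Fin n))
    (x : Cube n) : fSub μ f S x =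
      (∏ i ∈ S, Real.sqrt (1 - μ i ^ 2) / 2 * -bit x i) * altSum f S x := by
  rw [fSub_eq_queryAvg hμ, queryAvg, sum_flips]
  simp only [altSum, Int.cast_sum, mul_sum]
  refine sum_congr rfl fun T hT => ?_
  rw [mem_powerset] at hT
  have h1 : (∏ i ∈ S, (1 + μ i * bit (flipOn T x) i) / 2) * chi μ S (flipOn T x) =
      ∏ i ∈ S, (Real.sqrt (1 - μ i ^ 2) / 2 * -bit x i) * (if i ∈ T then 1 else -1) := by
    rw [chi_eq, ← prod_mul_distrib]
    refine prod_congr rfl fun i _ => ?_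
    refine (marg_mul_chiOne hμ i (flipOn T x i)).trans ?_
    by_cases hi : i ∈ T <;> simp [flipOn, hi, bit]
  have h2 : (∏ i ∈ S, if i ∈ T then (1 : ℝ) else -1) = (-1) ^ (S \ T).card := by
    rw [prod_ite]
    simp [filter_notMem_eq_sdiff]
  calc _ = ((∏ i ∈ S, (1 + μ i * bit (flipOn T x) i) / 2) * chi μ S (flipOn T x)) *
        toReal f (flipOn T x) := by ring
    _ = _ := by
      rw [h1, prod_mul_distrib, h2]
      simp [toReal, mul_assoc]

lemma fSub_sq (hμ : ∀ i, μ i ^ 2 < 1) (f : Cube n → ℤˣ) (S : Finset (Fin n)) (x : Cube n) :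
    fSub μ f S x ^ 2 = (∏ i ∈ S, (1 - μ i ^ 2) / 4) * (altSum f S x : ℝ) ^ 2 := by
  rw [fSub_eq_altSum hμ, mul_pow, ← prod_pow]
  congr 1
  refine prod_congr rfl fun i _ => ?_
  have h2 := Real.sq_sqrt (show (0 : ℝ) ≤ 1 - μ i ^ 2 by linarith [hμ i])
  have h3 := bit_sq x i
  calc _ = Real.sqrt (1 - μ i ^ 2) ^ 2 / 4 * (bit x i * bit x i) := by ring
    _ = _ := by rw [h2, h3, mul_one]

lemma abs_altSum_le (f : Cube n → ℤˣ) (S : Finset (Fin n)) (x : Cube n) :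
    |(altSum f S x : ℝ)| ≤ 2 ^ S.card := by
  rw [altSum, Int.cast_sum]
  refine (abs_sum_le_sum_abs _ _).trans ?_
  have : ∀ T ∈ S.powerset, |(((-1) ^ (S \ T).card * (f (flipOn T x) : ℤ) : ℤ) : ℝ)| ≤ 1 := by
    intro T _
    rcases Int.units_eq_one_or (f (flipOn T x)) with h | h <;> simp [h]
  refine (sum_le_sum this).trans ?_
  simp

/-- The homogeneous part of `f` at `S` as an average of alternating sums. -/
theorem coeff_mul_chi (hμ : ∀ i, μ i ^ 2 < 1) (f : Cube n → ℤˣ) (S : Finset (Fin n))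
    (x : Cube n) : coeff μ f S * chi μ S x =
      expect μ (fun y => (∏ i ∈ S, (1 - bit x i * bit y i) / 2) * altSum f S y) := by
  -- The first product is the indicator that `y` is opposite to `x` on `S`. On that event `-bit y i
  -- = bit x i`, so the factor in `fSub_eq_altSum` can be cancelled by a constant depending only on
  -- `x`, and `fSub` is then expanded in characters.
  have h1 : ∀ y : Cube n, (∏ i ∈ S, (1 - bit x i * bit y i) / 2) * (altSum f S y : ℝ) =
      ∑ T with S ⊆ T, coeff μ f T * (∏ i ∈ S, 2 * bit x i / Real.sqrt (1 - μ i ^ 2)) *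
        ((∏ i ∈ S, (1 - bit x i * bit y i) / 2) * chi μ (T \ S) y) := by
    intro y
    have e : (∏ i ∈ S, (1 - bit x i * bit y i) / 2) * (altSum f S y : ℝ) =
        (∏ i ∈ S, 2 * bit x i / Real.sqrt (1 - μ i ^ 2)) *
          ((∏ i ∈ S, (1 - bit x i * bit y i) / 2) * fSub μ f S y) := by
      rw [fSub_eq_altSum hμ]
      have : (∏ i ∈ S, 2 * bit x i / Real.sqrt (1 - μ i ^ 2)) *
          (∏ i ∈ S, (1 - bit x i * bit y i) / 2) *
          (∏ i ∈ S, Real.sqrt (1 - μ i ^ 2) / 2 * -bit y i) =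
          ∏ i ∈ S, (1 - bit x i * bit y i) / 2 := by
        rw [← prod_mul_distrib, ← prod_mul_distrib]
        refine prod_congr rfl fun i _ => ?_
        have h := (sqrt_pos hμ i).ne'
        rcases Int.units_eq_one_or (x i) with h1 | h1 <;>
          rcases Int.units_eq_one_or (y i) with h2 | h2 <;> simp [bit, h1, h2] <;>
          first | exact h | field_simp
      rw [← mul_assoc, ← mul_assoc, this]
    rw [e, fSub, mul_sum, mul_sum]
    exact sum_congr rfl fun T _ => by ring
  simp_rw [h1]
  rw [expect_sum]
  -- The indicator depends only on the bits in `S`, so any character left over on `T \ S` averages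
  -- to zero. Only the term `T = S` survives.
  have h2 : ∀ T, S ⊆ T →
      expect μ (fun y => (∏ i ∈ S, (1 - bit x i * bit y i) / 2) * chi μ (T \ S) y) =
        if T = S then ∏ i ∈ S, (1 - bit x i * μ i) / 2 else 0 := by
    intro T hT
    have h : ∀ y : Cube n, prodDist μ y * ((∏ i ∈ S, (1 - bit x i * bit y i) / 2) *
        chi μ (T \ S) y) = ∏ i, (marg μ i (y i) *
          ((if i ∈ S then (1 - bit x i * ((y i : ℤ) : ℝ)) / 2 else 1) *
          (if i ∈ T \ S then chiOne μ i (y i) else 1))) := by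
      intro y
      rw [prod_mul_distrib, prod_mul_distrib, ← chi_eq_univ, Fintype.prod_ite_mem, prodDist_eq]
      rfl
    rw [expect, sum_congr rfl fun y _ => h y, sum_cube_prod (fun i b => (marg μ i b *
          ((if i ∈ S then (1 - bit x i * ((b : ℤ) : ℝ)) / 2 else 1) *
          (if i ∈ T \ S then chiOne μ i b else 1))))]
    split_ifs with hTS
    · rw [← Fintype.prod_ite_mem S]
      refine prod_congr rfl fun i _ => ?_
      by_cases hi : i ∈ S
      · simp [hi, hTS, marg]; ring
      · simpa [hi, hTS] using marg_add i
    · obtain ⟨i, hiT, hiS⟩ := exists_of_ssubset (hT.ssubset_of_ne (Ne.symm hTS))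
      refine prod_eq_zero (mem_univ i) ?_
      simpa [hiS, hiT] using marg_mul_chiOne_add hμ i
  rw [sum_eq_single_of_mem S (by simp)]
  · rw [expect_const_mul, h2 S subset_rfl, if_pos rfl, mul_assoc, ← prod_mul_distrib, chi]
    congr 1
    refine prod_congr rfl fun i _ => ?_
    have h := (sqrt_pos hμ i).ne'
    have := bit_sq x i
    field_simp
    linear_combination μ i * this
  · intro T hT hTS
    rw [expect_const_mul, h2 T (by simpa using hT), if_neg hTS, mul_zero]

end Fourier

/-! ### Decision trees under a product distribution -/

section Trees

variable {n : ℕ} {μ : Fin n → ℝ}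

/-- `g` does not depend on the bit `i`. -/
def IndepOf {α : Type*} (g : Cube n → α) (i : Fin n) : Prop :=
  ∀ x b, g (Function.update x i b) = g x

lemma flipOn_singleton (i : Fin n) (x : Cube n) :
    flipOn {i} x = Function.update x i (-x i) := by
  funext j
  by_cases h : j = i
  · subst h; simp [flipOn]
  · simp [flipOn, h]

lemma flipOn_flipOn (T : Finset (Fin n)) (x : Cube n) : flipOn T (flipOn T x) = x := by
  funext j
  by_cases h : j ∈ T <;> simp [flipOn, h]

/-- Flipping bit `i` negates every summand, because `(1 + μ_i x_i)(x_i - μ_i) = (1 - μ_i²) x_i`; the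
sum is therefore its own negative. -/
lemma expect_bit_sub_mul {i : Fin n} {g : Cube n → ℝ} (hg : IndepOf g i) :
    expect μ (fun x => (bit x i - μ i) * g x) = 0 := by
  have inv : Function.Involutive (flipOn {i} : Cube n → Cube n) := flipOn_flipOn _
  have h1 : ∀ x : Cube n, prodDist μ (flipOn {i} x) * ((bit (flipOn {i} x) i - μ i) *
      g (flipOn {i} x)) = -(prodDist μ x * ((bit x i - μ i) * g x)) := by
    intro x
    have hr : ∏ j ∈ univ.erase i, marg μ j (flipOn {i} x j) =
        ∏ j ∈ univ.erase i, marg μ j (x j) := by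
      refine prod_congr rfl fun j hj => ?_
      rw [flipOn_singleton, Function.update_of_ne (ne_of_mem_erase hj)]
    rw [prodDist_eq, prodDist_eq, ← mul_prod_erase univ _ (mem_univ i), hr,
      ← mul_prod_erase univ (fun j => marg μ j (x j)) (mem_univ i), flipOn_singleton, hg]
    have h := bit_sq x i
    simp only [bit] at h
    simp only [bit, marg, Function.update_self, Units.val_neg, Int.cast_neg]
    linear_combination (μ i * g x * ∏ j ∈ univ.erase i, (1 + μ j * ((x j : ℤ) : ℝ)) / 2) * h
  have h2 := Equiv.sum_comp inv.toPerm (fun x => prodDist μ x * ((bit x i - μ i) * g x))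
  simp only [Function.Involutive.coe_toPerm, h1, sum_neg_distrib] at h2
  rw [expect]
  linarith

lemma expect_ite {i : Fin n} {g h : Cube n → ℝ} (hg : IndepOf g i) (hh : IndepOf h i) :
    expect μ (fun x => if x i = 1 then g x else h x) =
      (1 + μ i) / 2 * expect μ g + (1 - μ i) / 2 * expect μ h := by
  have : ∀ x : Cube n, (if x i = 1 then g x else h x) =
      ((1 + μ i) / 2 * g x + (1 - μ i) / 2 * h x) +
        (1 / 2 * ((bit x i - μ i) * g x) - 1 / 2 * ((bit x i - μ i) * h x)) := by
    intro x
    rcases Int.units_eq_one_or (x i) with h1 | h1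
    · simp [bit, h1]; ring
    · simp [bit, h1]; ring
  simp_rw [this]
  rw [expect_add, expect_add, expect_sub, expect_const_mul, expect_const_mul, expect_const_mul,
    expect_const_mul, expect_bit_sub_mul hg, expect_bit_sub_mul hh]
  ring

/-- The alternating sum is an iterated discrete derivative, one difference for each coordinate of
`S`. The recursion along a tree rests on this. -/
lemma altSum_insert (f : Cube n → ℤˣ) {i : Fin n} {S : Finset (Fin n)} (hi : i ∉ S)
    (x : Cube n) : altSum f (insert i S) x = altSum f S (flipOn {i} x) - altSum f S x := by
  rw [altSum, sum_powerset_insert hi, altSum, altSum, add_comm, sub_eq_add_neg,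
    ← sum_neg_distrib]
  refine congrArg₂ _ (sum_congr rfl fun T hT => ?_) (sum_congr rfl fun T hT => ?_)
  · have hT' : i ∉ T := fun h => hi (mem_powerset.1 hT h)
    rw [insert_sdiff_insert, sdiff_insert_of_notMem hi]
    have : flipOn (insert i T) x = flipOn T (flipOn {i} x) := by
      funext j
      by_cases hj : j = i
      · subst hj; simp [flipOn, hT']
      · simp [flipOn, hj]
    rw [this]
  · have hT' : i ∉ T := fun h => hi (mem_powerset.1 hT h)
    rw [insert_sdiff_of_notMem _ hT', card_insert_of_notMem (by simp [hi]), pow_succ]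
    ring

lemma altSum_update {f : Cube n → ℤˣ} {i : Fin n} (hf : IndepOf f i) (S : Finset (Fin n)) :
    IndepOf (altSum f S) i := by
  intro x b
  refine sum_congr rfl fun T _ => ?_
  congr 2
  rw [← hf (flipOn T x) (if i ∈ T then -b else b)]
  congr 1
  funext j
  by_cases hj : j = i
  · subst hj; simp [flipOn]
  · simp [flipOn, hj]

lemma altSum_eq_zero {f : Cube n → ℤˣ} {i : Fin n} (hf : IndepOf f i) {S : Finset (Fin n)}
    (hi : i ∈ S) (x : Cube n) : altSum f S x = 0 := by
  rw [← insert_erase hi, altSum_insert f (notMem_erase i S), flipOn_singleton, altSum_update hf,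
    sub_self]

lemma altSum_ite {a b : Cube n → ℤˣ} {i : Fin n} {S : Finset (Fin n)} (hi : i ∉ S) (x : Cube n) :
    altSum (fun x => if x i = 1 then b x else a x) S x =
      if x i = 1 then altSum b S x else altSum a S x := by
  have : ∀ T ∈ S.powerset, flipOn T x i = x i := by
    intro T hT
    have hT' : i ∉ T := fun h => hi (mem_powerset.1 hT h)
    simp [flipOn, hT']
  unfold altSum
  split_ifs with h <;>
  · refine sum_congr rfl fun T hT => ?_
    simp [this T hT, h]

/-- The probability that the alternating sum of `f` over `S` does not vanish. -/
noncomputable def sensProb (μ : Fin n → ℝ) (f : Cube n → ℤˣ) (S : Finset (Fin n)) : ℝ :=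
  expect μ (fun x => if altSum f S x = 0 then 0 else 1)

lemma sensProb_nonneg (hμ : ∀ i, μ i ^ 2 < 1) (f : Cube n → ℤˣ) (S : Finset (Fin n)) :
    0 ≤ sensProb μ f S :=
  expect_nonneg hμ fun x => by split_ifs <;> norm_num

/-- The inequality holds pointwise: the square of the alternating sum is at most `4^|S|`, and the
normalising product in `fSub_sq` is at most `4^{-|S|}`. -/
lemma expect_fSub_sq_le_sensProb (hμ : ∀ i, μ i ^ 2 < 1) (f : Cube n → ℤˣ)
    (S : Finset (Fin n)) : expect μ (fun x => fSub μ f S x ^ 2) ≤ sensProb μ f S := by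
  refine expect_mono hμ fun x => ?_
  rw [fSub_sq hμ]
  split_ifs with h
  · simp [h]
  · have h1 : (altSum f S x : ℝ) ^ 2 ≤ 4 ^ S.card := by
      have := sq_le_sq' (by linarith [neg_abs_le (altSum f S x : ℝ), abs_altSum_le f S x])
        ((le_abs_self _).trans (abs_altSum_le f S x))
      rwa [← pow_mul, mul_comm, pow_mul, show (2 : ℝ) ^ 2 = 4 by norm_num] at this
    have h2 : ∏ i ∈ S, (1 - μ i ^ 2) / 4 ≤ (1 / 4) ^ S.card := by
      rw [← prod_const]
      refine prod_le_prod (fun i _ => ?_) fun i _ => ?_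
      · linarith [hμ i]
      · linarith [sq_nonneg (μ i)]
    calc _ ≤ (1 / 4 : ℝ) ^ S.card * 4 ^ S.card :=
          mul_le_mul h2 h1 (sq_nonneg _) (by positivity)
      _ = 1 := by rw [← mul_pow]; norm_num

/-- Replace the bits of `x` in `U` by those of `z`. -/
def override (U : Finset (Fin n)) (z x : Cube n) : Cube n := fun i => if i ∈ U then z i else x i

lemma override_empty (z x : Cube n) : override ∅ z x = x := by
  funext i; simp [override]

lemma override_indep {α : Type*} (g : Cube n → α) {U : Finset (Fin n)} {i : Fin n} (hi : i ∈ U)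
    (z : Cube n) : IndepOf (fun x => g (override U z x)) i := by
  intro x b
  refine congrArg g (funext fun j => ?_)
  by_cases hj : j = i
  · subst hj; simp [override, hi]
  · simp [override, hj]

lemma override_insert {U : Finset (Fin n)} {i : Fin n} (hi : i ∉ U) (z : Cube n) {x : Cube n}
    {b : ℤˣ} (hb : x i = b) :
    override (insert i U) (Function.update z i b) x = override U z x := by
  funext j
  by_cases hj : j = i
  · subst hj; simp [override, hi, hb]
  · simp [override, hj]

/-- `U` and `z` record the bits already fixed along the path. Adding `i` to `U` makes both branch
functions independent of bit `i`, even if the subtrees query it again, so conditioning on that bit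
is legitimate. -/
lemma DecTree.eval_node_override {i : Fin n} (a b : DecTree n) {U : Finset (Fin n)}
    (hi : i ∉ U) (z : Cube n) :
    (fun x => (DecTree.node i a b).eval (override U z x)) = fun x =>
      if x i = 1 then b.eval (override (insert i U) (Function.update z i 1) x)
      else a.eval (override (insert i U) (Function.update z i (-1)) x) := by
  funext x
  have h : override U z x i = x i := by simp [override, hi]
  rw [DecTree.eval, h]
  rcases Int.units_eq_one_or (x i) with hx | hx
  · rw [if_pos hx, if_pos hx, override_insert hi z hx]
  · have : x i ≠ 1 := by rw [hx]; decide
    rw [if_neg this, if_neg this, override_insert hi z hx]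

lemma DecTree.one_le_leaves (T : DecTree n) : 1 ≤ T.leaves := by
  induction T with
  | leaf b => exact le_rfl
  | node i a b ha hb => simp only [DecTree.leaves]; omega

/-! ### Sensitivity and Fourier concentration of decision trees -/

section Bounds

variable {c : ℝ}

lemma sq_lt_one_of_mem (hc : 0 < c) {a : ℝ} (h : a ∈ Set.Icc (-1 + 2 * c) (1 - 2 * c)) :
    a ^ 2 < 1 := by
  rw [sq_lt_one_iff_abs_lt_one, abs_lt]
  constructor <;> linarith [h.1, h.2]

lemma sum_finset_split (i : Fin n) (F : Finset (Fin n) → ℝ) :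
    ∑ S, F S = ∑ S ∈ (univ.erase i).powerset, (F S + F (insert i S)) := by
  rw [sum_add_distrib, ← sum_powerset_insert (notMem_erase i univ), insert_erase (mem_univ i),
    powerset_univ]

/-- The weighted number of sets over which a tree is sensitive is at most its size. -/
theorem sum_sensProb_le (hc : 0 < c)
    (hμ : ∀ i, μ i ∈ Set.Icc (-1 + 2 * c) (1 - 2 * c))
    (T : DecTree n) : ∀ (U : Finset (Fin n)) (z : Cube n),
    ∑ S, c ^ S.card * sensProb μ (fun x => T.eval (override U z x)) S ≤ T.leaves := by
  have hμ' : ∀ i, μ i ^ 2 < 1 := fun i => sq_lt_one_of_mem hc (hμ i)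
  induction T with
  | leaf b =>
    intro U z
    rw [sum_eq_single_of_mem ∅ (mem_univ _)]
    · have : sensProb μ (fun x => (DecTree.leaf b).eval (override U z x)) ∅ ≤ expect μ fun _ => 1 :=
        expect_mono hμ' fun x => by split_ifs <;> norm_num
      simpa [expect_const, DecTree.leaves] using this
    · intro S _ hS
      obtain ⟨i, hi⟩ := nonempty_iff_ne_empty.2 hS
      have : ∀ x, altSum (fun x => (DecTree.leaf b).eval (override U z x)) S x = 0 :=
        altSum_eq_zero (i := i) (fun _ _ => rfl) hi
      simp [sensProb, this, expect]
  | node i a b iha ihb =>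
    intro U z
    -- A repeated query on the path always goes the same way, so the node can be replaced by one of
    -- its children.
    by_cases hi : i ∈ U
    · have hl : ((DecTree.node i a b).leaves : ℝ) = a.leaves + b.leaves := by
        simp [DecTree.leaves]
      have : (fun x => (DecTree.node i a b).eval (override U z x)) = fun x =>
          (if z i = 1 then b else a).eval (override U z x) := by
        funext x
        have : override U z x i = z i := by simp [override, hi]
        rw [DecTree.eval, this]
        split_ifs <;> rfl
      rw [this, hl]
      split_ifs
      · exact (ihb U z).trans (by simp)
      · exact (iha U z).trans (by simp)
    · rw [DecTree.eval_node_override a b hi]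
      set fb := fun x => b.eval (override (insert i U) (Function.update z i 1) x) with hfb
      set fa := fun x => a.eval (override (insert i U) (Function.update z i (-1)) x) with hfa
      have ib : IndepOf fb i := override_indep _ (mem_insert_self i U) _
      have ia : IndepOf fa i := override_indep _ (mem_insert_self i U) _
      have key : ∀ S ∈ (univ.erase i).powerset,
          (c ^ S.card * sensProb μ (fun x => if x i = 1 then fb x else fa x) S +
            c ^ (insert i S).card *
              sensProb μ (fun x => if x i = 1 then fb x else fa x) (insert i S)) ≤
          c ^ S.card * sensProb μ fa S + c ^ S.card * sensProb μ fb S := by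
        intro S hS
        have hiS : i ∉ S := fun h => by simpa using mem_powerset.1 hS h
        have na := sensProb_nonneg hμ' fa S
        have nb := sensProb_nonneg hμ' fb S
        -- Each value of bit `i` has probability at most `1 - c`, and the branch functions do not
        -- depend on that bit.
        have h1 : sensProb μ (fun x => if x i = 1 then fb x else fa x) S ≤
            (1 - c) * (sensProb μ fa S + sensProb μ fb S) := by
          have e : sensProb μ (fun x => if x i = 1 then fb x else fa x) S =
              (1 + μ i) / 2 * sensProb μ fb S + (1 - μ i) / 2 * sensProb μ fa S := by
            rw [sensProb, sensProb, sensProb, ← expect_ite (i := i)]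
            · congr 1
              funext x
              rw [altSum_ite hiS]
              split_ifs <;> rfl
            · intro x u; simp only [altSum_update ib S x u]
            · intro x u; simp only [altSum_update ia S x u]
          rw [e]
          nlinarith [(hμ i).1, (hμ i).2]
        -- Differentiating in direction `i` gives, up to sign, the difference of the two branch
        -- sums; it can be nonzero only where one of them is. This term carries an extra factor `c`,
        -- which together with the `1 - c` of `h1` makes `1`.
        have h2 : sensProb μ (fun x => if x i = 1 then fb x else fa x) (insert i S) ≤
            sensProb μ fa S + sensProb μ fb S := by
          rw [sensProb, sensProb, sensProb, ← expect_add]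
          refine expect_mono hμ' fun x => ?_
          rw [altSum_insert _ hiS, altSum_ite hiS, altSum_ite hiS, flipOn_singleton,
            altSum_update ia, altSum_update ib]
          by_cases ha : altSum fa S x = 0 <;> by_cases hb : altSum fb S x = 0 <;>
            simp only [ha, hb, ite_self, sub_self, if_true, if_false] <;>
            (try split_ifs) <;> norm_num
        rw [card_insert_of_notMem hiS, pow_succ]
        have h3 : 0 ≤ c ^ S.card := pow_nonneg hc.le _
        have h4 := mul_le_mul_of_nonneg_left h1 h3
        have h5 := mul_le_mul_of_nonneg_left h2 (mul_nonneg h3 hc.le)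
        nlinarith
      have sub : ∀ g : Cube n → ℤˣ, ∑ S ∈ (univ.erase i).powerset, c ^ S.card * sensProb μ g S ≤
          ∑ S, c ^ S.card * sensProb μ g S := fun g =>
        sum_le_sum_of_subset_of_nonneg (subset_univ _) fun S _ _ =>
          mul_nonneg (pow_nonneg hc.le _) (sensProb_nonneg hμ' g S)
      rw [sum_finset_split i]
      refine (sum_le_sum key).trans ?_
      rw [sum_add_distrib]
      simp only [DecTree.leaves, Nat.cast_add]
      exact add_le_add ((sub fa).trans (iha _ _)) ((sub fb).trans (ihb _ _))

/-- A tree is sensitive over few sets of low degree. -/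
lemma card_mul_le_leaves (hc : 0 < c) (hc' : c ≤ 1)
    (hμ : ∀ i, μ i ∈ Set.Icc (-1 + 2 * c) (1 - 2 * c)) (T : DecTree n) {d : ℕ} {τ : ℝ}
    (𝒜 : Finset (Finset (Fin n))) (h𝒜 : ∀ S ∈ 𝒜, S.card ≤ d ∧ τ ≤ sensProb μ T.eval S) :
    𝒜.card * (c ^ d * τ) ≤ T.leaves := by
  have hμ' : ∀ i, μ i ^ 2 < 1 := fun i => sq_lt_one_of_mem hc (hμ i)
  have h := sum_sensProb_le hc hμ T ∅ 1
  simp only [override_empty] at h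
  refine le_trans ?_ h
  rw [← nsmul_eq_mul, ← sum_const]
  calc _ ≤ ∑ S ∈ 𝒜, c ^ S.card * sensProb μ T.eval S := by
        refine sum_le_sum fun S hS => ?_
        exact (mul_le_mul_of_nonneg_left (h𝒜 S hS).2 (pow_nonneg hc.le _)).trans
          (mul_le_mul_of_nonneg_right (pow_le_pow_of_le_one hc.le hc' (h𝒜 S hS).1)
            (sensProb_nonneg hμ' _ _))
    _ ≤ _ := sum_le_sum_of_subset_of_nonneg (subset_univ _) fun S _ _ =>
        mul_nonneg (pow_nonneg hc.le _) (sensProb_nonneg hμ' _ _)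

/-- A bit is `√(1 - μ_i²)` times its own character plus the constant `μ_i`, so multiplying by it
only adds `i` to some of the sets. -/
lemma bit_mul_mem_span (hμ : ∀ i, μ i ^ 2 < 1) {𝓕 : Finset (Finset (Fin n))} {i : Fin n}
    (hi : ∀ S ∈ 𝓕, i ∉ S)
    {g : Cube n → ℝ} (hg : g ∈ Submodule.span ℝ (chi μ '' 𝓕)) :
    (fun x => bit x i * g x) ∈ Submodule.span ℝ (chi μ '' ↑(𝓕 ∪ 𝓕.image (insert i))) := by
  induction hg using Submodule.span_induction with
  | mem g hg =>
    obtain ⟨S, hS, rfl⟩ := hg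
    have h : (fun x => bit x i * chi μ S x) =
        Real.sqrt (1 - μ i ^ 2) • chi μ (insert i S) + μ i • chi μ S := by
      funext x
      have := (sqrt_pos hμ i).ne'
      simp only [Pi.add_apply, Pi.smul_apply, smul_eq_mul, chi, prod_insert (hi S hS)]
      field_simp
      ring
    rw [h]
    refine Submodule.add_mem _ (Submodule.smul_mem _ _ (Submodule.subset_span ⟨insert i S, ?_, rfl⟩))
      (Submodule.smul_mem _ _ (Submodule.subset_span ⟨S, ?_, rfl⟩))
    · simp only [coe_union, coe_image]
      exact Or.inr ⟨S, hS, rfl⟩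
    · simp only [coe_union]
      exact Or.inl hS
  | zero =>
    have : (fun x => bit x i * (0 : Cube n → ℝ) x) = 0 := by
      funext x; simp
    rw [this]
    exact Submodule.zero_mem _
  | add g h _ _ hg hh =>
    have : (fun x => bit x i * (g + h) x) =
        (fun x => bit x i * g x) + fun x => bit x i * h x := by
      funext x; simp [mul_add]
    rw [this]
    exact Submodule.add_mem _ hg hh
  | smul a g _ hg =>
    have : (fun x => bit x i * (a • g) x) = a • fun x => bit x i * g x := by
      funext x; simp; ring
    rw [this]
    exact Submodule.smul_mem _ _ hg

lemma fourier_eq_zero (hμ : ∀ i, μ i ^ 2 < 1) {𝓕 : Finset (Finset (Fin n))} {g : Cube n → ℝ}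
    (hg : g ∈ Submodule.span ℝ (chi μ '' 𝓕)) {S : Finset (Fin n)} (hS : S ∉ 𝓕) :
    fourier μ g S = 0 := by
  induction hg using Submodule.span_induction with
  | mem g hg =>
    obtain ⟨T, hT, rfl⟩ := hg
    rw [fourier, expect_chi_mul_chi hμ, if_neg]
    rintro rfl
    exact hS hT
  | zero => simp [fourier, expect]
  | add g h _ _ hg hh =>
    simp only [fourier, Pi.add_apply, add_mul] at *
    rw [expect_add, hg, hh, add_zero]
  | smul a g _ hg =>
    simp only [fourier, Pi.smul_apply, smul_eq_mul, mul_assoc] at *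
    rw [expect_const_mul, hg, mul_zero]

/-- The selection by bit `i` is `(h + g)/2 + x_i (h - g)/2`. A query therefore at most doubles the
combined support of its branches and raises the degree by at most one. -/
lemma ite_mem_span (hμ : ∀ i, μ i ^ 2 < 1) {𝓐 𝓑 : Finset (Finset (Fin n))} {i : Fin n}
    (hA : ∀ S ∈ 𝓐, i ∉ S) (hB : ∀ S ∈ 𝓑, i ∉ S) {g h : Cube n → ℝ}
    (hg : g ∈ Submodule.span ℝ (chi μ '' 𝓐)) (hh : h ∈ Submodule.span ℝ (chi μ '' 𝓑)) :
    (fun x => if x i = 1 then h x else g x) ∈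
      Submodule.span ℝ (chi μ '' ↑((𝓐 ∪ 𝓑) ∪ (𝓐 ∪ 𝓑).image (insert i))) := by
  have hAB : ∀ S ∈ 𝓐 ∪ 𝓑, i ∉ S := by
    intro S hS
    rcases mem_union.1 hS with h | h
    · exact hA S h
    · exact hB S h
  have hg' : g ∈ Submodule.span ℝ (chi μ '' ↑(𝓐 ∪ 𝓑)) :=
    Submodule.span_mono (Set.image_mono (by simp)) hg
  have hh' : h ∈ Submodule.span ℝ (chi μ '' ↑(𝓐 ∪ 𝓑)) :=
    Submodule.span_mono (Set.image_mono (by simp)) hh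
  have up : Submodule.span ℝ (chi μ '' ↑(𝓐 ∪ 𝓑)) ≤
      Submodule.span ℝ (chi μ '' ↑((𝓐 ∪ 𝓑) ∪ (𝓐 ∪ 𝓑).image (insert i))) :=
    Submodule.span_mono (Set.image_mono (by
      rw [coe_union (𝓐 ∪ 𝓑)]; exact Set.subset_union_left))
  have e : (fun x => if x i = 1 then h x else g x) =
      (1 / 2 : ℝ) • (h + g) + (1 / 2 : ℝ) • (fun x => bit x i * (h - g) x) := by
    funext x
    rcases Int.units_eq_one_or (x i) with h1 | h1
    · simp [h1, bit]; ring
    · simp [h1, bit]; ring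
  rw [e]
  exact Submodule.add_mem _ (Submodule.smul_mem _ _ (up (Submodule.add_mem _ hh' hg')))
    (Submodule.smul_mem _ _ (bit_mul_mem_span hμ hAB (Submodule.sub_mem _ hh' hg')))

/-- A tree is close to a function with few Fourier coefficients, all of low degree. -/
theorem exists_sparse_approx (hc : 0 < c) (hc' : c ≤ 1)
    (hμ : ∀ i, μ i ∈ Set.Icc (-1 + 2 * c) (1 - 2 * c)) (T : DecTree n) :
    ∀ (d : ℕ) (U : Finset (Fin n)) (z : Cube n),
    ∃ (g : Cube n → ℝ) (𝓕 : Finset (Finset (Fin n))),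
      𝓕.card ≤ T.leaves * 2 ^ d ∧ (∀ S ∈ 𝓕, S.card ≤ d) ∧ (∀ S ∈ 𝓕, Disjoint S U) ∧
      (∀ i ∈ U, IndepOf g i) ∧ g ∈ Submodule.span ℝ (chi μ '' 𝓕) ∧
      expect μ (fun x => (toReal (fun x => T.eval (override U z x)) x - g x) ^ 2) ≤
        T.leaves * (1 - c) ^ d := by
  have hμ' : ∀ i, μ i ^ 2 < 1 := fun i => sq_lt_one_of_mem hc (hμ i)
  -- When no depth is left the tree is approximated by `0`. The squared error is then exactly `1`,
  -- which is at most the number of leaves.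
  have zero : ∀ (T : DecTree n) (U : Finset (Fin n)) (z : Cube n),
      ∃ (g : Cube n → ℝ) (𝓕 : Finset (Finset (Fin n))),
      𝓕.card ≤ T.leaves * 2 ^ 0 ∧ (∀ S ∈ 𝓕, S.card ≤ 0) ∧ (∀ S ∈ 𝓕, Disjoint S U) ∧
      (∀ i ∈ U, IndepOf g i) ∧ g ∈ Submodule.span ℝ (chi μ '' 𝓕) ∧
      expect μ (fun x => (toReal (fun x => T.eval (override U z x)) x - g x) ^ 2) ≤
        T.leaves * (1 - c) ^ 0 := by
    intro T U z
    refine ⟨0, ∅, by simp, by simp, by simp, fun _ _ _ _ => rfl, Submodule.zero_mem _, ?_⟩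
    have h : ∀ x, (toReal (fun x => T.eval (override U z x)) x - (0 : Cube n → ℝ) x) ^ 2 = 1 := by
      intro x
      rcases Int.units_eq_one_or (T.eval (override U z x)) with h | h <;> simp [toReal, h]
    simp_rw [h]
    rw [expect_const]
    simpa using T.one_le_leaves
  induction T with
  | leaf b =>
    intro d U z
    refine ⟨fun _ => ((b : ℤ) : ℝ), {∅}, ?_, by simp, by simp, fun _ _ _ _ => rfl, ?_, ?_⟩
    · simpa [DecTree.leaves] using Nat.one_le_two_pow
    · have : (fun _ : Cube n => ((b : ℤ) : ℝ)) = ((b : ℤ) : ℝ) • chi μ ∅ := by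
        funext x; simp [chi]
      rw [this]
      exact Submodule.smul_mem _ _ (Submodule.subset_span ⟨∅, by simp, rfl⟩)
    · have : (0 : ℝ) ≤ (1 - c) ^ d := pow_nonneg (by linarith) _
      simpa [toReal, DecTree.eval, expect, DecTree.leaves] using this
  | node i a b iha ihb =>
    intro d U z
    rcases d with _ | d
    · exact zero _ U z
    have hc1 : 0 ≤ 1 - c := by linarith
    by_cases hi : i ∈ U
    · have : (fun x => (DecTree.node i a b).eval (override U z x)) = fun x =>
          (if z i = 1 then b else a).eval (override U z x) := by
        funext x
        have : override U z x i = z i := by simp [override, hi]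
        rw [DecTree.eval, this]
        split_ifs <;> rfl
      rw [this]
      have hp := pow_nonneg hc1 (d + 1)
      have hla : a.leaves ≤ (DecTree.node i a b).leaves := by simp [DecTree.leaves]
      have hlb : b.leaves ≤ (DecTree.node i a b).leaves := by simp [DecTree.leaves]
      split_ifs
      · obtain ⟨g, 𝓕, h1, h2, h3, h4, h5, h6⟩ := ihb (d + 1) U z
        exact ⟨g, 𝓕, h1.trans (Nat.mul_le_mul_right _ hlb), h2, h3, h4, h5,
          h6.trans (mul_le_mul_of_nonneg_right (by exact_mod_cast hlb) hp)⟩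
      · obtain ⟨g, 𝓕, h1, h2, h3, h4, h5, h6⟩ := iha (d + 1) U z
        exact ⟨g, 𝓕, h1.trans (Nat.mul_le_mul_right _ hla), h2, h3, h4, h5,
          h6.trans (mul_le_mul_of_nonneg_right (by exact_mod_cast hla) hp)⟩
    · rw [DecTree.eval_node_override a b hi]
      obtain ⟨ga, 𝓐, a1, a2, a3, a4, a5, a6⟩ := iha d (insert i U) (Function.update z i (-1))
      obtain ⟨gb, 𝓑, b1, b2, b3, b4, b5, b6⟩ := ihb d (insert i U) (Function.update z i 1)
      set fb := fun x => b.eval (override (insert i U) (Function.update z i 1) x) with hfb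
      set fa := fun x => a.eval (override (insert i U) (Function.update z i (-1)) x) with hfa
      have ib : IndepOf fb i := override_indep _ (mem_insert_self i U) _
      have ia : IndepOf fa i := override_indep _ (mem_insert_self i U) _
      have hA : ∀ S ∈ 𝓐, i ∉ S := fun S hS h =>
        (disjoint_left.1 (a3 S hS)) h (mem_insert_self i U)
      have hB : ∀ S ∈ 𝓑, i ∉ S := fun S hS h =>
        (disjoint_left.1 (b3 S hS)) h (mem_insert_self i U)
      have a3' : ∀ S ∈ 𝓐, Disjoint S U := fun S hS =>
        (a3 S hS).mono_right (subset_insert i U)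
      have b3' : ∀ S ∈ 𝓑, Disjoint S U := fun S hS =>
        (b3 S hS).mono_right (subset_insert i U)
      refine ⟨fun x => if x i = 1 then gb x else ga x, (𝓐 ∪ 𝓑) ∪ (𝓐 ∪ 𝓑).image (insert i),
        ?_, ?_, ?_, ?_, ite_mem_span hμ' hA hB a5 b5, ?_⟩
      · have h1 : (𝓐 ∪ 𝓑).card ≤ 𝓐.card + 𝓑.card := card_union_le _ _
        have h2 : ((𝓐 ∪ 𝓑).image (insert i)).card ≤ (𝓐 ∪ 𝓑).card := card_image_le
        refine (card_union_le _ _).trans ?_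
        simp only [DecTree.leaves, pow_succ]
        nlinarith
      · intro S hS
        simp only [mem_union, mem_image] at hS
        rcases hS with (h | h) | ⟨S', h | h, rfl⟩
        · exact (a2 S h).trans (Nat.le_succ d)
        · exact (b2 S h).trans (Nat.le_succ d)
        · exact (card_insert_le _ _).trans (Nat.succ_le_succ (a2 S' h))
        · exact (card_insert_le _ _).trans (Nat.succ_le_succ (b2 S' h))
      · intro S hS
        simp only [mem_union, mem_image] at hS
        rcases hS with (h | h) | ⟨S', h | h, rfl⟩
        · exact a3' S h
        · exact b3' S h
        · exact disjoint_insert_left.2 ⟨hi, a3' S' h⟩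
        · exact disjoint_insert_left.2 ⟨hi, b3' S' h⟩
      · intro u hu x v
        have hui : i ≠ u := by rintro rfl; exact hi hu
        simp only [Function.update_of_ne hui, a4 u (mem_insert_of_mem hu) x v,
          b4 u (mem_insert_of_mem hu) x v]
      -- The error at a node is the average of the errors of the branches, each with weight at most
      -- `1 - c`. This supplies one factor `1 - c` per level.
      · have e : expect μ (fun x => (toReal (fun x => if x i = 1 then fb x else fa x) x -
            if x i = 1 then gb x else ga x) ^ 2) =
            (1 + μ i) / 2 * expect μ (fun x => (toReal fb x - gb x) ^ 2) +
            (1 - μ i) / 2 * expect μ (fun x => (toReal fa x - ga x) ^ 2) := by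
          rw [← expect_ite (i := i)]
          · congr 1
            funext x
            simp only [toReal]
            split_ifs <;> rfl
          · intro x v; simp only [toReal, ib x v, b4 i (mem_insert_self i U) x v]
          · intro x v; simp only [toReal, ia x v, a4 i (mem_insert_self i U) x v]
        rw [e]
        have na : 0 ≤ expect μ (fun x => (toReal fa x - ga x) ^ 2) :=
          expect_nonneg hμ' fun x => sq_nonneg _
        have nb : 0 ≤ expect μ (fun x => (toReal fb x - gb x) ^ 2) :=
          expect_nonneg hμ' fun x => sq_nonneg _
        calc _ ≤ (1 - c) * expect μ (fun x => (toReal fb x - gb x) ^ 2) +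
              (1 - c) * expect μ (fun x => (toReal fa x - ga x) ^ 2) := by
              refine add_le_add (mul_le_mul_of_nonneg_right ?_ nb)
                (mul_le_mul_of_nonneg_right ?_ na) <;> linarith [(hμ i).1, (hμ i).2]
          _ ≤ (1 - c) * (b.leaves * (1 - c) ^ d) + (1 - c) * (a.leaves * (1 - c) ^ d) :=
              add_le_add (mul_le_mul_of_nonneg_left b6 hc1) (mul_le_mul_of_nonneg_left a6 hc1)
          _ = _ := by simp only [DecTree.leaves, Nat.cast_add]; ring

/-- The Fourier weight of a tree outside a family that contains all heavy sets of low degree. -/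
theorem sum_coeff_sq_compl_le (hc : 0 < c) (hc' : c ≤ 1)
    (hμ : ∀ i, μ i ∈ Set.Icc (-1 + 2 * c) (1 - 2 * c)) (T : DecTree n) (d : ℕ) {τ : ℝ}
    (hτ : 0 ≤ τ) (𝒮 : Finset (Finset (Fin n)))
    (h𝒮 : ∀ S, S ∉ 𝒮 → S.card ≤ d → coeff μ T.eval S ^ 2 ≤ τ) :
    ∑ S ∈ 𝒮ᶜ, coeff μ T.eval S ^ 2 ≤ T.leaves * 2 ^ d * τ + T.leaves * (1 - c) ^ d := by
  have hμ' : ∀ i, μ i ^ 2 < 1 := fun i => sq_lt_one_of_mem hc (hμ i)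
  obtain ⟨g, 𝓕, h1, h2, -, -, h5, h6⟩ := exists_sparse_approx hc hc' hμ T d ∅ 1
  simp only [override_empty] at h6
  -- On the support of the sparse approximant there are at most `leaves * 2 ^ d` sets, each
  -- contributing at most `τ`. Off that support the coefficients are those of the difference, whose
  -- total weight is controlled by Parseval.
  rw [← sum_filter_add_sum_filter_not 𝒮ᶜ (· ∈ 𝓕)]
  refine add_le_add ?_ ?_
  · calc _ ≤ ∑ S ∈ 𝒮ᶜ with S ∈ 𝓕, τ := by
          refine sum_le_sum fun S hS => ?_
          rw [mem_filter, mem_compl] at hS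
          exact h𝒮 S hS.1 (h2 S hS.2)
      _ = ((𝒮ᶜ.filter (· ∈ 𝓕)).card : ℝ) * τ := by rw [sum_const, nsmul_eq_mul]
      _ ≤ _ := by
          refine mul_le_mul_of_nonneg_right ?_ hτ
          have : (𝒮ᶜ.filter (· ∈ 𝓕)).card ≤ 𝓕.card :=
            card_le_card fun S hS => (mem_filter.1 hS).2
          exact_mod_cast this.trans h1
  · refine le_trans ?_ h6
    rw [expect_sq hμ']
    calc _ = ∑ S ∈ 𝒮ᶜ with S ∉ 𝓕, fourier μ (fun x => toReal T.eval x - g x) S ^ 2 := by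
          refine sum_congr rfl fun S hS => ?_
          have h0 := fourier_eq_zero hμ' h5 (mem_filter.1 hS).2
          congr 1
          rw [fourier] at h0
          simp only [fourier, sub_mul]
          rw [expect_sub, h0, sub_zero]
          rfl
      _ ≤ _ := sum_le_sum_of_subset_of_nonneg (subset_univ _) fun _ _ _ => sq_nonneg _

end Bounds

/-- If `h` is within `1/4` of `g`, then the error of `sign h` is controlled by the squared
distance of `g` to the target. -/
lemma err_sgn_le (hμ : ∀ i, μ i ^ 2 < 1) (f : Cube n → ℤˣ) (g h : Cube n → ℝ) {a : ℝ}
    (ha : a ≤ 1) (hgh : ∀ x, |h x - g x| ≤ a) :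
    (1 - a) ^ 2 * err (prodDist μ) (fun x => sgn (h x)) f ≤
      expect μ (fun x => (g x - toReal f x) ^ 2) := by
  rw [err, sum_filter, mul_sum]
  refine sum_le_sum fun x _ => ?_
  have hp := prodDist_nonneg hμ x
  split_ifs with hx
  · rw [mul_comm]
    refine mul_le_mul_of_nonneg_left ?_ hp
    have h1 := abs_le.1 (hgh x)
    rcases Int.units_eq_one_or (f x) with hf | hf
    -- At a misclassified point `h x` and the label lie on opposite sides of zero, so `g x`, being
    -- within `a` of `h x`, is at distance at least `1 - a` from the label.
    · have : h x < 0 := by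
        by_contra hcon
        exact hx (by simp [sgn, not_lt.1 hcon, hf])
      simp only [toReal, hf, Units.val_one, Int.cast_one]
      nlinarith
    · have : 0 ≤ h x := by
        by_contra hcon
        exact hx (by simp [sgn, hcon, hf])
      simp only [toReal, hf, Units.val_neg, Units.val_one, Int.cast_neg, Int.cast_one]
      nlinarith
  · rw [mul_zero]
    exact mul_nonneg hp (sq_nonneg _)

end Trees

/-! ### The algorithm with exact expectations -/

section Exact

variable {n : ℕ} {μ : Fin n → ℝ} {f : Cube n → ℤˣ} {θ : ℝ}

/-- Removing an element from a heavy set leaves a heavy set, by `expect_fSub_sq_anti`, so every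
heavy set of size at most `i` is reached through a chain of sets that pass the test. -/
lemma mem_collected_of_lt (hμ : ∀ i, μ i ^ 2 < 1) (i : ℕ) : ∀ S : Finset (Fin n), S.card ≤ i →
    θ ^ 2 < expect μ (fun x => fSub μ f S x ^ 2) → S ∈ collected μ f θ i := by
  induction i with
  | zero =>
    intro S hS _
    simpa [collected] using hS
  | succ i ih =>
    intro S hS hW
    simp only [collected, mem_union, mem_filter, mem_univ, true_and]
    rcases Nat.lt_or_ge i S.card with h | h
    · obtain ⟨j, hj⟩ : S.Nonempty := card_pos.1 (by omega)
      have hcard : (S.erase j).card = i := by rw [card_erase_of_mem hj]; omega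
      exact Or.inr ⟨S.erase j, ih _ hcard.le (hW.trans_le (expect_fSub_sq_anti hμ f (erase_subset j S))),
        hcard, j, notMem_erase j S, (insert_erase hj).symm, hW⟩
    · exact Or.inl (ih S h hW)

lemma of_mem_collected (i : ℕ) : ∀ S ∈ collected μ f θ i, S.card ≤ i ∧
    (S = ∅ ∨ θ ^ 2 < expect μ (fun x => fSub μ f S x ^ 2)) := by
  induction i with
  | zero =>
    intro S hS
    simp only [collected, mem_singleton] at hS
    simp [hS]
  | succ i ih =>
    intro S hS
    simp only [collected, mem_union, mem_filter, mem_univ, true_and] at hS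
    rcases hS with h | ⟨S', hS', hcard, j, hj, rfl, hW⟩
    · exact ⟨(ih S h).1.trans (Nat.le_succ i), (ih S h).2⟩
    · exact ⟨by rw [card_insert_of_notMem hj, hcard], Or.inr hW⟩

variable {c ε : ℝ} {t : ℕ}

lemma logb_inv_pos (hc : 0 < c) (hc' : c ≤ 1 / 2) : 0 < Real.logb 2 (1 / (1 - c)) := by
  refine Real.logb_pos (by norm_num) ?_
  rw [lt_div_iff₀] <;> linarith

/-- The exponent is a quotient of logarithms, and base and argument may be exchanged: `a^{log p} =
p^{log a}`. This turns exponentials in the depth into powers of `8t/ε`. -/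
lemma rpow_depthParam (ht : 0 < t) (hε : 0 < ε) {a : ℝ}
    (ha : 0 < a) : a ^ depthParam c ε t =
      (8 * t / ε) ^ (Real.logb 2 a / Real.logb 2 (1 / (1 - c))) := by
  have hp : (0 : ℝ) < 8 * t / ε := by positivity
  have h1 : a = 2 ^ Real.logb 2 a := (Real.rpow_logb (by norm_num) (by norm_num) ha).symm
  have h2 : (8 * t / ε : ℝ) = 2 ^ Real.logb 2 (8 * t / ε) :=
    (Real.rpow_logb (by norm_num) (by norm_num) hp).symm
  conv_lhs => rw [h1]
  conv_rhs => rw [h2]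
  rw [← Real.rpow_mul (by norm_num), ← Real.rpow_mul (by norm_num), depthParam]
  congr 1
  ring

lemma one_sub_rpow_depthParam (hc : 0 < c) (hc' : c ≤ 1 / 2) (ht : 0 < t) (hε : 0 < ε) :
    (1 - c) ^ depthParam c ε t = ε / (8 * t) := by
  have h := logb_inv_pos hc hc'
  rw [rpow_depthParam ht hε (by linarith)]
  rw [one_div, Real.logb_inv] at h ⊢
  rw [div_neg, div_self (by linarith), Real.rpow_neg_one, inv_div]

lemma eight_le (ht : 0 < t) (hε : 0 < ε) (hε' : ε < 1) : (8 : ℝ) ≤ 8 * t / ε := by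
  have : (1 : ℝ) ≤ t := by exact_mod_cast ht
  rw [le_div_iff₀ hε]
  nlinarith

lemma two_le_div (hn : 0 < n) (ht : 0 < t) (hε : 0 < ε) (hε' : ε < 1) :
    (2 : ℝ) ≤ 2 * n * t / ε := by
  have : (1 : ℝ) ≤ n * t := by exact_mod_cast Nat.mul_pos hn ht
  rw [le_div_iff₀ hε]
  linarith

lemma one_le_logb_div (hn : 0 < n) (ht : 0 < t) (hε : 0 < ε) (hε' : ε < 1) :
    1 ≤ Real.logb 2 (2 * n * t / ε) := by
  have := two_le_div hn ht hε hε'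
  rw [Real.le_logb_iff_rpow_le (by norm_num) (by linarith)]
  simpa using this

lemma depthParam_nonneg (hc : 0 < c) (hc' : c ≤ 1 / 2) (ht : 0 < t) (hε : 0 < ε)
    (hε' : ε < 1) : 0 ≤ depthParam c ε t :=
  div_nonneg (Real.logb_nonneg (by norm_num) (by linarith [eight_le ht hε hε']))
    (logb_inv_pos hc hc').le

lemma two_pow_depth_le (hc : 0 < c) (hc' : c ≤ 1 / 2) (ht : 0 < t) (hε : 0 < ε) (hε' : ε < 1) :
    (2 : ℝ) ^ ⌊depthParam c ε t⌋₊ ≤ (8 * t / ε) ^ (1 / Real.logb 2 (1 / (1 - c))) := by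
  have := rpow_depthParam (c := c) ht hε (a := 2) (by norm_num)
  rw [Real.logb_self_eq_one (by norm_num)] at this
  rw [← this, ← Real.rpow_natCast]
  exact Real.rpow_le_rpow_of_exponent_le (by norm_num)
    (Nat.floor_le (depthParam_nonneg hc hc' ht hε hε'))

/-- Rounding the depth down costs at most one factor `1 - c ≥ 1/2`, which weakens `ε/(8t)` to
`ε/(4t)`. -/
lemma one_sub_pow_depth_le (hc : 0 < c) (hc' : c ≤ 1 / 2) (ht : 0 < t) (hε : 0 < ε) :
    (1 - c) ^ ⌊depthParam c ε t⌋₊ ≤ ε / (4 * t) := by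
  have ht' : (0 : ℝ) < t := by exact_mod_cast ht
  have h1 : (1 - c) ^ (⌊depthParam c ε t⌋₊ + 1) ≤ ε / (8 * t) := by
    rw [← one_sub_rpow_depthParam hc hc' ht hε, ← Real.rpow_natCast]
    refine Real.rpow_le_rpow_of_exponent_ge (by linarith) (by linarith) ?_
    push_cast
    exact (Nat.lt_floor_add_one _).le
  have h2 : (0 : ℝ) ≤ (1 - c) ^ ⌊depthParam c ε t⌋₊ := pow_nonneg (by linarith) _
  rw [pow_succ] at h1
  have h3 : (1 - c) ^ ⌊depthParam c ε t⌋₊ ≤ 2 * (ε / (8 * t)) := by nlinarith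
  refine h3.trans (le_of_eq ?_)
  field_simp
  norm_num

lemma thetaParam_sq (ht : 0 < t) (hε : 0 < ε) : thetaParam c ε t ^ 2 =
    ε / (2 * t * (8 * t / ε) ^ (1 / Real.logb 2 (1 / (1 - c)))) := by
  rw [thetaParam, Real.sq_sqrt]
  positivity

/-- The missed weight has two parts: the light coefficients contribute at most `t 2^d θ² ≤ ε/2`, and
the truncation at most `t (1-c)^d ≤ ε/4`. As the coefficients are exact, `err_sgn_le` applies with
`a = 0`. -/
theorem err_output_le (hc : 0 < c) (hc' : c ≤ 1 / 2)
    (hμ : ∀ i, μ i ∈ Set.Icc (-1 + 2 * c) (1 - 2 * c)) (T : DecTree n) (hT : T.leaves ≤ t)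
    (hε : 0 < ε) (hε' : ε < 1) :
    err (prodDist μ) (output μ T.eval (thetaParam c ε t) ⌊depthParam c ε t⌋₊) T.eval ≤ ε := by
  have hμ' : ∀ i, μ i ^ 2 < 1 := fun i => sq_lt_one_of_mem hc (hμ i)
  have ht : 0 < t := T.one_le_leaves.trans hT
  have ht' : (0 : ℝ) < t := by exact_mod_cast ht
  set θ := thetaParam c ε t with hθ
  set d := ⌊depthParam c ε t⌋₊ with hd
  have h1 := err_sgn_le hμ' T.eval
    (fun x => ∑ S ∈ collected μ T.eval θ d, coeff μ T.eval S * chi μ S x)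
    (fun x => ∑ S ∈ collected μ T.eval θ d, coeff μ T.eval S * chi μ S x)
    (a := 0) (by norm_num) (by simp)
  have h2 := expect_sq_sub_sum hμ' (toReal T.eval) (collected μ T.eval θ d)
  have h3 := sum_coeff_sq_compl_le hc (by linarith) hμ T d (sq_nonneg θ)
    (collected μ T.eval θ d) (fun S hS hcard => by
      by_contra hcon
      exact hS (mem_collected_of_lt hμ' d S hcard
        ((not_le.1 hcon).trans_le (coeff_sq_le_expect hμ' _ S))))
  have h4 : (1 - 0 : ℝ) ^ 2 * err (prodDist μ) (output μ T.eval θ d) T.eval ≤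
      T.leaves * 2 ^ d * θ ^ 2 + T.leaves * (1 - c) ^ d := h1.trans (h2.le.trans h3)
  have hTt : (T.leaves : ℝ) ≤ t := by exact_mod_cast hT
  have hP : (0 : ℝ) < (8 * t / ε) ^ (1 / Real.logb 2 (1 / (1 - c))) := by positivity
  have h5 : (T.leaves : ℝ) * 2 ^ d * θ ^ 2 ≤ ε / 2 := by
    calc (T.leaves : ℝ) * 2 ^ d * θ ^ 2 ≤
        t * (8 * t / ε) ^ (1 / Real.logb 2 (1 / (1 - c))) * θ ^ 2 := by
          gcongr
          exact two_pow_depth_le hc hc' ht hε hε'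
      _ = ε / 2 := by
          rw [hθ, thetaParam_sq ht hε]
          field_simp
  have h6 : (T.leaves : ℝ) * (1 - c) ^ d ≤ ε / 4 := by
    calc (T.leaves : ℝ) * (1 - c) ^ d ≤ t * (ε / (4 * t)) := by
          gcongr
          · exact pow_nonneg (by linarith) _
          · exact one_sub_pow_depth_le hc hc' ht hε
      _ = ε / 4 := by field_simp
  linarith

/-- Every collected set other than `∅` has passed the test, so its sensitivity probability exceeds
`θ²` and `card_mul_le_leaves` counts it. The summand `1` is for the untested empty set. -/
theorem card_collected_le (hc : 0 < c) (hc' : c ≤ 1 / 2)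
    (hμ : ∀ i, μ i ∈ Set.Icc (-1 + 2 * c) (1 - 2 * c)) (T : DecTree n) (hT : T.leaves ≤ t)
    (hθ : 0 < θ) (d : ℕ) :
    ((collected μ T.eval θ d).card : ℝ) ≤ 1 + t / (c ^ d * θ ^ 2) := by
  have hμ' : ∀ i, μ i ^ 2 < 1 := fun i => sq_lt_one_of_mem hc (hμ i)
  have h := card_mul_le_leaves hc (by linarith) hμ T (d := d) (τ := θ ^ 2)
    ((collected μ T.eval θ d).erase ∅) (fun S hS => by
      obtain ⟨h1, h2⟩ := of_mem_collected d S (mem_of_mem_erase hS)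
      exact ⟨h1, (h2.resolve_left (ne_of_mem_erase hS)).le.trans
        (expect_fSub_sq_le_sensProb hμ' _ S)⟩)
  have h1 : ((collected μ T.eval θ d).card : ℝ) ≤
      1 + ((collected μ T.eval θ d).erase ∅).card := by
    have := card_le_card (subset_insert_iff.2 (subset_refl ((collected μ T.eval θ d).erase ∅)))
    rw [add_comm]
    exact_mod_cast this.trans (card_insert_le _ _)
  have h2 : (((collected μ T.eval θ d).erase ∅).card : ℝ) ≤ t / (c ^ d * θ ^ 2) := by
    rw [le_div_iff₀ (by positivity)]
    exact h.trans (by exact_mod_cast hT)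
  linarith

/-- `n + t + 1/ε` dominates the quantities of the exact algorithm polynomially. -/
theorem exact_algorithm (c : ℝ) (hc : 0 < c) (hc' : c ≤ 1 / 2) :
    ∃ (K₀ : ℕ) (C₀ : ℝ), ∀ (K : ℕ) (C : ℝ), K₀ ≤ K → C₀ ≤ C →
      ∀ (n t : ℕ) (ε : ℝ), 0 < n → 0 < ε → ε < 1 →
        ∀ (μ : Fin n → ℝ) (T : DecTree n),
          (∀ i, μ i ∈ Set.Icc (-1 + 2 * c) (1 - 2 * c)) → T.leaves ≤ t →
          ∀ (θ : ℝ) (d : ℕ), θ = thetaParam c ε t → d = ⌊depthParam c ε t⌋₊ →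
            err (prodDist μ) (output μ T.eval θ d) T.eval ≤ ε ∧
            ((collected μ T.eval θ d).card : ℝ) ≤ K * (n + t + 1 / ε) ^ K ∧
            ((tests μ T.eval θ d).card : ℝ) ≤ K * (n + t + 1 / ε) ^ K ∧
            ∀ p ∈ tests μ T.eval θ d, ∀ x : Cube n,
              fSub μ T.eval (insert p.2 p.1) x = queryAvg μ T.eval (insert p.2 p.1) x ∧
              ((flips (insert p.2 p.1) x).card : ℝ) ≤ K * (n + t + 1 / ε) ^ K ∧
              ∀ y ∈ flips (insert p.2 p.1) x,
                (hammingDist x y : ℝ) ≤ C * Real.logb 2 (2 * n * t / ε) := by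
  have hL := logb_inv_pos hc hc'
  set L := Real.logb 2 (1 / (1 - c)) with hLdef
  set A : ℕ := ⌈Real.logb 2 (1 / c) / L⌉₊ with hA
  set A' : ℕ := ⌈1 / L⌉₊ with hA'
  -- With `8t/ε ≤ X^4`, the factors `c^{-d}` and `(8t/ε)^{1/L}` cost exponents `4A` and `4A'`, the
  -- remaining factors of the count cost `5`, and the choice of the coordinate to be tested costs
  -- one more.
  refine ⟨4 * A + 4 * A' + 6, 3 / L, ?_⟩
  intro K C hK hC n t ε hn hε hε' μ T hμ hT θ d hθ hd
  have hμ' : ∀ i, μ i ^ 2 < 1 := fun i => sq_lt_one_of_mem hc (hμ i)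
  have ht : 0 < t := T.one_le_leaves.trans hT
  have ht' : (1 : ℝ) ≤ t := by exact_mod_cast ht
  have hn' : (1 : ℝ) ≤ n := by exact_mod_cast hn
  have hε1 : (1 : ℝ) < 1 / ε := by rw [lt_div_iff₀ hε]; linarith
  set X : ℝ := n + t + 1 / ε with hX
  have hX3 : 3 ≤ X := by linarith
  have hX1 : 1 ≤ X := by linarith
  have htX : (t : ℝ) ≤ X := by linarith
  have hnX : (n : ℝ) ≤ X := by linarith
  have heX : 1 / ε ≤ X := by linarith
  have hp1 := eight_le ht hε hε'
  have hp : (8 * t / ε : ℝ) ≤ X ^ 4 := by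
    calc (8 * t / ε : ℝ) = 8 * (t * (1 / ε)) := by ring
      _ ≤ 9 * (X * X) := by gcongr; norm_num
      _ ≤ (X * X) * (X * X) := by gcongr; nlinarith
      _ = X ^ 4 := by ring
  have big : ∀ (z : ℝ) (a : ℕ), z ≤ X ^ a → a ≤ K → z ≤ K * X ^ K := by
    intro z a hz ha
    have hK1 : (1 : ℝ) ≤ K := by exact_mod_cast (by omega : 1 ≤ K)
    calc z ≤ X ^ a := hz
      _ ≤ X ^ K := pow_le_pow_right₀ hX1 ha
      _ ≤ K * X ^ K := le_mul_of_one_le_left (by positivity) hK1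
  have hpA : ∀ (a : ℝ) (k : ℕ), a ≤ k → (8 * t / ε : ℝ) ^ a ≤ X ^ (4 * k) := by
    intro a k ha
    calc (8 * t / ε : ℝ) ^ a ≤ (8 * t / ε : ℝ) ^ (k : ℝ) :=
          Real.rpow_le_rpow_of_exponent_le (by linarith) ha
      _ = (8 * t / ε : ℝ) ^ k := Real.rpow_natCast _ _
      _ ≤ (X ^ 4) ^ k := by gcongr
      _ = _ := by rw [← pow_mul]
  have hinvL : (8 * t / ε : ℝ) ^ (1 / L) ≤ X ^ (4 * A') := hpA _ _ (Nat.le_ceil _)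
  have h2d : (2 : ℝ) ^ d ≤ X ^ (4 * A') := by
    rw [hd]
    exact (two_pow_depth_le hc hc' ht hε hε').trans hinvL
  have hcd : 1 / c ^ d ≤ X ^ (4 * A) := by
    have h1 : 1 / c ^ d ≤ (1 / c) ^ depthParam c ε t := by
      rw [hd, ← one_div_pow, ← Real.rpow_natCast]
      refine Real.rpow_le_rpow_of_exponent_le ?_
        (Nat.floor_le (depthParam_nonneg hc hc' ht hε hε'))
      rw [le_div_iff₀ hc]; linarith
    rw [rpow_depthParam ht hε (by positivity)] at h1
    exact h1.trans (hpA _ _ (Nat.le_ceil _))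
  have hθ2 := thetaParam_sq (c := c) ht hε
  rw [← hθ, ← hLdef] at hθ2
  have hP : (0 : ℝ) < (8 * t / ε) ^ (1 / L) := Real.rpow_pos_of_pos (by linarith) _
  have hθpos : 0 < θ := by
    rw [hθ]
    refine Real.sqrt_pos.2 ?_
    rw [← hLdef]
    positivity
  have hcoll : ((collected μ T.eval θ d).card : ℝ) ≤ X ^ (4 * A + 4 * A' + 5) := by
    refine (card_collected_le hc hc' hμ T hT hθpos d).trans ?_
    have e : (t : ℝ) / (c ^ d * θ ^ 2) =
        2 * t * t * (1 / ε) * (1 / c ^ d) * (8 * t / ε) ^ (1 / L) := by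
      rw [hθ2]
      have := (pow_pos hc d).ne'
      field_simp
    rw [e]
    have h1 : 2 * t * t * (1 / ε) * (1 / c ^ d) * (8 * t / ε : ℝ) ^ (1 / L) ≤
        2 * X * X * X * X ^ (4 * A) * X ^ (4 * A') := by gcongr
    have h2 : 1 ≤ X ^ (4 * A + 4 * A') := one_le_pow₀ hX1
    have h3 : 1 + 2 * X * X * X ≤ X ^ 5 := by
      have h4 : 1 ≤ X ^ 3 := one_le_pow₀ hX1
      have h5 : 3 ≤ X ^ 2 := by nlinarith
      calc 1 + 2 * X * X * X ≤ 3 * X ^ 3 := by linarith [pow_succ X 2, sq X]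
        _ ≤ X ^ 2 * X ^ 3 := by gcongr
        _ = X ^ 5 := by ring
    calc _ ≤ X ^ (4 * A + 4 * A') * 1 + X ^ (4 * A + 4 * A') * (2 * X * X * X) := by
          rw [mul_one]
          refine add_le_add h2 (h1.trans (le_of_eq ?_))
          rw [pow_add]; ring
      _ = X ^ (4 * A + 4 * A') * (1 + 2 * X * X * X) := by ring
      _ ≤ X ^ (4 * A + 4 * A') * X ^ 5 := by gcongr
      _ = _ := by rw [← pow_add]
  refine ⟨?_, big _ _ hcoll (by omega), ?_, ?_⟩
  · rw [hθ, hd]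
    exact err_output_le hc hc' hμ T hT hε hε'
  · refine big _ (4 * A + 4 * A' + 6) ?_ hK
    have h1 : (tests μ T.eval θ d).card ≤ (collected μ T.eval θ d).card * n := by
      have : tests μ T.eval θ d ⊆ collected μ T.eval θ d ×ˢ univ := by
        intro p hp
        simp only [tests, mem_filter, mem_univ, true_and] at hp
        simp [hp.1]
      simpa using card_le_card this
    calc ((tests μ T.eval θ d).card : ℝ) ≤ (collected μ T.eval θ d).card * n := by
          exact_mod_cast h1
      _ ≤ X ^ (4 * A + 4 * A' + 5) * X := by gcongr
      _ = _ := by rw [← pow_succ]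
  · intro p hp x
    simp only [tests, mem_filter, mem_univ, true_and] at hp
    have hcard : (insert p.2 p.1).card ≤ d := (card_insert_le _ _).trans hp.2.1
    refine ⟨fSub_eq_queryAvg hμ' _ _ x, big _ (4 * A') ?_ (by omega), ?_⟩
    · rw [card_flips]
      push_cast
      exact (pow_le_pow_right₀ (by norm_num) hcard).trans h2d
    · intro y hy
      have h1 : (hammingDist x y : ℝ) ≤ d := by
        exact_mod_cast (hammingDist_flips hy).trans hcard
      have h2 : (d : ℝ) ≤ depthParam c ε t := by
        rw [hd]; exact Nat.floor_le (depthParam_nonneg hc hc' ht hε hε')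
      have h2nt := two_le_div hn ht hε hε'
      have h3 := one_le_logb_div hn ht hε hε'
      -- The factor `4` between the arguments costs an additive `2`, which is absorbed because the
      -- logarithm on the right is at least `1`.
      have h4 : Real.logb 2 (8 * t / ε) ≤ 3 * Real.logb 2 (2 * n * t / ε) := by
        calc Real.logb 2 (8 * t / ε) ≤ Real.logb 2 (4 * (2 * n * t / ε)) := by
              refine Real.logb_le_logb_of_le (by norm_num) (by linarith) ?_
              have : (t : ℝ) ≤ n * t := le_mul_of_one_le_left (by linarith) hn'
              rw [← mul_div_assoc]
              refine div_le_div_of_nonneg_right ?_ hε.le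
              linarith
          _ = 2 + Real.logb 2 (2 * n * t / ε) := by
              rw [Real.logb_mul (by norm_num) (by linarith)]
              congr 1
              rw [show (4 : ℝ) = 2 ^ (2 : ℝ) by norm_num,
                Real.logb_rpow (by norm_num) (by norm_num)]
          _ ≤ _ := by linarith
      calc (hammingDist x y : ℝ) ≤ depthParam c ε t := h1.trans h2
        _ ≤ 3 * Real.logb 2 (2 * n * t / ε) / L := by
            rw [depthParam]; gcongr
        _ = 3 / L * Real.logb 2 (2 * n * t / ε) := by ring
        _ ≤ _ := by gcongr

end Exact

/-! ### Concentration over an independent sample -/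

section Concentration

variable {α : Type*} [Fintype α] {D : α → ℝ} {m : ℕ}

lemma sum_prod_sample (hD1 : ∑ x, D x = 1) : ∑ ω : Fin m → α, ∏ u, D (ω u) = 1 := by
  rw [← Fintype.sum_pow, hD1, one_pow]

/-- The bound `exp u ≤ 1 + u + u²` for `|u| ≤ 1` is averaged; the linear term disappears because the
mean is zero. -/
lemma sum_mul_exp_le (hD : ∀ x, 0 ≤ D x) (hD1 : ∑ x, D x = 1) {X : α → ℝ}
    (hX : ∀ x, |X x| ≤ 1) (hmean : ∑ x, D x * X x = 0) {l : ℝ} (hl : 0 ≤ l) (hl1 : l ≤ 1) :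
    ∑ x, D x * Real.exp (l * X x) ≤ Real.exp (l ^ 2) := by
  have h : ∀ x, Real.exp (l * X x) ≤ 1 + l * X x + l ^ 2 := by
    intro x
    have h1 : |l * X x| ≤ 1 := by
      rw [abs_mul, abs_of_nonneg hl]
      exact mul_le_one₀ hl1 (abs_nonneg _) (hX x)
    have h2 := (abs_le.1 (Real.abs_exp_sub_one_sub_id_le h1)).2
    have h3 : X x ^ 2 ≤ 1 := (sq_le_one_iff_abs_le_one _).2 (hX x)
    have h4 : (l * X x) ^ 2 ≤ l ^ 2 := by
      rw [mul_pow]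
      exact mul_le_of_le_one_right (sq_nonneg _) h3
    linarith
  calc ∑ x, D x * Real.exp (l * X x) ≤ ∑ x, D x * (1 + l * X x + l ^ 2) :=
        sum_le_sum fun x _ => mul_le_mul_of_nonneg_left (h x) (hD x)
    _ = (∑ x, D x) * (1 + l ^ 2) + l * ∑ x, D x * X x := by
        rw [sum_mul, mul_sum, ← sum_add_distrib]
        exact sum_congr rfl fun x _ => by ring
    _ = l ^ 2 + 1 := by rw [hD1, hmean]; ring
    _ ≤ Real.exp (l ^ 2) := Real.add_one_le_exp _

/-- Chernoff's method: the indicator of the deviation is bounded by an exponential, whose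
expectation factors over the independent examples. -/
lemma sum_sample_upper_tail (hD : ∀ x, 0 ≤ D x) (hD1 : ∑ x, D x = 1) {g : α → ℝ}
    (hg : ∀ x, |g x| ≤ 1) {τ : ℝ} (hτ : 0 ≤ τ) (hτ1 : τ ≤ 1) :
    ∑ ω : Fin m → α with m * τ ≤ ∑ u, (g (ω u) - ∑ x, D x * g x), ∏ u, D (ω u) ≤
      Real.exp (-(m * τ ^ 2 / 16)) := by
  set e := ∑ x, D x * g x with he
  have he1 : |e| ≤ 1 := by
    refine (abs_sum_le_sum_abs _ _).trans ?_
    rw [← hD1]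
    refine sum_le_sum fun x _ => ?_
    rw [abs_mul, abs_of_nonneg (hD x)]
    exact mul_le_of_le_one_right (hD x) (hg x)
  have hX : ∀ x, |(g x - e) / 2| ≤ 1 := by
    intro x
    rw [abs_le]
    have := abs_le.1 he1
    have := abs_le.1 (hg x)
    constructor <;> linarith
  have hmean : ∑ x, D x * ((g x - e) / 2) = 0 := by
    have : ∀ x, D x * ((g x - e) / 2) = D x * g x * (1 / 2) - D x * (e / 2) := fun x => by ring
    simp_rw [this]
    rw [sum_sub_distrib, ← sum_mul, ← sum_mul, ← he, hD1]
    ring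
  -- The centred variable is halved so as to lie in `[-1, 1]`. The choice `l = τ/4` maximises `l τ/2
  -- - l²`, with value `τ²/16`.
  have hmgf := sum_mul_exp_le hD hD1 hX hmean (l := τ / 4) (by linarith) (by linarith)
  rw [sum_filter]
  calc _ ≤ ∑ ω : Fin m → α, Real.exp (-(m * τ ^ 2 / 8)) *
        ∏ u, (D (ω u) * Real.exp (τ / 4 * ((g (ω u) - e) / 2))) := by
        refine sum_le_sum fun ω _ => ?_
        have hp : 0 ≤ ∏ u, D (ω u) := prod_nonneg fun u _ => hD _
        rw [prod_mul_distrib, ← Real.exp_sum, mul_left_comm, ← Real.exp_add]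
        split_ifs with h
        · refine le_mul_of_one_le_right hp (Real.one_le_exp ?_)
          rw [← mul_sum, ← sum_div]
          nlinarith
        · exact mul_nonneg hp (Real.exp_pos _).le
    _ = Real.exp (-(m * τ ^ 2 / 8)) * (∑ x, D x * Real.exp (τ / 4 * ((g x - e) / 2))) ^ m := by
        rw [← mul_sum, Fintype.sum_pow (fun x => D x * Real.exp (τ / 4 * ((g x - e) / 2)))]
    _ ≤ Real.exp (-(m * τ ^ 2 / 8)) * Real.exp ((τ / 4) ^ 2) ^ m := by
        gcongr
        exact sum_nonneg fun x _ => mul_nonneg (hD x) (Real.exp_pos _).le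
    _ = _ := by
        rw [← Real.exp_nat_mul, ← Real.exp_add]
        congr 1
        ring

/-- With probability at least `1 - δ`, all empirical averages of a finite family of bounded
functions are close to their expectations. -/
theorem le_sum_sample {ι : Type*} (hD : ∀ x, 0 ≤ D x) (hD1 : ∑ x, D x = 1) (I : Finset ι)
    (g : ι → α → ℝ) (hg : ∀ k ∈ I, ∀ x, |g k x| ≤ 1) {τ δ : ℝ} (hτ : 0 ≤ τ) (hτ1 : τ ≤ 1)
    (hδ : 2 * I.card * Real.exp (-(m * τ ^ 2 / 16)) ≤ δ)
    (P : (Fin m → α) → Prop) [DecidablePred P]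
    (hP : ∀ ω, (∀ k ∈ I, |∑ u, (g k (ω u) - ∑ x, D x * g k x)| < m * τ) → P ω) :
    1 - δ ≤ ∑ ω with P ω, ∏ u, D (ω u) := by
  classical
  have hp : ∀ ω : Fin m → α, 0 ≤ ∏ u, D (ω u) := fun ω => prod_nonneg fun u _ => hD _
  have htail : ∀ k ∈ I, ∑ ω : Fin m → α with m * τ ≤ |∑ u, (g k (ω u) - ∑ x, D x * g k x)|,
      ∏ u, D (ω u) ≤ 2 * Real.exp (-(m * τ ^ 2 / 16)) := by
    intro k hk
    have h1 := sum_sample_upper_tail (m := m) hD hD1 (hg k hk) hτ hτ1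
    have h2 := sum_sample_upper_tail (m := m) hD hD1 (g := fun x => -g k x)
      (fun x => by rw [abs_neg]; exact hg k hk x) hτ hτ1
    have h3 : ∀ ω : Fin m → α, ∑ u, (-g k (ω u) - ∑ x, D x * -g k x) =
        -∑ u, (g k (ω u) - ∑ x, D x * g k x) := by
      intro ω
      rw [← sum_neg_distrib]
      refine sum_congr rfl fun u _ => ?_
      simp only [mul_neg, sum_neg_distrib]
      ring
    simp only [h3] at h2
    rw [two_mul]
    refine le_trans ?_ (add_le_add h1 h2)
    rw [← sum_union_inter]
    refine le_trans (sum_le_sum_of_subset_of_nonneg ?_ fun _ _ _ => hp _)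
      (le_add_of_nonneg_right (sum_nonneg fun _ _ => hp _))
    intro ω hω
    simp only [mem_union, mem_filter, mem_univ, true_and] at hω ⊢
    exact le_abs.1 hω
  -- Union bound: a bad sample violates the accuracy of at least one member of the family.
  have hbad : ∑ ω : Fin m → α with ¬ P ω, ∏ u, D (ω u) ≤ δ := by
    calc ∑ ω : Fin m → α with ¬ P ω, ∏ u, D (ω u) ≤ ∑ ω : Fin m → α, ∑ k ∈ I,
        if m * τ ≤ |∑ u, (g k (ω u) - ∑ x, D x * g k x)| then ∏ u, D (ω u) else 0 := by
          rw [sum_filter]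
          refine sum_le_sum fun ω _ => ?_
          have hn : ∀ k ∈ I, 0 ≤ if m * τ ≤ |∑ u, (g k (ω u) - ∑ x, D x * g k x)| then
              ∏ u, D (ω u) else 0 := fun k _ => by
            split_ifs
            exacts [hp ω, le_rfl]
          by_cases hω : P ω
          · rw [if_neg (not_not.2 hω)]
            exact sum_nonneg hn
          · rw [if_pos hω]
            obtain ⟨k, hk, hbad⟩ : ∃ k ∈ I, m * τ ≤ |∑ u, (g k (ω u) - ∑ x, D x * g k x)| := by
              by_contra hcon
              push Not at hcon
              exact hω (hP ω hcon)
            refine le_trans (le_of_eq ?_) (single_le_sum hn hk)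
            rw [if_pos hbad]
      _ ≤ ∑ k ∈ I, 2 * Real.exp (-(m * τ ^ 2 / 16)) := by
          rw [sum_comm]
          refine sum_le_sum fun k hk => ?_
          rw [← sum_filter]
          exact htail k hk
      _ = 2 * I.card * Real.exp (-(m * τ ^ 2 / 16)) := by
          rw [sum_const, nsmul_eq_mul]; ring
      _ ≤ δ := hδ
  have htot := sum_filter_add_sum_filter_not univ P (fun ω : Fin m → α => ∏ u, D (ω u))
  rw [sum_prod_sample hD1] at htot
  linarith

end Concentration

/-- The sets of at most `d` coordinates. -/
def smallSets (n d : ℕ) : Finset (Finset (Fin n)) := univ.filter fun S => S.card ≤ d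

lemma mem_smallSets {n d : ℕ} {S : Finset (Fin n)} : S ∈ smallSets n d ↔ S.card ≤ d := by
  simp [smallSets]

/-- Such a set arises from `d` successive choices, each of a coordinate or of nothing. -/
lemma card_smallSets_le (n d : ℕ) : (smallSets n d).card ≤ (n + 1) ^ d := by
  induction d with
  | zero =>
    refine card_le_one.2 fun a ha b hb => ?_
    simp only [mem_smallSets, Nat.le_zero, card_eq_zero] at ha hb
    rw [ha, hb]
  | succ d ih =>
    have : smallSets n (d + 1) ⊆ ((univ : Finset (Option (Fin n))) ×ˢ smallSets n d).image
        (fun p => p.1.elim p.2 (fun i => insert i p.2)) := by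
      intro S hS
      rw [mem_smallSets] at hS
      rw [mem_image]
      rcases Nat.lt_or_ge d S.card with h | h
      · obtain ⟨j, hj⟩ : S.Nonempty := card_pos.1 (by omega)
        refine ⟨(some j, S.erase j), ?_, insert_erase hj⟩
        simp only [mem_product, mem_univ, true_and, mem_smallSets, card_erase_of_mem hj]
        omega
      · exact ⟨(none, S), by simp [mem_smallSets, h], rfl⟩
    refine (card_le_card this).trans (card_image_le.trans ?_)
    rw [card_product, card_univ, Fintype.card_option, Fintype.card_fin, pow_succ, mul_comm]
    exact Nat.mul_le_mul_right _ ih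

/-! ### Families of sets grown one coordinate at a time -/

section Family

variable {n : ℕ}

open Classical in
/-- Append `S ∪ {j}` to a list of sets if it is admissible; the criterion may depend on the
length of the list. -/
noncomputable def growStep (ok : Fin n → ℕ → Finset (Fin n) → Prop) (j : Fin n)
    (cur : List (Finset (Fin n))) (S : Finset (Fin n)) : List (Finset (Fin n)) :=
  if ok j cur.length (insert j S) then cur ++ [insert j S] else cur

/-- The list of sets obtained from `[∅]` by trying to add the coordinates `0, …, k - 1` in turn
to all sets present. -/
noncomputable def family (ok : Fin n → ℕ → Finset (Fin n) → Prop) :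
    ℕ → List (Finset (Fin n))
  | 0 => [∅]
  | k + 1 => if h : k < n then (family ok k).foldl (growStep ok ⟨k, h⟩) (family ok k)
      else family ok k

variable {ok : Fin n → ℕ → Finset (Fin n) → Prop}

lemma mem_foldl_growStep {j : Fin n} {S : Finset (Fin n)} (l : List (Finset (Fin n))) :
    ∀ cur, S ∈ l.foldl (growStep ok j) cur →
      S ∈ cur ∨ ∃ S' ∈ l, S = insert j S' ∧ ∃ len, ok j len S := by
  induction l with
  | nil => intro cur h; exact Or.inl h
  | cons S₀ l ih =>
    intro cur h
    rw [List.foldl_cons] at h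
    rcases ih _ h with h | ⟨S', hS', h⟩
    · unfold growStep at h
      split_ifs at h with hok
      · rcases List.mem_append.1 h with h | h
        · exact Or.inl h
        · rw [List.mem_singleton] at h
          exact Or.inr ⟨S₀, List.mem_cons_self, h, _, h ▸ hok⟩
      · exact Or.inl h
    · exact Or.inr ⟨S', List.mem_cons_of_mem _ hS', h⟩

/-- A property is inherited by the family if it passes to admissible extensions. The length at the
moment of insertion is left arbitrary. -/
lemma family_induction {P : Finset (Fin n) → Prop} (h0 : P ∅)
    (hs : ∀ j len S, P S → ok j len (insert j S) → P (insert j S)) (k : ℕ) :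
    ∀ S ∈ family ok k, P S := by
  induction k with
  | zero => intro S hS; simp only [family, List.mem_singleton] at hS; rwa [hS]
  | succ k ih =>
    intro S hS
    simp only [family] at hS
    split_ifs at hS with hk
    · rcases mem_foldl_growStep _ _ hS with h | ⟨S', hS', rfl, len, hok⟩
      · exact ih S h
      · exact hs _ len S' (ih S' hS') hok
    · exact ih S hS

lemma prefix_growStep (j : Fin n) (cur : List (Finset (Fin n))) (S : Finset (Fin n)) :
    cur <+: growStep ok j cur S := by
  unfold growStep
  split_ifs
  · exact List.prefix_append _ _
  · exact List.prefix_rfl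

lemma prefix_foldl_growStep (j : Fin n) (l : List (Finset (Fin n))) :
    ∀ cur, cur <+: l.foldl (growStep ok j) cur := by
  induction l with
  | nil => intro cur; exact List.prefix_rfl
  | cons S l ih => intro cur; exact (prefix_growStep j cur S).trans (ih _)

lemma family_prefix_succ (k : ℕ) : family ok k <+: family ok (k + 1) := by
  simp only [family]
  split_ifs
  · exact prefix_foldl_growStep _ _ _
  · exact List.prefix_rfl

lemma family_prefix {k l : ℕ} (h : k ≤ l) : family ok k <+: family ok l := by
  induction h with
  | refl => exact List.prefix_rfl
  | step _ ih => exact ih.trans (family_prefix_succ _)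

lemma nodup_foldl_growStep {j : Fin n} (l : List (Finset (Fin n))) :
    ∀ cur : List (Finset (Fin n)), cur.Nodup → l.Nodup → (∀ S ∈ l, j ∉ S) →
      (∀ S ∈ l, insert j S ∉ cur) → (l.foldl (growStep ok j) cur).Nodup := by
  induction l with
  | nil => intro cur h _ _ _; exact h
  | cons S l ih =>
    intro cur hcur hl hj hnew
    rw [List.nodup_cons] at hl
    refine ih _ ?_ hl.2 (fun S' h => hj S' (List.mem_cons_of_mem _ h)) fun S' hS' => ?_
    · unfold growStep
      split_ifs
      · rw [← List.concat_eq_append]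
        exact hcur.concat (hnew S List.mem_cons_self)
      · exact hcur
    · have h1 := hnew S' (List.mem_cons_of_mem _ hS')
      unfold growStep
      split_ifs
      · rw [List.mem_append, List.mem_singleton, not_or]
        refine ⟨h1, fun h => hl.1 ?_⟩
        have e := congrArg (fun A => A.erase j) h
        simp only [erase_insert (hj S List.mem_cons_self),
          erase_insert (hj S' (List.mem_cons_of_mem _ hS'))] at e
        rwa [← e]
      · exact h1

lemma lt_of_mem_family (k : ℕ) : ∀ S ∈ family ok k, ∀ i ∈ S, (i : ℕ) < k := by
  induction k with
  | zero => intro S hS; simp only [family, List.mem_singleton] at hS; simp [hS]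
  | succ k ih =>
    intro S hS
    simp only [family] at hS
    split_ifs at hS with hk
    · rcases mem_foldl_growStep _ _ hS with h | ⟨S', hS', rfl, -⟩
      · exact fun i hi => (ih S h i hi).trans (Nat.lt_succ_self k)
      · intro i hi
        rcases mem_insert.1 hi with rfl | hi
        · exact Nat.lt_succ_self k
        · exact (ih S' hS' i hi).trans (Nat.lt_succ_self k)
    · exact fun i hi => (ih S hS i hi).trans (Nat.lt_succ_self k)

/-- Before round `k` only coordinates below `k` occur, so a set is created only in the round of its
largest element, and from the unique set obtained by erasing that element. -/
lemma nodup_family (k : ℕ) : (family ok k).Nodup := by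
  induction k with
  | zero => simp [family]
  | succ k ih =>
    simp only [family]
    split_ifs with hk
    · have hk' : ∀ S ∈ family ok k, (⟨k, hk⟩ : Fin n) ∉ S := fun S hS h =>
        lt_irrefl _ (lt_of_mem_family k S hS _ h)
      exact nodup_foldl_growStep _ _ ih ih hk' fun S _ h => hk' _ h (mem_insert_self _ _)
    · exact ih

lemma length_foldl_growStep_le {B : ℕ} (hB : ∀ j len S, ok j len S → len < B) {j : Fin n}
    (l : List (Finset (Fin n))) : ∀ cur : List (Finset (Fin n)), cur.length ≤ B →
      (l.foldl (growStep ok j) cur).length ≤ B := by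
  induction l with
  | nil => intro cur h; exact h
  | cons S l ih =>
    intro cur h
    refine ih _ ?_
    unfold growStep
    split_ifs with hok
    · simpa using hB _ _ _ hok
    · exact h

lemma length_family_le {B : ℕ} (hB : ∀ j len S, ok j len S → len < B) (h1 : 1 ≤ B) (k : ℕ) :
    (family ok k).length ≤ B := by
  induction k with
  | zero => simpa [family] using h1
  | succ k ih =>
    simp only [family]
    split_ifs with hk
    · exact length_foldl_growStep_le hB _ _ ih
    · exact ih

/-- Lists only grow, so the length at the time of the attempt is at most the final one.
Admissibility is required for all lengths up to that, which avoids tracking the exact moment. -/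
lemma insert_mem_foldl_growStep {j : Fin n} {S : Finset (Fin n)} (l : List (Finset (Fin n))) :
    ∀ cur, S ∈ l → (∀ len ≤ (l.foldl (growStep ok j) cur).length, ok j len (insert j S)) →
      insert j S ∈ l.foldl (growStep ok j) cur := by
  induction l with
  | nil => intro cur h; simp at h
  | cons S₀ l ih =>
    intro cur h hok
    rw [List.foldl_cons] at hok ⊢
    rcases List.mem_cons.1 h with rfl | h
    · have hlen : cur.length ≤ (l.foldl (growStep ok j) (growStep ok j cur S)).length :=
        ((prefix_growStep j cur S).trans (prefix_foldl_growStep j l _)).length_le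
      refine (prefix_foldl_growStep j l _).subset ?_
      rw [growStep, if_pos (hok _ hlen)]
      simp
    · exact ih _ h hok

/-- A set all of whose initial segments are admissible belongs to the family. -/
lemma mem_family {S : Finset (Fin n)}
    (hS : ∀ j ∈ S, ∀ len ≤ (family ok n).length, ok j len (S.filter (· ≤ j))) :
    S ∈ family ok n := by
  -- After `k` rounds the part of `S` below `k` is present. If `k` belongs to `S`, the next part is
  -- the initial segment of `S` ending at `k`, admissible by hypothesis.
  have : ∀ k ≤ n, S.filter (fun i : Fin n => (i : ℕ) < k) ∈ family ok k := by
    intro k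
    induction k with
    | zero => intro _; simp [family]
    | succ k ih =>
      intro hk
      have hk' : k < n := hk
      have ih := ih hk'.le
      by_cases hmem : (⟨k, hk'⟩ : Fin n) ∈ S
      · have e : S.filter (fun i : Fin n => (i : ℕ) < k + 1) =
            insert ⟨k, hk'⟩ (S.filter (fun i : Fin n => (i : ℕ) < k)) := by
          ext i
          simp only [mem_filter, mem_insert, Fin.ext_iff]
          constructor
          · rintro ⟨h1, h2⟩
            rcases Nat.lt_succ_iff_lt_or_eq.1 h2 with h | h
            · exact Or.inr ⟨h1, h⟩
            · exact Or.inl h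
          · rintro (h | ⟨h1, h2⟩)
            · have : i = ⟨k, hk'⟩ := Fin.ext h
              exact ⟨this ▸ hmem, by omega⟩
            · exact ⟨h1, by omega⟩
        have e' : S.filter (· ≤ (⟨k, hk'⟩ : Fin n)) =
            insert ⟨k, hk'⟩ (S.filter (fun i : Fin n => (i : ℕ) < k)) := by
          rw [← e]
          refine filter_congr fun i _ => ?_
          rw [Fin.le_def, Nat.lt_succ_iff]
        have hlen := (family_prefix (ok := ok) hk).length_le
        rw [e]
        simp only [family, dif_pos hk'] at hlen ⊢
        refine insert_mem_foldl_growStep _ _ ih fun len h => ?_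
        rw [← e']
        exact hS _ hmem len (h.trans hlen)
      · have e : S.filter (fun i : Fin n => (i : ℕ) < k + 1) = S.filter (fun i : Fin n => (i : ℕ) < k) := by
          refine filter_congr fun i hi => ?_
          have : (i : ℕ) ≠ k := fun h => hmem (by
            have : i = ⟨k, hk'⟩ := Fin.ext h
            exact this ▸ hi)
          omega
        rw [e]
        exact (family_prefix_succ k).subset ih
  have h := this n le_rfl
  rwa [filter_true_of_mem fun i _ => i.2] at h

/-- The list of all subsets of `S`. -/
noncomputable def subsetList (S : Finset (Fin n)) : List (Finset (Fin n)) :=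
  family (fun j _ _ => j ∈ S) n

lemma toFinset_subsetList (S : Finset (Fin n)) : (subsetList S).toFinset = S.powerset := by
  ext T
  rw [List.mem_toFinset, mem_powerset]
  constructor
  · refine family_induction (P := (· ⊆ S)) (empty_subset S) (fun j len T hT hj => ?_) n T
    exact insert_subset hj hT
  · exact fun hT => mem_family fun j hj _ _ => hT hj

lemma nodup_subsetList (S : Finset (Fin n)) : (subsetList S).Nodup := nodup_family n

lemma sum_subsetList (S : Finset (Fin n)) (φ : Finset (Fin n) → ℤ) :
    ((subsetList S).map φ).sum = ∑ T ∈ S.powerset, φ T := by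
  rw [← toFinset_subsetList, List.sum_toFinset _ (nodup_subsetList S)]

lemma length_subsetList (S : Finset (Fin n)) : (subsetList S).length = 2 ^ S.card := by
  rw [← List.toFinset_card_of_nodup (nodup_subsetList S), toFinset_subsetList, card_powerset]

lemma length_family_le_length_subsetList (S : Finset (Fin n)) (k : ℕ) :
    (family (fun j _ _ => j ∈ S) k).length ≤ (subsetList S).length := by
  rcases le_total k n with h | h
  · exact (family_prefix h).length_le
  · refine le_of_eq ?_
    induction h with
    | refl => rfl
    | step h ih => rw [family, dif_neg (Nat.not_lt.2 h), ih]

end Family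

/-! ### The learner as a function of its sample -/

section Learner

variable {n m : ℕ}

/-- The number of sample points at which the alternating sum over `S` does not vanish. -/
def sensCount (f : Cube n → ℤˣ) (ω : Fin m → Cube n) (S : Finset (Fin n)) : ℕ :=
  (univ.filter fun u => altSum f S (ω u) ≠ 0).card

/-- The test by which the learner accepts a set. -/
def accepts (f : Cube n → ℤˣ) (ω : Fin m → Cube n) (d w cap : ℕ) (_ : Fin n) (len : ℕ)
    (S : Finset (Fin n)) : Prop :=
  S.card ≤ d ∧ len * n < cap ∧ m < sensCount f ω S * w

/-- The sets collected by the learner. -/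
noncomputable def accepted (f : Cube n → ℤˣ) (ω : Fin m → Cube n) (d w cap : ℕ) :
    List (Finset (Fin n)) :=
  family (accepts f ω d w cap) n

/-- The contribution of the set `S` and the sample point `y` to the vote on `x`. -/
def ballot (f : Cube n → ℤˣ) (x y : Cube n) (S : Finset (Fin n)) : ℤ :=
  if ∀ i ∈ S, y i = -x i then altSum f S y else 0

/-- The integer whose sign is the prediction at `x`. -/
noncomputable def vote (f : Cube n → ℤˣ) (ω : Fin m → Cube n) (d w cap : ℕ) (x : Cube n) : ℤ :=
  ((accepted f ω d w cap).map fun S => ∑ u, ballot f x (ω u) S).sum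

/-- The hypothesis of the learner. -/
noncomputable def hypothesis (f : Cube n → ℤˣ) (d w cap : ℕ) (ω : Fin m → Cube n) (x : Cube n) :
    ℤˣ :=
  if 0 ≤ vote f ω d w cap x then 1 else -1

/-- Each factor is the indicator that the two points differ in that bit. In this form
`coeff_mul_chi` says that the ballot is an unbiased estimate of `f̂(S) χ_S(x)`. -/
lemma ballot_eq (f : Cube n → ℤˣ) (x y : Cube n) (S : Finset (Fin n)) :
    (ballot f x y S : ℝ) = (∏ i ∈ S, (1 - bit x i * bit y i) / 2) * altSum f S y := by
  have h : ∀ i, (1 - bit x i * bit y i) / 2 = if y i = -x i then 1 else 0 := by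
    intro i
    rcases Int.units_eq_one_or (x i) with h1 | h1 <;>
      rcases Int.units_eq_one_or (y i) with h2 | h2 <;> simp [bit, h1, h2]
  rw [ballot, prod_congr rfl fun i _ => h i, prod_ite_zero]
  split_ifs <;> simp

lemma card_le_of_mem_accepted {f : Cube n → ℤˣ} {ω : Fin m → Cube n} {d w cap : ℕ} :
    ∀ S ∈ accepted f ω d w cap, S.card ≤ d :=
  family_induction (P := fun S => S.card ≤ d) (by simp) (fun _ _ _ _ h => h.1) n

lemma length_accepted_le {f : Cube n → ℤˣ} {ω : Fin m → Cube n} {d w cap : ℕ} (hn : 0 < n)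
    (hcap : 1 ≤ cap) (k : ℕ) : (family (accepts f ω d w cap) k).length ≤ cap :=
  length_family_le (fun _ len _ h => lt_of_le_of_lt (Nat.le_mul_of_pos_right len hn) h.2.1) hcap k

variable {μ : Fin n → ℝ} {c ε η : ℝ}

/-- On a sample whose relevant averages are accurate, the hypothesis has small error. -/
theorem err_hypothesis_le (hc : 0 < c) (hc' : c ≤ 1)
    (hμ : ∀ i, μ i ∈ Set.Icc (-1 + 2 * c) (1 - 2 * c)) (T : DecTree n) {ω : Fin m → Cube n}
    {d w cap : ℕ} (hm : 0 < m) (hw : 0 < w)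
    (hcount : ∀ S : Finset (Fin n), S.card ≤ d →
      |(sensCount T.eval ω S : ℝ) - m * sensProb μ T.eval S| ≤ m * η)
    (hballot : ∀ (S : Finset (Fin n)) (x : Cube n), S.card ≤ d →
      |((∑ u, ballot T.eval x (ω u) S : ℤ) : ℝ) - m * (coeff μ T.eval S * chi μ S x)| ≤
        m * (2 ^ d * η))
    (hη : η ≤ 1 / (2 * w)) (hcapη : cap * (2 ^ d * η) ≤ 1 / 4)
    (hcap : (1 + 2 * w * T.leaves / c ^ d) * n < cap)
    (hε : T.leaves * 2 ^ d * (2 / w) + T.leaves * (1 - c) ^ d ≤ 9 / 16 * ε) :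
    err (prodDist μ) (hypothesis T.eval d w cap ω) T.eval ≤ ε := by
  have hμ' : ∀ i, μ i ^ 2 < 1 := fun i => sq_lt_one_of_mem hc (hμ i)
  have hm' : (0 : ℝ) < m := by exact_mod_cast hm
  have hw' : (0 : ℝ) < w := by exact_mod_cast hw
  set 𝒮 := (accepted T.eval ω d w cap).toFinset with h𝒮
  have hnodup : (accepted T.eval ω d w cap).Nodup := nodup_family n
  have hlen : (accepted T.eval ω d w cap).length = 𝒮.card :=
    (List.toFinset_card_of_nodup hnodup).symm
  -- Acceptance means an empirical sensitivity above `1/w`, and the sampling error is at most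
  -- `1/(2w)`.
  have hsens : ∀ S ∈ 𝒮.erase ∅, S.card ≤ d ∧ 1 / (2 * w) ≤ sensProb μ T.eval S := by
    intro S hS
    have h : S = ∅ ∨ (S.card ≤ d ∧ m < sensCount T.eval ω S * w) :=
      family_induction (P := fun S => S = ∅ ∨ (S.card ≤ d ∧ m < sensCount T.eval ω S * w))
        (Or.inl rfl) (fun _ _ _ _ h => Or.inr ⟨h.1, h.2.2⟩) n S
        (List.mem_toFinset.1 (mem_of_mem_erase hS))
    obtain ⟨h1, h2⟩ := h.resolve_left (ne_of_mem_erase hS)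
    refine ⟨h1, ?_⟩
    have h3 := (abs_le.1 (hcount S h1)).2
    have h4 : (m : ℝ) < sensCount T.eval ω S * w := by exact_mod_cast h2
    have h5 : (m : ℝ) * (1 / w) < sensCount T.eval ω S := by
      rw [mul_one_div, div_lt_iff₀ hw']; exact h4
    have h6 : (m : ℝ) * (1 / w) ≤ m * (sensProb μ T.eval S + η) := by linarith
    have h7 := le_of_mul_le_mul_left h6 hm'
    have h8 : (1 : ℝ) / w = 1 / (2 * w) + 1 / (2 * w) := by field_simp; norm_num
    linarith
  -- By the count of sensitive sets the storage bound is never reached on a good sample, so it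
  -- rejects nothing.
  have hcard : (𝒮.card : ℝ) * n < cap := by
    refine lt_of_le_of_lt (mul_le_mul_of_nonneg_right ?_ (Nat.cast_nonneg n)) hcap
    have h1 := card_mul_le_leaves hc hc' hμ T (𝒮.erase ∅) hsens
    have h2 : (𝒮.card : ℝ) ≤ 1 + (𝒮.erase ∅).card := by
      have := card_le_card (subset_insert_iff.2 (subset_refl (𝒮.erase ∅)))
      rw [add_comm]
      exact_mod_cast this.trans (card_insert_le _ _)
    have h3 : ((𝒮.erase ∅).card : ℝ) ≤ 2 * w * T.leaves / c ^ d := by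
      rw [le_div_iff₀ (pow_pos hc d)]
      calc ((𝒮.erase ∅).card : ℝ) * c ^ d =
          (𝒮.erase ∅).card * (c ^ d * (1 / (2 * w))) * (2 * w) := by field_simp
        _ ≤ T.leaves * (2 * w) := by gcongr
        _ = _ := by ring
    linarith
  -- If the squared coefficient exceeded `2/w`, every initial segment of `S` would have true
  -- sensitivity above `2/w`, hence empirical sensitivity above `1/w`, and `mem_family` would put
  -- `S` into the family.
  have hheavy : ∀ S, S ∉ 𝒮 → S.card ≤ d → coeff μ T.eval S ^ 2 ≤ 2 / w := by
    intro S hS hSd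
    by_contra hcon
    refine hS (List.mem_toFinset.2 (mem_family fun j _ len hl => ⟨?_, ?_, ?_⟩))
    · exact (card_le_card (filter_subset _ _)).trans hSd
    · have hl' : len ≤ 𝒮.card := hlen ▸ hl
      have : 𝒮.card * n < cap := by exact_mod_cast hcard
      exact lt_of_le_of_lt (Nat.mul_le_mul_right n hl') this
    · set S' := S.filter (· ≤ j) with hS'
      have h1 : 2 / (w : ℝ) < sensProb μ T.eval S' := by
        calc 2 / (w : ℝ) < coeff μ T.eval S ^ 2 := not_le.1 hcon
          _ ≤ expect μ (fun x => fSub μ T.eval S x ^ 2) := coeff_sq_le_expect hμ' _ S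
          _ ≤ expect μ (fun x => fSub μ T.eval S' x ^ 2) :=
              expect_fSub_sq_anti hμ' _ (filter_subset _ _)
          _ ≤ _ := expect_fSub_sq_le_sensProb hμ' _ S'
      have h2 := (abs_le.1 (hcount S' ((card_le_card (filter_subset _ _)).trans hSd))).1
      have h3 : η ≤ 1 / w := hη.trans (by gcongr; linarith)
      have h4 : (m : ℝ) * (1 / w) < sensCount T.eval ω S' := by
        have : (m : ℝ) * (1 / w) < m * (sensProb μ T.eval S' - η) := by
          refine mul_lt_mul_of_pos_left ?_ hm'
          have : (2 : ℝ) / w = 1 / w + 1 / w := by ring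
          linarith
        linarith
      rw [mul_one_div, div_lt_iff₀ hw'] at h4
      exact_mod_cast h4
  -- The estimation errors of the collected sets add up to at most `cap * (2 ^ d * η)`.
  have hclose : ∀ x, |(vote T.eval ω d w cap x : ℝ) / m -
      ∑ S ∈ 𝒮, coeff μ T.eval S * chi μ S x| ≤ 1 / 4 := by
    intro x
    have h1 : (vote T.eval ω d w cap x : ℝ) =
        ∑ S ∈ 𝒮, ((∑ u, ballot T.eval x (ω u) S : ℤ) : ℝ) := by
      rw [vote, ← List.sum_toFinset _ hnodup, Int.cast_sum]
    rw [h1, sum_div, ← sum_sub_distrib]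
    refine (abs_sum_le_sum_abs _ _).trans ?_
    have h2 : ∀ S ∈ 𝒮, |((∑ u, ballot T.eval x (ω u) S : ℤ) : ℝ) / m -
        coeff μ T.eval S * chi μ S x| ≤ 2 ^ d * η := by
      intro S hS
      have h3 := hballot S x (card_le_of_mem_accepted S (List.mem_toFinset.1 hS))
      have e : ((∑ u, ballot T.eval x (ω u) S : ℤ) : ℝ) / m - coeff μ T.eval S * chi μ S x =
          (((∑ u, ballot T.eval x (ω u) S : ℤ) : ℝ) - m * (coeff μ T.eval S * chi μ S x)) / m := by
        field_simp
      rw [e, abs_div, abs_of_pos hm', div_le_iff₀ hm']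
      linarith
    refine (sum_le_sum h2).trans ?_
    rw [sum_const, nsmul_eq_mul]
    refine le_trans (mul_le_mul_of_nonneg_right ?_ ?_) hcapη
    -- In dimension zero the bound on `card * n` says nothing about the number of sets, but `∅` is
    -- the only one.
    · by_cases hn : n = 0
      · subst hn
        have h5 : 𝒮.card ≤ 1 := card_le_one.2 fun a _ b _ => Subsingleton.elim a b
        have h6 : (0 : ℝ) < cap := by simpa using hcard
        have h7 : 1 ≤ cap := by exact_mod_cast h6
        exact_mod_cast h5.trans h7
      · have : (1 : ℝ) ≤ n := by exact_mod_cast Nat.pos_of_ne_zero hn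
        nlinarith [(Nat.cast_nonneg 𝒮.card : (0 : ℝ) ≤ 𝒮.card)]
    · have := (abs_nonneg _).trans (hballot ∅ x (by simp))
      exact nonneg_of_mul_nonneg_right this hm'
  have hsgn : hypothesis T.eval d w cap ω =
      fun x => sgn ((vote T.eval ω d w cap x : ℝ) / m) := by
    funext x
    have : 0 ≤ vote T.eval ω d w cap x ↔ (0 : ℝ) ≤ (vote T.eval ω d w cap x : ℝ) / m := by
      rw [le_div_iff₀ hm', zero_mul]
      exact_mod_cast Iff.rfl
    simp only [hypothesis, sgn, this]
  have h1 := err_sgn_le hμ' T.eval (fun x => ∑ S ∈ 𝒮, coeff μ T.eval S * chi μ S x)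
    (fun x => (vote T.eval ω d w cap x : ℝ) / m) (a := 1 / 4) (by norm_num) hclose
  have h2 := expect_sq_sub_sum hμ' (toReal T.eval) 𝒮
  have h3 := sum_coeff_sq_compl_le hc hc' hμ T d (by positivity : (0 : ℝ) ≤ 2 / w) 𝒮 hheavy
  rw [hsgn]
  -- The tolerance `1/4` of the vote costs the factor `(3/4)² = 9/16`, for which `hε` leaves room.
  have h4 : (1 - 1 / 4 : ℝ) ^ 2 * err (prodDist μ)
      (fun x => sgn ((vote T.eval ω d w cap x : ℝ) / m)) T.eval ≤ 9 / 16 * ε :=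
    h1.trans (h2.le.trans (h3.trans hε))
  norm_num at h4
  linarith

/-- The hypothesis has small error with high probability over the sample. -/
theorem le_sum_good_sample (hc : 0 < c) (hc' : c ≤ 1)
    (hμ : ∀ i, μ i ∈ Set.Icc (-1 + 2 * c) (1 - 2 * c)) (T : DecTree n)
    {d w cap : ℕ} {δ : ℝ} (hm : 0 < m) (hw : 0 < w) (hη0 : 0 ≤ η)
    (hδ : 4 * ((n : ℝ) + 1) ^ (2 * d) * Real.exp (-(m * η ^ 2 / 16)) ≤ δ)
    (hη : η ≤ 1 / (2 * w)) (hcapη : cap * (2 ^ d * η) ≤ 1 / 4)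
    (hcap : (1 + 2 * w * T.leaves / c ^ d) * n < cap)
    (hε : T.leaves * 2 ^ d * (2 / w) + T.leaves * (1 - c) ^ d ≤ 9 / 16 * ε)
    [DecidablePred fun ω : Fin m → Cube n =>
      err (prodDist μ) (hypothesis T.eval d w cap ω) T.eval ≤ ε] :
    1 - δ ≤ ∑ ω : Fin m → Cube n with
      err (prodDist μ) (hypothesis T.eval d w cap ω) T.eval ≤ ε, ∏ u, prodDist μ (ω u) := by
  have hμ' : ∀ i, μ i ^ 2 < 1 := fun i => sq_lt_one_of_mem hc (hμ i)
  -- The ballot at `S` depends on `x` only through its positive bits in `S`, so one representative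
  -- point for each small set `A` suffices. The union bound then runs over `2 (n+1)^{2d}` functions
  -- at most instead of all `2^n` arguments.
  let pt : Finset (Fin n) → Cube n := fun A i => if i ∈ A then 1 else -1
  let g : Finset (Fin n) × Finset (Fin n) × Bool → Cube n → ℝ := fun k y =>
    bif k.2.2 then (if altSum T.eval k.1 y = 0 then 0 else 1)
    else (ballot T.eval (pt k.2.1) y k.1 : ℝ) / 2 ^ d
  have h2d : (0 : ℝ) < 2 ^ d := by positivity
  refine le_sum_sample (prodDist_nonneg hμ') sum_prodDist
    (smallSets n d ×ˢ (smallSets n d ×ˢ (univ : Finset Bool))) g ?_ hη0 ?_ ?_ _ fun ω hω => ?_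
  · rintro ⟨S, A, b⟩ hk y
    simp only [mem_product, mem_smallSets] at hk
    cases b
    · simp only [g, cond_false]
      rw [abs_div, abs_of_pos h2d, div_le_one h2d, ballot]
      split_ifs
      · exact (abs_altSum_le _ _ _).trans (pow_le_pow_right₀ (by norm_num) hk.1)
      · simp
    · simp only [g, cond_true]
      split_ifs <;> simp
  · have : (1 : ℝ) ≤ w := by exact_mod_cast hw
    refine hη.trans ?_
    rw [div_le_one (by linarith)]
    linarith
  · refine le_trans (mul_le_mul_of_nonneg_right ?_ (Real.exp_pos _).le) hδ
    have h1 : ((smallSets n d).card : ℝ) ≤ ((n : ℝ) + 1) ^ d := by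
      exact_mod_cast card_smallSets_le n d
    rw [card_product, card_product, Nat.cast_mul, Nat.cast_mul, card_univ, Fintype.card_bool,
      two_mul d, pow_add]
    have := mul_le_mul h1 h1 (Nat.cast_nonneg _) (by positivity)
    push_cast
    linarith
  · refine err_hypothesis_le hc hc' hμ T hm hw (fun S hS => ?_) (fun S x hS => ?_) hη hcapη hcap hε
    · have h := hω (S, ∅, true) (by simp [mem_smallSets, hS])
      simp only [g, cond_true, sum_sub_distrib, sum_const, card_univ, Fintype.card_fin,
        nsmul_eq_mul] at h
      have e : (sensCount T.eval ω S : ℝ) =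
          ∑ u, if altSum T.eval S (ω u) = 0 then (0 : ℝ) else 1 := by
        rw [sensCount, card_filter]
        push_cast
        exact sum_congr rfl fun u _ => by split_ifs <;> simp_all
      rw [e]
      exact h.le
    · have h := hω (S, S.filter (fun i => x i = 1), false) (by
        simp only [mem_product, mem_smallSets, mem_univ, and_true]
        exact ⟨hS, (card_le_card (filter_subset _ _)).trans hS⟩)
      have hb : ∀ y, ballot T.eval (pt (S.filter (fun i => x i = 1))) y S =
          ballot T.eval x y S := by
        intro y
        have : (∀ i ∈ S, y i = -pt (S.filter (fun i => x i = 1)) i) ↔ ∀ i ∈ S, y i = -x i := by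
          refine forall₂_congr fun i hi => ?_
          rcases Int.units_eq_one_or (x i) with h1 | h1 <;> simp [pt, hi, h1]
        simp only [ballot, this]
      simp only [g, cond_false, hb] at h
      have e2 : ∑ y, prodDist μ y * ((ballot T.eval x y S : ℝ) / 2 ^ d) =
          coeff μ T.eval S * chi μ S x / 2 ^ d := by
        rw [coeff_mul_chi hμ', expect, sum_div]
        refine sum_congr rfl fun y _ => ?_
        rw [ballot_eq]
        ring
      rw [e2, ← sum_congr rfl fun u _ => sub_div _ _ _, ← sum_div, abs_div, abs_of_pos h2d,
        div_lt_iff₀ h2d, sum_sub_distrib, sum_const, card_univ, Fintype.card_fin,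
        nsmul_eq_mul] at h
      rw [Int.cast_sum]
      linarith

end Learner

/-! ### Reasoning about programs -/

section Logic

variable {n m : ℕ} {f : Cube n → ℤˣ} {r : ℕ} {ω : Fin m → Cube n}

/-- The program `p` halts from `s`, in a state and after a number of steps that satisfy `Q`. -/
def Runs (f : Cube n → ℤˣ) (r : ℕ) (ω : Fin m → Cube n) (p : Cmd) (s : State)
    (Q : State → ℕ → Prop) : Prop :=
  ∃ s' k, Exec f r ω p s s' k ∧ Q s' k

lemma Runs.mono {p : Cmd} {s : State} {Q Q' : State → ℕ → Prop} (h : Runs f r ω p s Q)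
    (hQ : ∀ s' k, Q s' k → Q' s' k) : Runs f r ω p s Q' :=
  let ⟨s', k, he, hq⟩ := h
  ⟨s', k, he, hQ s' k hq⟩

/-- This rule and the ones for assignment, sequence and branching are equivalences, so that
rewriting executes straight-line code symbolically and accumulates its cost. -/
lemma runs_skip {s : State} {Q : State → ℕ → Prop} : Runs f r ω .skip s Q ↔ Q s 1 := by
  constructor
  · rintro ⟨s', k, he, hq⟩
    cases he
    exact hq
  · exact fun h => ⟨s, 1, .skip s, h⟩

lemma runs_set {a : ℕ} {i e : Expr} {s : State} {Q : State → ℕ → Prop} :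
    Runs f r ω (.set a i e) s Q ↔
      Q ⟨s.mem.write a (i.val s.mem) (e.val s.mem), s.drawn⟩ (i.cost + e.cost + 1) := by
  constructor
  · rintro ⟨s', k, he, hq⟩
    cases he
    exact hq
  · exact fun h => ⟨_, _, .set s a i e, h⟩

lemma runs_seq {p q : Cmd} {s : State} {Q : State → ℕ → Prop} :
    Runs f r ω (.seq p q) s Q ↔
      Runs f r ω p s (fun s' k => Runs f r ω q s' fun s'' l => Q s'' (k + l)) := by
  constructor
  · rintro ⟨s', k, he, hq⟩
    cases he with
    | seq h1 h2 => exact ⟨_, _, h1, _, _, h2, hq⟩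
  · rintro ⟨s', k, h1, s'', l, h2, hq⟩
    exact ⟨_, _, .seq h1 h2, hq⟩

lemma runs_ite {e : Expr} {p q : Cmd} {s : State} {Q : State → ℕ → Prop} :
    Runs f r ω (.ite e p q) s Q ↔ if 0 < e.val s.mem then
      Runs f r ω p s (fun s' k => Q s' (e.cost + 1 + k))
      else Runs f r ω q s (fun s' k => Q s' (e.cost + 1 + k)) := by
  constructor
  · rintro ⟨s', k, he, hq⟩
    cases he with
    | ite_pos h h1 => rw [if_pos h]; exact ⟨_, _, h1, hq⟩
    | ite_neg h h1 => rw [if_neg h]; exact ⟨_, _, h1, hq⟩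
  · intro h
    split_ifs at h with he
    · obtain ⟨s', k, h1, hq⟩ := h
      exact ⟨_, _, .ite_pos he h1, hq⟩
    · obtain ⟨s', k, h1, hq⟩ := h
      exact ⟨_, _, .ite_neg he h1, hq⟩

lemma runs_mq {a b : ℕ} {i j : Expr} {s : State} {Q : State → ℕ → Prop} (q : Cube n)
    (hq : ∀ v : Fin n, s.mem a (i.val s.mem + (v : ℕ)) = (q v : ℤ))
    (hloc : ∃ u : Fin m, (u : ℕ) < s.drawn ∧ hammingDist (ω u) q ≤ r)
    (hQ : Q ⟨s.mem.write b (j.val s.mem) (f q : ℤˣ), s.drawn⟩ (i.cost + j.cost + n + 1)) :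
    Runs f r ω (.mq a i b j) s Q :=
  ⟨_, _, .mq s a i b j q hq hloc, hQ⟩

lemma runs_ex {a : ℕ} {i : Expr} {s : State} {Q : State → ℕ → Prop} (h : s.drawn < m)
    (hQ : Q ⟨(s.mem.writePoint a (i.val s.mem) (ω ⟨s.drawn, h⟩)).write a (i.val s.mem + n)
          (f (ω ⟨s.drawn, h⟩) : ℤˣ), s.drawn + 1⟩ (i.cost + n + 1)) :
    Runs f r ω (.ex a i) s Q :=
  ⟨_, _, .ex s a i h, hQ⟩

/-- The arrays that a program may change. -/
def Cmd.mods : Cmd → List ℕ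
  | .skip => []
  | .set a _ _ => [a]
  | .seq p q => p.mods ++ q.mods
  | .ite _ p q => p.mods ++ q.mods
  | .loop _ p => p.mods
  | .ex a _ => [a]
  | .mq _ _ b _ => [b]

/-- Whether a program may draw examples. -/
def Cmd.draws : Cmd → Bool
  | .skip => false
  | .set _ _ _ => false
  | .seq p q => p.draws || q.draws
  | .ite _ p q => p.draws || q.draws
  | .loop _ p => p.draws
  | .ex _ _ => true
  | .mq _ _ _ _ => false

/-- Between `s` and `s'` only the arrays in `W` have changed, and no example has been drawn. -/
structure Frame (W : List ℕ) (s s' : State) : Prop where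
  mem : ∀ a, a ∉ W → s'.mem a = s.mem a
  drawn : s'.drawn = s.drawn

lemma Frame.refl (W : List ℕ) (s : State) : Frame W s s := ⟨fun _ _ => rfl, rfl⟩

lemma Frame.trans {W : List ℕ} {s s' s'' : State} (h : Frame W s s') (h' : Frame W s' s'') :
    Frame W s s'' :=
  ⟨fun a ha => (h'.mem a ha).trans (h.mem a ha), h'.drawn.trans h.drawn⟩

lemma Frame.mono {W W' : List ℕ} {s s' : State} (h : Frame W s s') (hW : W ⊆ W') :
    Frame W' s s' :=
  ⟨fun a ha => h.mem a fun h' => ha (hW h'), h.drawn⟩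

lemma Mem.write_of_ne {M : Mem} {a a' : ℕ} (h : a' ≠ a) (i v : ℤ) : M.write a i v a' = M a' := by
  funext i'
  simp [Mem.write, h]

lemma Mem.write_apply (M : Mem) (a : ℕ) (i v i' : ℤ) :
    M.write a i v a i' = if i' = i then v else M a i' := by
  simp [Mem.write]

lemma Frame.write {W : List ℕ} {s s' : State} (h : Frame W s s') {a : ℕ} (ha : a ∈ W)
    (i v : ℤ) : Frame W s ⟨s'.mem.write a i v, s'.drawn⟩ :=
  ⟨fun b hb => (Mem.write_of_ne (fun e => hb (by rw [e]; exact ha)) i v).trans (h.mem b hb), h.drawn⟩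

/-- Arrays that do not occur among the syntactic targets of a program keep their contents; for
concrete programs this reduces to a decidable membership. -/
lemma Exec.frame {p : Cmd} {s s' : State} {k : ℕ} (h : Exec f r ω p s s' k)
    (hp : p.draws = false) : Frame p.mods s s' := by
  induction h with
  | skip s => exact Frame.refl _ _
  | set s a i e => exact (Frame.refl _ s).write (by simp [Cmd.mods]) _ _
  | seq h1 h2 ih1 ih2 =>
    simp only [Cmd.draws, Bool.or_eq_false_iff] at hp
    exact ((ih1 hp.1).mono (by simp [Cmd.mods])).trans ((ih2 hp.2).mono (by simp [Cmd.mods]))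
  | ite_pos _ _ ih =>
    simp only [Cmd.draws, Bool.or_eq_false_iff] at hp
    exact (ih hp.1).mono (by simp [Cmd.mods])
  | ite_neg _ _ ih =>
    simp only [Cmd.draws, Bool.or_eq_false_iff] at hp
    exact (ih hp.2).mono (by simp [Cmd.mods])
  | loop_done _ => exact Frame.refl _ _
  | loop_step _ _ _ ih1 ih2 =>
    exact (ih1 hp).trans (ih2 hp)
  | ex s a i h => simp [Cmd.draws] at hp
  | mq s a i b j q _ _ => exact (Frame.refl _ s).write (by simp [Cmd.mods]) _ _

lemma Runs.frame {p : Cmd} {s : State} {Q : State → ℕ → Prop} (h : Runs f r ω p s Q)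
    (hp : p.draws = false) : Runs f r ω p s (fun s' k => Q s' k ∧ Frame p.mods s s') :=
  let ⟨s', k, he, hq⟩ := h
  ⟨s', k, he, hq, he.frame hp⟩

/-- The rule for loops that run for a known number of rounds. -/
theorem runs_loop {e : Expr} {p : Cmd} {s : State} (I : ℕ → State → Prop) (N B : ℕ) (h0 : I 0 s)
    (hstep : ∀ i < N, ∀ s, I i s → 0 < e.val s.mem ∧
      Runs f r ω p s (fun s' k => k ≤ B ∧ I (i + 1) s'))
    (hend : ∀ s, I N s → ¬ 0 < e.val s.mem) :
    Runs f r ω (.loop e p) s (fun s' k => k ≤ N * (e.cost + 1 + B) + (e.cost + 1) ∧ I N s') := by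
  -- The induction is on the number of rounds still to come, since execution of a loop unfolds from
  -- its first round.
  have : ∀ j ≤ N, ∀ s, I (N - j) s → Runs f r ω (.loop e p) s
      (fun s' k => k ≤ j * (e.cost + 1 + B) + (e.cost + 1) ∧ I N s') := by
    intro j
    induction j with
    | zero =>
      intro _ s hs
      exact ⟨s, _, .loop_done (hend s hs), by simp, hs⟩
    | succ j ih =>
      intro hj s hs
      obtain ⟨hpos, s', k, he, hk, hs'⟩ := hstep (N - (j + 1)) (by omega) s hs
      rw [show N - (j + 1) + 1 = N - j by omega] at hs'
      obtain ⟨s'', l, he', hl, hs''⟩ := ih (by omega) s' hs'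
      refine ⟨s'', _, .loop_step hpos he he', ?_, hs''⟩
      rw [Nat.succ_mul]
      omega
  exact this N le_rfl s (by rwa [Nat.sub_self])

/-- The rule for loops that draw no examples: what the body does not change stays the same. -/
theorem runs_loop_frame {e : Expr} {p : Cmd} {s₀ : State} (I : ℕ → State → Prop) (N B : ℕ)
    (hp : p.draws = false) (h0 : I 0 s₀)
    (hstep : ∀ i < N, ∀ s, Frame p.mods s₀ s → I i s → 0 < e.val s.mem ∧
      Runs f r ω p s (fun s' k => k ≤ B ∧ I (i + 1) s'))
    (hend : ∀ s, Frame p.mods s₀ s → I N s → ¬ 0 < e.val s.mem) :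
    Runs f r ω (.loop e p) s₀ (fun s' k => k ≤ N * (e.cost + 1 + B) + (e.cost + 1) ∧ I N s' ∧
      Frame p.mods s₀ s') := by
  refine (runs_loop (fun i s => I i s ∧ Frame p.mods s₀ s) N B ⟨h0, Frame.refl _ _⟩ ?_ ?_)
  · rintro i hi s ⟨hI, hF⟩
    obtain ⟨h1, h2⟩ := hstep i hi s hF hI
    refine ⟨h1, (h2.frame hp).mono ?_⟩
    rintro s' k ⟨⟨hk, hI'⟩, hF'⟩
    exact ⟨hk, hI', hF.trans hF'⟩
  · rintro s ⟨hI, hF⟩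
    exact hend s hF hI

/-- The value of the scalar variable `a`, kept in cell `0` of array `a`. -/
def var (a : ℕ) : Expr := .get a (.const 0)

/-- Assign to the scalar variable `a`. -/
def assign (a : ℕ) (e : Expr) : Cmd := .set a (.const 0) e

/-- The expression for the dimension. -/
def dim : Expr := .get 0 (.const 0)

end Logic

/-- The row `S` is stored from index `p` on as an indicator vector. -/
def IsRow {n : ℕ} (A : ℤ → ℤ) (p : ℤ) (S : Finset (Fin n)) : Prop :=
  ∀ i : Fin n, A (p + (i : ℕ)) = if i ∈ S then 1 else 0

/-- The rows of the list `L` are stored one after the other. -/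
def IsRows {n : ℕ} (A : ℤ → ℤ) (L : List (Finset (Fin n))) : Prop :=
  ∀ a (h : a < L.length), IsRow A ((a : ℤ) * n) L[a]

/-! ### Growing a family of sets -/

/-- Copy the row at the source pointer to the end of the list. -/
def copyRow (b : ℕ) : Cmd :=
  .seq (assign (b + 5) (.const 0))
    (.loop (.sub dim (var (b + 5)))
      (.seq (.set b (.add (var (b + 1)) (var (b + 5)))
        (.get b (.add (var (b + 4)) (var (b + 5)))))
        (assign (b + 5) (.add (var (b + 5)) (.const 1)))))

/-- Store the empty set as the first row. -/
def clearRow (b : ℕ) : Cmd :=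
  .seq (assign (b + 5) (.const 0))
    (.loop (.sub dim (var (b + 5)))
      (.seq (.set b (var (b + 5)) (.const 0))
        (assign (b + 5) (.add (var (b + 5)) (.const 1)))))

/-- One attempt to extend the family. -/
def growRow (b : ℕ) (test : Cmd) : Cmd :=
  .seq (copyRow b)
    (.seq (.set b (.add (var (b + 1)) (var (b + 2))) (.const 1))
      (.seq test
        (.seq (.ite (var (b + 6)) (assign (b + 1) (.add (var (b + 1)) dim)) .skip)
          (assign (b + 4) (.add (var (b + 4)) dim)))))

/-- All attempts with a given coordinate. -/
def growRound (b : ℕ) (test : Cmd) : Cmd :=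
  .seq (assign (b + 3) (var (b + 1)))
    (.seq (assign (b + 4) (.const 0))
      (.seq (.loop (.sub (var (b + 3)) (var (b + 4))) (growRow b test))
        (assign (b + 2) (.add (var (b + 2)) (.const 1)))))

/-- Build the family of sets given by `test`. The rows are in array `b`, and the scalars are
the end pointer `b + 1`, the coordinate `b + 2`, the end of the sources `b + 3`, the source
pointer `b + 4`, the index `b + 5` and the verdict `b + 6` of the test. -/
def growCmd (b : ℕ) (test : Cmd) : Cmd :=
  .seq (clearRow b)
    (.seq (assign (b + 1) dim)
      (.seq (assign (b + 2) (.const 0))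
        (.loop (.sub dim (var (b + 2))) (growRound b test))))

section Grow

variable {n m : ℕ} {f : Cube n → ℤˣ} {r : ℕ} {ω : Fin m → Cube n}

lemma runs_copyRow {b : ℕ} (hb : 0 < b) {s : State} {p q : ℤ} {S : Finset (Fin n)}
    (hn : s.mem 0 0 = n) (hq : s.mem (b + 1) 0 = q) (hp : s.mem (b + 4) 0 = p)
    (hpq : p + n ≤ q) (hS : IsRow (s.mem b) p S) :
    Runs f r ω (copyRow b) s (fun s' k => k ≤ 40 * n + 20 ∧ IsRow (s'.mem b) q S ∧
      ∀ z < q, s'.mem b z = s.mem b z) := by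
  have hb0 : b ≠ 0 := hb.ne'
  simp only [copyRow, assign, runs_seq, runs_set, Expr.val, Expr.cost]
  refine (runs_loop_frame (fun i s' => s'.mem (b + 5) 0 = i ∧
    (∀ j : Fin n, (j : ℕ) < i → s'.mem b (q + (j : ℕ)) = if j ∈ S then 1 else 0) ∧
    ∀ z < q, s'.mem b z = s.mem b z) n 30 rfl ?_ ?_ ?_).mono ?_
  · refine ⟨by simp [Mem.write], fun j hj => by omega, fun z _ => by simp [Mem.write]⟩
  · rintro i hi s' hF ⟨h1, h2, h3⟩
    have e0 : s'.mem 0 0 = n := by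
      rw [hF.mem 0 (by simp [Cmd.mods, hb0.symm])]; simp [Mem.write, hn]
    have e1 : s'.mem (b + 1) 0 = q := by
      rw [hF.mem (b + 1) (by simp [Cmd.mods])]; simp [Mem.write, hq]
    have e4 : s'.mem (b + 4) 0 = p := by
      rw [hF.mem (b + 4) (by simp [Cmd.mods])]; simp [Mem.write, hp]
    have hrow : s'.mem b (p + i) = if (⟨i, hi⟩ : Fin n) ∈ S then 1 else 0 := by
      rw [h3 _ (by omega)]; exact hS ⟨i, hi⟩
    refine ⟨?_, ?_⟩
    · simp only [Expr.val, dim, var, e0, h1]; omega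
    · simp only [runs_seq, runs_set, Expr.val, Expr.cost, var]
      refine ⟨by omega, ?_, ?_, ?_⟩
      · simp [Mem.write, h1]
      · intro j hj
        rcases Nat.lt_succ_iff_lt_or_eq.1 hj with hj | hj
        · have := h2 j hj
          have hne : (j : ℕ) ≠ i := by omega
          simp [Mem.write, h1, e1, hne, this]
        · have : j = ⟨i, hi⟩ := Fin.ext hj
          subst this
          simp [Mem.write, h1, e1, e4, hrow]
      · intro z hz
        have : z ≠ q + i := by omega
        simp [Mem.write, h1, e1, this, h3 z hz]
  · rintro s' hF ⟨h1, -⟩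
    have e0 : s'.mem 0 0 = n := by
      rw [hF.mem 0 (by simp [Cmd.mods, hb0.symm])]; simp [Mem.write, hn]
    simp only [Expr.val, dim, var, e0, h1]; omega
  · rintro s' k ⟨hk, ⟨h1, h2, h3⟩, hF⟩
    simp only [Expr.cost, dim, var] at hk
    exact ⟨by omega, fun j => h2 j j.2, h3⟩

lemma runs_clearRow {b : ℕ} (hb : 0 < b) {s : State} (hn : s.mem 0 0 = n) :
    Runs f r ω (clearRow b) s (fun s' k => k ≤ 40 * n + 20 ∧
      IsRow (s'.mem b) 0 (∅ : Finset (Fin n))) := by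
  have hb0 : b ≠ 0 := hb.ne'
  simp only [clearRow, assign, runs_seq, runs_set, Expr.val, Expr.cost]
  refine (runs_loop_frame (fun i s' => s'.mem (b + 5) 0 = i ∧
    (∀ j : Fin n, (j : ℕ) < i → s'.mem b ((j : ℕ) : ℤ) = 0)) n 30 rfl ?_ ?_ ?_).mono ?_
  · exact ⟨by simp [Mem.write], fun j hj => by omega⟩
  · rintro i hi s' hF ⟨h1, h2⟩
    have e0 : s'.mem 0 0 = n := by
      rw [hF.mem 0 (by simp [Cmd.mods, hb0.symm])]; simp [Mem.write, hn]
    refine ⟨?_, ?_⟩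
    · simp only [Expr.val, dim, var, e0, h1]; omega
    · simp only [runs_seq, runs_set, Expr.val, Expr.cost, var]
      refine ⟨by omega, ?_, ?_⟩
      · simp [Mem.write, h1]
      · intro j hj
        rcases Nat.lt_succ_iff_lt_or_eq.1 hj with hj | hj
        · simp [Mem.write, h2 j hj]
        · simp [Mem.write, h1, hj]
  · rintro s' hF ⟨h1, -⟩
    have e0 : s'.mem 0 0 = n := by
      rw [hF.mem 0 (by simp [Cmd.mods, hb0.symm])]; simp [Mem.write, hn]
    simp only [Expr.val, dim, var, e0, h1]; omega
  · rintro s' k ⟨hk, ⟨h1, h2⟩, hF⟩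
    simp only [Expr.cost, dim, var] at hk
    exact ⟨by omega, fun j => by simpa using h2 j j.2⟩

lemma row_lt {a len i n : ℕ} (ha : a < len) (hi : i < n) : (a : ℤ) * n + i < len * n := by
  have : (a + 1) * n ≤ len * n := Nat.mul_le_mul_right n ha
  have h : (((a + 1) * n : ℕ) : ℤ) ≤ ((len * n : ℕ) : ℤ) := by exact_mod_cast this
  push_cast at h
  nlinarith

lemma IsRow.congr {A A' : ℤ → ℤ} {p : ℤ} {S : Finset (Fin n)} (h : IsRow A p S)
    (hA : ∀ i : Fin n, A' (p + (i : ℕ)) = A (p + (i : ℕ))) : IsRow A' p S :=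
  fun i => (hA i).trans (h i)

lemma IsRows.congr {A A' : ℤ → ℤ} {L : List (Finset (Fin n))} (h : IsRows A L)
    (hA : ∀ z < (L.length : ℤ) * n, A' z = A z) : IsRows A' L :=
  fun a ha => (h a ha).congr fun i => hA _ (row_lt ha i.2)

lemma IsRows.append {A : ℤ → ℤ} {L : List (Finset (Fin n))} {S : Finset (Fin n)}
    (h : IsRows A L) (hS : IsRow A ((L.length : ℤ) * n) S) : IsRows A (L ++ [S]) := by
  intro a ha
  rw [List.length_append, List.length_singleton] at ha
  rcases Nat.lt_succ_iff_lt_or_eq.1 ha with h' | h'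
  · rw [List.getElem_append_left h']
    exact h a h'
  · subst h'
    rw [List.getElem_append_right le_rfl]
    simpa using hS

/-- The candidate is built just past the end of the list, and acceptance merely advances the end
pointer. A rejected candidate stays behind as garbage, outside the range that the invariant
describes. -/
lemma runs_growRow {b : ℕ} {test : Cmd} {Bt : ℕ} (hb : 0 < b) (htd : test.draws = false)
    (htm : ∀ a ∈ [0, b, b + 1, b + 2, b + 3, b + 4], a ∉ test.mods)
    {ok : Fin n → ℕ → Finset (Fin n) → Prop} {s : State} {cur : List (Finset (Fin n))}
    {a : ℕ} {S : Finset (Fin n)} {j : Fin n}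
    (htest : ∀ s', Frame (growRow b test).mods s s' → s'.mem (b + 1) 0 = cur.length * n →
      s'.mem (b + 2) 0 = (j : ℕ) → IsRow (s'.mem b) (cur.length * n) (insert j S) →
      Runs f r ω test s' (fun s'' k => k ≤ Bt ∧
        (0 < s''.mem (b + 6) 0 ↔ ok j cur.length (insert j S))))
    (hn : s.mem 0 0 = n) (h1 : s.mem (b + 1) 0 = cur.length * n)
    (h2 : s.mem (b + 2) 0 = (j : ℕ)) (h4 : s.mem (b + 4) 0 = a * n) (ha : a < cur.length)
    (hrows : IsRows (s.mem b) cur) (hS : IsRow (s.mem b) (a * n) S) :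
    Runs f r ω (growRow b test) s (fun s' k => k ≤ Bt + 40 * n + 70 ∧
      s'.mem (b + 1) 0 = (growStep ok j cur S).length * n ∧
      s'.mem (b + 4) 0 = ((a + 1 : ℕ) : ℤ) * n ∧
      IsRows (s'.mem b) (growStep ok j cur S)) := by
  have hb0 : b ≠ 0 := hb.ne'
  have t0 := htm 0 (by simp)
  have tb := htm b (by simp)
  have t1 := htm (b + 1) (by simp)
  have t2 := htm (b + 2) (by simp)
  have t4 := htm (b + 4) (by simp)
  have hle : (a : ℤ) * n + n ≤ cur.length * n := by
    have : (a + 1) * n ≤ cur.length * n := Nat.mul_le_mul_right n ha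
    have h : (((a + 1) * n : ℕ) : ℤ) ≤ ((cur.length * n : ℕ) : ℤ) := by exact_mod_cast this
    push_cast at h
    linarith
  rw [growRow, runs_seq]
  refine ((runs_copyRow hb hn h1 h4 hle hS).frame rfl).mono ?_
  rintro s1 k1 ⟨⟨hk1, hr1, hz1⟩, hF1⟩
  have a0 : s1.mem 0 0 = n := by
    rw [hF1.mem 0 (by simp [copyRow, assign, Cmd.mods, hb0.symm]), hn]
  have a1 : s1.mem (b + 1) 0 = cur.length * n := by
    rw [hF1.mem _ (by simp [copyRow, assign, Cmd.mods]), h1]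
  have a2 : s1.mem (b + 2) 0 = (j : ℕ) := by
    rw [hF1.mem _ (by simp [copyRow, assign, Cmd.mods]), h2]
  have a4 : s1.mem (b + 4) 0 = a * n := by
    rw [hF1.mem _ (by simp [copyRow, assign, Cmd.mods]), h4]
  rw [runs_seq, runs_set]
  simp only [Expr.val, var, Expr.cost, a1, a2]
  set s2 : State := ⟨s1.mem.write b (cur.length * n + (j : ℕ)) 1, s1.drawn⟩ with hs2
  have hF2 : Frame (growRow b test).mods s s2 := by
    refine (hF1.mono ?_).write ?_ _ _
    · simp [growRow, Cmd.mods]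
    · simp [growRow, copyRow, assign, Cmd.mods]
  have hcells : ∀ z < (cur.length : ℤ) * n, s2.mem b z = s.mem b z := by
    intro z hz
    have : z ≠ cur.length * n + (j : ℕ) := by omega
    rw [hs2]
    simp only [Mem.write_apply, if_neg this]
    exact hz1 z hz
  have hrow2 : IsRow (s2.mem b) (cur.length * n) (insert j S) := by
    intro i
    rw [hs2]
    simp only [Mem.write_apply]
    by_cases hij : i = j
    · simp [hij]
    · have : (i : ℕ) ≠ j := fun h => hij (Fin.ext h)
      rw [if_neg (by omega), hr1 i]
      simp [hij]
  have b0 : s2.mem 0 0 = n := by rw [hs2]; simp [Mem.write, hb0.symm, a0]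
  have b1 : s2.mem (b + 1) 0 = cur.length * n := by rw [hs2]; simp [Mem.write, a1]
  have b2 : s2.mem (b + 2) 0 = (j : ℕ) := by rw [hs2]; simp [Mem.write, a2]
  have b4 : s2.mem (b + 4) 0 = a * n := by rw [hs2]; simp [Mem.write, a4]
  rw [runs_seq]
  refine ((htest s2 hF2 b1 b2 hrow2).frame htd).mono ?_
  rintro s3 k3 ⟨⟨hk3, hok⟩, hF3⟩
  have c0 : s3.mem 0 0 = n := by rw [hF3.mem 0 t0, b0]
  have c1 : s3.mem (b + 1) 0 = cur.length * n := by rw [hF3.mem _ t1, b1]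
  have c4 : s3.mem (b + 4) 0 = a * n := by rw [hF3.mem _ t4, b4]
  have cb : s3.mem b = s2.mem b := hF3.mem b tb
  have hrows3 : IsRows (s3.mem b) cur := hrows.congr fun z hz => by rw [cb, hcells z hz]
  have hrow3 : IsRow (s3.mem b) (cur.length * n) (insert j S) := by rw [cb]; exact hrow2
  rw [runs_seq, runs_ite]
  simp only [Expr.val, Expr.cost, assign, dim, runs_set, runs_skip, c0, c1, c4]
  unfold growStep
  split_ifs with hfl hg hg
  · refine ⟨by omega, ?_, ?_, ?_⟩
    · simp [Mem.write]; ring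
    · simp [Mem.write, c0, c4, hb0]; ring
    · have : ∀ z, ((s3.mem.write (b + 1) 0 (cur.length * n + n)).write (b + 4) 0
          ((s3.mem.write (b + 1) 0 (cur.length * n + n)) (b + 4) 0 +
            (s3.mem.write (b + 1) 0 (cur.length * n + n)) 0 0)) b z = s3.mem b z := by
        intro z; simp [Mem.write]
      exact (hrows3.append hrow3).congr fun z _ => this z
  · exact absurd (hok.1 hfl) hg
  · exact absurd (hok.2 hg) hfl
  · refine ⟨by omega, ?_, ?_, ?_⟩
    · simp [Mem.write, c1]
    · simp [Mem.write]; ring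
    · exact hrows3.congr fun z _ => by simp [Mem.write]

/-- The end of the sources is frozen at the start of the round, so sets created in this round are
not extended again. This matches the fold over the old list in `family`. -/
lemma runs_growRound {b : ℕ} {test : Cmd} {Bt Lmax : ℕ} (hb : 0 < b) (htd : test.draws = false)
    (htm : ∀ a ∈ [0, b, b + 1, b + 2, b + 3, b + 4], a ∉ test.mods)
    {ok : Fin n → ℕ → Finset (Fin n) → Prop} {s : State} {k : ℕ} (hk : k < n)
    (htest : ∀ s' (j : Fin n) (len : ℕ) (S : Finset (Fin n)), Frame (growRound b test).mods s s' →
      s'.mem (b + 1) 0 = len * n →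
      s'.mem (b + 2) 0 = (j : ℕ) → IsRow (s'.mem b) (len * n) S →
      Runs f r ω test s' (fun s'' k => k ≤ Bt ∧ (0 < s''.mem (b + 6) 0 ↔ ok j len S)))
    (hL : (family ok k).length ≤ Lmax)
    (hn : s.mem 0 0 = n) (h1 : s.mem (b + 1) 0 = (family ok k).length * n)
    (h2 : s.mem (b + 2) 0 = k) (hrows : IsRows (s.mem b) (family ok k)) :
    Runs f r ω (growRound b test) s (fun s' l => l ≤ Lmax * (Bt + 40 * n + 80) + 30 ∧
      s'.mem (b + 1) 0 = (family ok (k + 1)).length * n ∧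
      s'.mem (b + 2) 0 = ((k + 1 : ℕ) : ℤ) ∧ IsRows (s'.mem b) (family ok (k + 1))) := by
  have hb0 : b ≠ 0 := hb.ne'
  have t0 := htm 0 (by simp)
  have t2 := htm (b + 2) (by simp)
  have t3 := htm (b + 3) (by simp)
  set j : Fin n := ⟨k, hk⟩ with hj
  set L := family ok k with hLdef
  have hfam : family ok (k + 1) = L.foldl (growStep ok j) L := by simp [family, hk, hLdef, hj]
  simp only [growRound, assign, runs_seq, runs_set, Expr.val, Expr.cost, var, h1]
  set s1 : State := ⟨(s.mem.write (b + 3) 0 (L.length * n)).write (b + 4) 0 0, s.drawn⟩ with hs1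
  have hF1 : Frame (growRound b test).mods s s1 :=
    ((Frame.refl _ s).write (by simp [growRound, assign, Cmd.mods]) _ _).write
      (by simp [growRound, assign, Cmd.mods]) _ _
  have hsub : (growRow b test).mods ⊆ (growRound b test).mods := by
    intro a ha
    simp only [growRound, Cmd.mods, List.mem_append]
    exact Or.inr (Or.inr (Or.inl ha))
  have m0 : (0 : ℕ) ∉ (growRow b test).mods := by
    simp [growRow, copyRow, assign, Cmd.mods, t0, hb0.symm]
  have m2 : b + 2 ∉ (growRow b test).mods := by
    simp [growRow, copyRow, assign, Cmd.mods, t2]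
  have m3 : b + 3 ∉ (growRow b test).mods := by
    simp [growRow, copyRow, assign, Cmd.mods, t3]
  have hd : (growRow b test).draws = false := by
    simp [growRow, copyRow, assign, Cmd.draws, htd]
  refine (runs_loop_frame (fun a s' => s'.mem (b + 4) 0 = (a : ℤ) * n ∧
    s'.mem (b + 1) 0 = ((L.take a).foldl (growStep ok j) L).length * n ∧
    IsRows (s'.mem b) ((L.take a).foldl (growStep ok j) L)) L.length (Bt + 40 * n + 70) hd
    ?_ ?_ ?_).mono ?_
  · refine ⟨by simp [hs1, Mem.write], by simp [hs1, Mem.write, h1], ?_⟩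
    exact hrows.congr fun z _ => by simp [hs1, Mem.write]
  · rintro a ha s' hF ⟨h4', h1', hr'⟩
    have e0 : s'.mem 0 0 = n := by rw [hF.mem 0 m0]; simp [hs1, Mem.write, hn]
    have e2 : s'.mem (b + 2) 0 = (j : ℕ) := by rw [hF.mem _ m2]; simp [hs1, Mem.write, h2, hj]
    have e3 : s'.mem (b + 3) 0 = L.length * n := by rw [hF.mem _ m3]; simp [hs1, Mem.write]
    -- The current list extends the old one, so the sources are still at their original places.
    have hpre : L <+: (L.take a).foldl (growStep ok j) L := prefix_foldl_growStep _ _ _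
    have hS : IsRow (s'.mem b) (a * n) L[a] := by
      have := hr' a (ha.trans_le hpre.length_le)
      rwa [← hpre.getElem ha] at this
    have hstep : (L.take (a + 1)).foldl (growStep ok j) L =
        growStep ok j ((L.take a).foldl (growStep ok j) L) L[a] := by
      rw [List.take_succ_eq_append_getElem ha, List.foldl_append]; rfl
    refine ⟨?_, ?_⟩
    · simp only [Expr.val, e3, h4']
      have := row_lt ha (Nat.lt_of_le_of_lt (Nat.zero_le k) hk)
      simp only [Nat.cast_zero, add_zero] at this
      linarith
    · rw [hstep]
      refine (runs_growRow (Bt := Bt) (ok := ok) hb htd htm (fun s'' hF'' q1 q2 q3 => ?_) e0 h1' e2 h4'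
        (ha.trans_le hpre.length_le) hr' hS).mono ?_
      · exact htest s'' j _ _ ((hF1.trans (hF.mono hsub)).trans (hF''.mono hsub)) q1 q2 q3
      · rintro s'' l ⟨hl, p1, p2, p3⟩
        exact ⟨hl, p2, p1, p3⟩
  · rintro s' hF ⟨h4', -⟩
    have e3 : s'.mem (b + 3) 0 = L.length * n := by rw [hF.mem _ m3]; simp [hs1, Mem.write]
    simp [Expr.val, e3, h4']
  · rintro s' l ⟨hl, ⟨h4', h1', hr'⟩, hF⟩
    have e2 : s'.mem (b + 2) 0 = (k : ℤ) := by rw [hF.mem _ m2]; simp [hs1, Mem.write, h2]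
    rw [List.take_length, ← hfam] at h1' hr'
    simp only [Expr.cost] at hl
    refine ⟨?_, ?_, ?_, ?_⟩
    · have h5 : L.length * (Bt + 40 * n + 80) ≤ Lmax * (Bt + 40 * n + 80) :=
        Nat.mul_le_mul_right _ hL
      have h6 : L.length * (2 + 1 + (2) + 1 + (Bt + 40 * n + 70)) ≤
        L.length * (Bt + 40 * n + 80) := Nat.mul_le_mul_left _ (by omega)
      simp only [Nat.reduceAdd] at hl h6 ⊢
      omega
    · simp [Mem.write, h1']
    · simp [Mem.write, e2]
    · exact hr'.congr fun z _ => by simp [Mem.write]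

/-- The program builds the family given by its test. -/
theorem runs_growCmd {b : ℕ} {test : Cmd} {Bt Lmax : ℕ} (hb : 0 < b)
    (htd : test.draws = false)
    (htm : ∀ a ∈ [0, b, b + 1, b + 2, b + 3, b + 4], a ∉ test.mods)
    {ok : Fin n → ℕ → Finset (Fin n) → Prop} {s : State}
    (htest : ∀ s' (j : Fin n) (len : ℕ) (S : Finset (Fin n)), Frame (growCmd b test).mods s s' →
      s'.mem (b + 1) 0 = len * n →
      s'.mem (b + 2) 0 = (j : ℕ) → IsRow (s'.mem b) (len * n) S →
      Runs f r ω test s' (fun s'' k => k ≤ Bt ∧ (0 < s''.mem (b + 6) 0 ↔ ok j len S)))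
    (hL : ∀ k, (family ok k).length ≤ Lmax) (hn : s.mem 0 0 = n) :
    Runs f r ω (growCmd b test) s (fun s' l =>
      l ≤ n * (Lmax * (Bt + 40 * n + 80) + 40) + (40 * n + 50) ∧
      s'.mem (b + 1) 0 = (family ok n).length * n ∧ IsRows (s'.mem b) (family ok n)) := by
  have hb0 : b ≠ 0 := hb.ne'
  have t0 := htm 0 (by simp)
  rw [growCmd, runs_seq]
  refine ((runs_clearRow hb hn).frame rfl).mono ?_
  rintro s1 k1 ⟨⟨hk1, hr1⟩, hF1⟩
  have a0 : s1.mem 0 0 = n := by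
    rw [hF1.mem 0 (by simp [clearRow, assign, Cmd.mods, hb0.symm]), hn]
  simp only [assign, runs_seq, runs_set, Expr.val, Expr.cost, dim, a0]
  set s2 : State := ⟨(s1.mem.write (b + 1) 0 n).write (b + 2) 0 0, s1.drawn⟩ with hs2
  have hF2 : Frame (growCmd b test).mods s s2 :=
    ((hF1.mono (by simp [growCmd, Cmd.mods])).write (by simp [growCmd, assign, Cmd.mods]) _ _).write
      (by simp [growCmd, assign, Cmd.mods]) _ _
  have hsub : (growRound b test).mods ⊆ (growCmd b test).mods := by
    intro a ha
    simp only [growCmd, Cmd.mods, List.mem_append]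
    exact Or.inr (Or.inr (Or.inr ha))
  have m0 : (0 : ℕ) ∉ (growRound b test).mods := by
    simp [growRound, growRow, copyRow, assign, Cmd.mods, t0, hb0.symm]
  have hd : (growRound b test).draws = false := by
    simp [growRound, growRow, copyRow, assign, Cmd.draws, htd]
  refine (runs_loop_frame (fun k s' => s'.mem (b + 2) 0 = (k : ℤ) ∧
    s'.mem (b + 1) 0 = (family ok k).length * n ∧ IsRows (s'.mem b) (family ok k)) n
    (Lmax * (Bt + 40 * n + 80) + 30) hd ?_ ?_ ?_).mono ?_
  · refine ⟨by simp [hs2, Mem.write], by simp [hs2, Mem.write, family], ?_⟩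
    intro a ha
    simp only [family, List.length_singleton, Nat.lt_one_iff] at ha
    subst ha
    simp only [family, List.getElem_cons_zero, Nat.cast_zero, zero_mul]
    exact hr1.congr fun i => by simp [hs2, Mem.write]
  · rintro k hk s' hF ⟨h2', h1', hr'⟩
    have e0 : s'.mem 0 0 = n := by rw [hF.mem 0 m0]; simp [hs2, Mem.write, a0]
    refine ⟨by simp only [Expr.val, var, e0, h2']; omega, ?_⟩
    refine (runs_growRound (Bt := Bt) hb htd htm hk (fun s'' j len S hF'' q1 q2 q3 => ?_) (hL k) e0 h1' h2'
      hr').mono ?_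
    · exact htest s'' j len S ((hF2.trans (hF.mono hsub)).trans (hF''.mono hsub)) q1 q2 q3
    · rintro s'' l ⟨hl, p1, p2, p3⟩
      exact ⟨hl, p2, p1, p3⟩
  · rintro s' hF ⟨h2', -⟩
    have e0 : s'.mem 0 0 = n := by rw [hF.mem 0 m0]; simp [hs2, Mem.write, a0]
    simp [Expr.val, var, e0, h2']
  · rintro s' l ⟨hl, ⟨h2', h1', hr'⟩, hF⟩
    refine ⟨?_, h1', hr'⟩
    simp only [Expr.cost, var] at hl
    have : n * (2 + 2 + 1 + 1 + (Lmax * (Bt + 40 * n + 80) + 30)) ≤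
      n * (Lmax * (Bt + 40 * n + 80) + 40) := Nat.mul_le_mul_left _ (by omega)
    simp only [Nat.reduceAdd] at hl this ⊢
    omega

end Grow

/-! ### Evaluating alternating sums over the sample

Arrays: `3` sample, `4` table of alternating sums, `5` query point, `10` collected sets, `20` subsets.
Scalars: `6` end of the sample, `7` degree bound, `8` weight of a sensitive sample point,
`9` bound on the storage, `30` sample size, `31` pointer to the current set, `32` pointer into the
table, `33` size of the current set, `34` index, `35` pointer into the sample, `36` weighted count,
`37` alternating sum, `38` pointer into the subsets, `39` sign, `40` answer. -/

/-- Write the current sample point, flipped on the current subset, to array `5`, and the sign of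
the subset to scalar `39`. -/
def pointCmd : Cmd :=
  .seq (assign 34 (.const 0))
    (.seq (assign 39 (.const 1))
      (.loop (.sub dim (var 34))
        (.seq (.ite (.get 20 (.add (var 38) (var 34)))
            (.set 5 (var 34) (.sub (.const 0) (.get 3 (.add (var 35) (var 34)))))
            (.seq (.set 5 (var 34) (.get 3 (.add (var 35) (var 34))))
              (.ite (.get 10 (.add (var 31) (var 34))) (assign 39 (.sub (.const 0) (var 39)))
                .skip)))
          (assign 34 (.add (var 34) (.const 1))))))

/-- Compute the alternating sum over the current set at the current sample point. -/
def altSumCmd : Cmd :=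
  .seq (assign 37 (.const 0))
    (.seq (assign 38 (.const 0))
      (.loop (.sub (var 21) (var 38))
        (.seq pointCmd
          (.seq (.mq 5 (.const 0) 40 (.const 0))
            (.seq (.ite (var 39) (assign 37 (.add (var 37) (var 40)))
                (assign 37 (.sub (var 37) (var 40))))
              (assign 38 (.add (var 38) dim)))))))

/-- Compute the alternating sums over the current set at all sample points. -/
def tableCmd : Cmd :=
  .seq (assign 35 (.const 0))
    (.seq (assign 36 (.const 0))
      (.loop (.sub (var 6) (var 35))
        (.seq altSumCmd
          (.seq (.set 4 (var 32) (var 37))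
            (.seq (assign 32 (.add (var 32) (.const 1)))
              (.seq (.ite (var 37) (assign 36 (.add (var 36) (var 8)))
                  (.ite (.sub (.const 0) (var 37)) (assign 36 (.add (var 36) (var 8))) .skip))
                (assign 35 (.add (.add (var 35) dim) (.const 1)))))))))

/-- The test whose family consists of the subsets of the current set. -/
def subsetTest : Cmd := assign 26 (.get 10 (.add (var 31) (var 22)))

/-- Enumerate the subsets of the current set and compute its alternating sums. -/
def tallyCmd : Cmd := .seq (growCmd 20 subsetTest) tableCmd

/-- Compute the size of the current set. -/
def sizeCmd : Cmd :=
  .seq (assign 33 (.const 0))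
    (.seq (assign 34 (.const 0))
      (.loop (.sub dim (var 34))
        (.seq (assign 33 (.add (var 33) (.get 10 (.add (var 31) (var 34)))))
          (assign 34 (.add (var 34) (.const 1))))))

/-- The test by which the learner accepts a set. -/
def acceptTest : Cmd :=
  .seq (assign 31 (var 11))
    (.seq sizeCmd
      (.ite (.sub (.add (var 7) (.const 1)) (var 33))
        (.ite (.sub (var 9) (var 11))
          (.seq (assign 32 (.const 0))
            (.seq tallyCmd (assign 16 (.sub (var 36) (var 30)))))
          (assign 16 (.const 0)))
        (assign 16 (.const 0))))

/-- Tabulate the alternating sums over all collected sets. -/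
def finishCmd : Cmd :=
  .seq (assign 31 (.const 0))
    (.seq (assign 32 (.const 0))
      (.loop (.sub (var 11) (var 31))
        (.seq tallyCmd (assign 31 (.add (var 31) dim)))))

section Tally

variable {n m : ℕ} {f : Cube n → ℤˣ} {r : ℕ} {ω : Fin m → Cube n}

/-- The sample is stored one point (with its label) after the other. -/
def IsSample (A : ℤ → ℤ) (ω : Fin m → Cube n) : Prop :=
  ∀ (u : Fin m) (i : Fin n), A ((u : ℕ) * ((n : ℤ) + 1) + (i : ℕ)) = (ω u i : ℤ)

/-- The parameters have been computed and the sample has been drawn. -/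
structure Ready (ω : Fin m → Cube n) (d w cap : ℕ) (s : State) : Prop where
  dim : s.mem 0 0 = n
  sample : IsSample (s.mem 3) ω
  sampleEnd : s.mem 6 0 = m * ((n : ℤ) + 1)
  deg : s.mem 7 0 = d
  weight : s.mem 8 0 = w
  cap : s.mem 9 0 = cap
  size : s.mem 30 0 = m
  drawn : s.drawn = m

lemma Ready.of_frame {d w cap : ℕ} {s s' : State} {W : List ℕ} (h : Ready ω d w cap s)
    (hF : Frame W s s') (hW : ∀ a ∈ [0, 3, 6, 7, 8, 9, 30], a ∉ W) : Ready ω d w cap s' where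
  dim := by rw [hF.mem 0 (hW 0 (by simp)), h.dim]
  sample := by rw [hF.mem 3 (hW 3 (by simp))]; exact h.sample
  sampleEnd := by rw [hF.mem 6 (hW 6 (by simp)), h.sampleEnd]
  deg := by rw [hF.mem 7 (hW 7 (by simp)), h.deg]
  weight := by rw [hF.mem 8 (hW 8 (by simp)), h.weight]
  cap := by rw [hF.mem 9 (hW 9 (by simp)), h.cap]
  size := by rw [hF.mem 30 (hW 30 (by simp)), h.size]
  drawn := by rw [hF.drawn, h.drawn]

lemma card_filter_lt_succ {k : ℕ} (A : Finset (Fin k)) {i : ℕ} (hi : i < k) :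
    (A.filter fun j : Fin k => (j : ℕ) < i + 1).card =
      (A.filter fun j : Fin k => (j : ℕ) < i).card + if (⟨i, hi⟩ : Fin k) ∈ A then 1 else 0 := by
  have h : A.filter (fun j : Fin k => (j : ℕ) < i + 1) =
      A.filter (fun j : Fin k => (j : ℕ) < i) ∪ A.filter (fun j : Fin k => j = ⟨i, hi⟩) := by
    ext j
    simp only [mem_filter, mem_union, Fin.ext_iff, ← and_or_left]
    rw [Nat.lt_succ_iff_lt_or_eq]
  have hd : Disjoint (A.filter fun j : Fin k => (j : ℕ) < i) (A.filter fun j : Fin k => j = ⟨i, hi⟩) := by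
    rw [disjoint_left]
    intro j h1 h2
    simp only [mem_filter, Fin.ext_iff] at h1 h2
    omega
  rw [h, card_union_of_disjoint hd, filter_eq']
  split_ifs <;> simp

lemma filter_lt_self {k : ℕ} (A : Finset (Fin k)) : (A.filter fun j : Fin k => (j : ℕ) < k) = A :=
  filter_true_of_mem fun j _ => j.2

/-- The sign variable is negated once for every coordinate that lies in `S` but not in `T`, which
produces `(-1)^{|S \ T|}`. -/
lemma runs_pointCmd {s : State} {S T : Finset (Fin n)} {y : Cube n} {p q z : ℤ}
    (hn : s.mem 0 0 = n) (hp : s.mem 31 0 = p) (hS : IsRow (s.mem 10) p S)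
    (hq : s.mem 38 0 = q) (hT : IsRow (s.mem 20) q T)
    (hz : s.mem 35 0 = z) (hy : ∀ i : Fin n, s.mem 3 (z + (i : ℕ)) = (y i : ℤ)) :
    Runs f r ω pointCmd s (fun s' k => k ≤ 80 * n + 30 ∧
      (∀ v : Fin n, s'.mem 5 ((v : ℕ) : ℤ) = (flipOn T y v : ℤ)) ∧
      s'.mem 39 0 = (-1) ^ (S \ T).card) := by
  simp only [pointCmd, assign, runs_seq, runs_set, Expr.val, Expr.cost]
  set s1 : State := ⟨(s.mem.write 34 0 0).write 39 0 1, s.drawn⟩ with hs1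
  refine (runs_loop_frame (fun i s' => s'.mem 34 0 = i ∧
    (∀ v : Fin n, (v : ℕ) < i → s'.mem 5 ((v : ℕ) : ℤ) = (flipOn T y v : ℤ)) ∧
    s'.mem 39 0 = (-1) ^ ((S \ T).filter fun v : Fin n => (v : ℕ) < i).card) n 60 rfl ?_ ?_ ?_).mono ?_
  · refine ⟨by simp [hs1, Mem.write], fun v hv => by omega, by simp [hs1, Mem.write]⟩
  · rintro i hi s' hF ⟨h1, h2, h3⟩
    have e0 : s'.mem 0 0 = n := by rw [hF.mem 0 (by decide)]; simp [hs1, Mem.write, hn]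
    have e31 : s'.mem 31 0 = p := by rw [hF.mem 31 (by decide)]; simp [hs1, Mem.write, hp]
    have e38 : s'.mem 38 0 = q := by rw [hF.mem 38 (by decide)]; simp [hs1, Mem.write, hq]
    have e35 : s'.mem 35 0 = z := by rw [hF.mem 35 (by decide)]; simp [hs1, Mem.write, hz]
    have e10 : s'.mem 10 (p + i) = if (⟨i, hi⟩ : Fin n) ∈ S then 1 else 0 := by
      rw [hF.mem 10 (by decide)]; simpa [hs1, Mem.write] using hS ⟨i, hi⟩
    have e20 : s'.mem 20 (q + i) = if (⟨i, hi⟩ : Fin n) ∈ T then 1 else 0 := by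
      rw [hF.mem 20 (by decide)]; simpa [hs1, Mem.write] using hT ⟨i, hi⟩
    have e3 : s'.mem 3 (z + i) = (y ⟨i, hi⟩ : ℤ) := by
      rw [hF.mem 3 (by decide)]; simpa [hs1, Mem.write] using hy ⟨i, hi⟩
    refine ⟨by simp only [Expr.val, dim, var, e0, h1]; omega, ?_⟩
    have hcells : ∀ (x : ℤ), x = (flipOn T y ⟨i, hi⟩ : ℤ) → ∀ v : Fin n, (v : ℕ) < i + 1 →
        s'.mem.write 5 i x 5 ((v : ℕ) : ℤ) = (flipOn T y v : ℤ) := by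
      intro x hx v hv
      rw [Mem.write_apply]
      rcases Nat.lt_succ_iff_lt_or_eq.1 hv with hv | hv
      · rw [if_neg (by omega), h2 v hv]
      · have : v = ⟨i, hi⟩ := Fin.ext hv
        subst this
        simpa using hx
    simp only [runs_seq, runs_ite, runs_set, runs_skip, Expr.val, Expr.cost, var, h1, e38, e35,
      e20, e3]
    rw [card_filter_lt_succ _ hi]
    by_cases hiT : (⟨i, hi⟩ : Fin n) ∈ T
    · have := hcells _ (show -((y ⟨i, hi⟩ : ℤˣ) : ℤ) = _ by simp [flipOn, hiT])
      simp only [hiT, if_true, zero_lt_one]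
      refine ⟨by omega, by simp [Mem.write, h1], fun v hv => ?_, ?_⟩
      · rw [← this v hv]; simp [Mem.write]
      · simp [Mem.write, h3, hiT]
    · have := hcells _ (show ((y ⟨i, hi⟩ : ℤˣ) : ℤ) = _ by simp [flipOn, hiT])
      simp only [hiT, if_false, lt_irrefl]
      have e10' : s'.mem.write 5 i (y ⟨i, hi⟩ : ℤ) 10 (p + i) =
          if (⟨i, hi⟩ : Fin n) ∈ S then 1 else 0 := by
        rw [Mem.write_of_ne (by decide), e10]
      simp only [Mem.write_of_ne (show 31 ≠ 5 by decide), Mem.write_of_ne (show 34 ≠ 5 by decide),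
        e31, h1, e10']
      by_cases hiS : (⟨i, hi⟩ : Fin n) ∈ S
      · simp only [hiS, if_true, zero_lt_one]
        refine ⟨by omega, by simp [Mem.write, h1], fun v hv => ?_, ?_⟩
        · rw [← this v hv]; simp [Mem.write]
        · simp [Mem.write, h3, hiT, hiS, pow_succ]
      · simp only [hiS, if_false, lt_irrefl]
        refine ⟨by omega, by simp [Mem.write], fun v hv => ?_, ?_⟩
        · rw [← this v hv]; simp [Mem.write]
        · simp [Mem.write, h3, hiS]
  · rintro s' hF ⟨h1, -⟩
    have e0 : s'.mem 0 0 = n := by rw [hF.mem 0 (by decide)]; simp [hs1, Mem.write, hn]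
    simp [Expr.val, dim, var, e0, h1]
  · rintro s' k ⟨hk, ⟨h1, h2, h3⟩, hF⟩
    simp only [Expr.cost, dim, var] at hk
    rw [filter_lt_self] at h3
    exact ⟨by omega, fun v => h2 v v.2, h3⟩

lemma mem_subsetList {S T : Finset (Fin n)} : T ∈ subsetList S ↔ T ⊆ S := by
  rw [← List.mem_toFinset, toFinset_subsetList, mem_powerset]

lemma runs_altSumCmd {s : State} {S : Finset (Fin n)} {u : Fin m} {p z : ℤ} (hn0 : 0 < n)
    (hn : s.mem 0 0 = n) (hp : s.mem 31 0 = p) (hS : IsRow (s.mem 10) p S) (hSr : S.card ≤ r)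
    (h21 : s.mem 21 0 = (subsetList S).length * n) (h20 : IsRows (s.mem 20) (subsetList S))
    (hz : s.mem 35 0 = z) (hy : ∀ i : Fin n, s.mem 3 (z + (i : ℕ)) = (ω u i : ℤ))
    (hdr : s.drawn = m) :
    Runs f r ω altSumCmd s (fun s' k => k ≤ 2 ^ S.card * (90 * n + 100) + 30 ∧
      s'.mem 37 0 = altSum f S (ω u)) := by
  have hL := length_subsetList S
  set L := subsetList S with hLdef
  simp only [altSumCmd, assign, runs_seq, runs_set, Expr.val, Expr.cost]
  set s1 : State := ⟨(s.mem.write 37 0 0).write 38 0 0, s.drawn⟩ with hs1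
  let φ : Finset (Fin n) → ℤ := fun T => (-1) ^ (S \ T).card * (f (flipOn T (ω u)) : ℤ)
  refine (runs_loop_frame (fun a s' => s'.mem 38 0 = (a : ℤ) * n ∧
    s'.mem 37 0 = ((L.take a).map φ).sum) L.length (81 * n + 80) rfl ?_ ?_ ?_).mono ?_
  · exact ⟨by simp [hs1, Mem.write], by simp [hs1, Mem.write]⟩
  · rintro a ha s' hF ⟨h1, h2⟩
    have e0 : s'.mem 0 0 = n := by rw [hF.mem 0 (by decide)]; simp [hs1, Mem.write, hn]
    have e31 : s'.mem 31 0 = p := by rw [hF.mem 31 (by decide)]; simp [hs1, Mem.write, hp]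
    have e35 : s'.mem 35 0 = z := by rw [hF.mem 35 (by decide)]; simp [hs1, Mem.write, hz]
    have e21 : s'.mem 21 0 = L.length * n := by
      rw [hF.mem 21 (by decide)]; simp [hs1, Mem.write, h21]
    have e10 : IsRow (s'.mem 10) p S := by
      rw [hF.mem 10 (by decide)]; exact hS.congr fun i => by simp [hs1, Mem.write]
    have e20 : IsRow (s'.mem 20) (a * n) L[a] := by
      rw [hF.mem 20 (by decide)]; exact (h20 a ha).congr fun i => by simp [hs1, Mem.write]
    have e3 : ∀ i : Fin n, s'.mem 3 (z + (i : ℕ)) = (ω u i : ℤ) := by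
      intro i; rw [hF.mem 3 (by decide)]; simpa [hs1, Mem.write] using hy i
    have ed : s'.drawn = m := by rw [hF.drawn]; exact hdr
    have hTS : L[a] ⊆ S := mem_subsetList.1 (List.getElem_mem ha)
    refine ⟨?_, ?_⟩
    · simp only [Expr.val, var, e21, h1]
      have := row_lt ha hn0
      simp only [Nat.cast_zero, add_zero] at this
      linarith
    rw [runs_seq]
    refine ((runs_pointCmd e0 e31 e10 h1 e20 e35 e3).frame rfl).mono ?_
    rintro s2 k2 ⟨⟨hk2, hpt, hsg⟩, hF2⟩
    have g0 : s2.mem 0 0 = n := by rw [hF2.mem 0 (by decide), e0]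
    have g37 : s2.mem 37 0 = ((L.take a).map φ).sum := by rw [hF2.mem 37 (by decide), h2]
    have g38 : s2.mem 38 0 = (a : ℤ) * n := by rw [hF2.mem 38 (by decide), h1]
    rw [runs_seq]
    -- The query is local because only bits in `L[a] ⊆ S` were flipped in a sample point that has
    -- already been drawn.
    refine runs_mq (flipOn L[a] (ω u)) (fun v => by simpa [Expr.val] using hpt v)
      ⟨u, by rw [hF2.drawn, ed]; exact u.2,
        (hammingDist_flips (flipOn_mem_flips hTS (ω u))).trans hSr⟩ ?_
    have hsum : ((L.take (a + 1)).map φ).sum = ((L.take a).map φ).sum + φ L[a] := by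
      rw [List.take_succ_eq_append_getElem ha, List.map_append, List.sum_append]
      simp
    rw [hsum]
    simp only [runs_seq, runs_ite, runs_set, Expr.val, Expr.cost, var, dim]
    rcases neg_one_pow_eq_or ℤ (S \ L[a]).card with hs | hs
    · have hφ : φ L[a] = (f (flipOn L[a] (ω u)) : ℤ) := by simp [φ, hs]
      rw [hs] at hsg
      rw [if_pos (by simp [Mem.write, hsg])]
      refine ⟨by omega, ?_, ?_⟩
      · simp [Mem.write, g0, g38]; ring
      · simp [Mem.write, g37, hφ]
    · have hφ : φ L[a] = -(f (flipOn L[a] (ω u)) : ℤ) := by simp [φ, hs]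
      rw [hs] at hsg
      rw [if_neg (by simp [Mem.write, hsg])]
      refine ⟨by omega, ?_, ?_⟩
      · simp [Mem.write, g0, g38]; ring
      · simp [Mem.write, g37, hφ, sub_eq_add_neg]
  · rintro s' hF ⟨h1, -⟩
    have e21 : s'.mem 21 0 = L.length * n := by
      rw [hF.mem 21 (by decide)]; simp [hs1, Mem.write, h21]
    simp [Expr.val, var, e21, h1]
  · rintro s' k ⟨hk, ⟨h1, h2⟩, hF⟩
    simp only [Expr.cost, var] at hk
    rw [hL] at hk
    have h5 : 2 ^ S.card * (2 + 2 + 1 + 1 + (81 * n + 80)) ≤ 2 ^ S.card * (90 * n + 100) :=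
      Nat.mul_le_mul_left _ (by omega)
    refine ⟨?_, ?_⟩
    · simp only [Nat.reduceAdd] at hk h5 ⊢
      omega
    · rw [h2, List.take_length, hLdef, sum_subsetList]
      rfl

/-- Each sensitive sample point adds the weight `w` to the counter, so the product of the count with
`w` is obtained without a multiplication. -/
lemma runs_tableCmd {s : State} {S : Finset (Fin n)} {p v : ℤ} {d w cap : ℕ} (hn0 : 0 < n)
    (hR : Ready ω d w cap s) (hp : s.mem 31 0 = p) (hS : IsRow (s.mem 10) p S)
    (hSr : S.card ≤ r) (hv : s.mem 32 0 = v)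
    (h21 : s.mem 21 0 = (subsetList S).length * n) (h20 : IsRows (s.mem 20) (subsetList S)) :
    Runs f r ω tableCmd s (fun s' k => k ≤ m * (2 ^ S.card * (90 * n + 100) + 100) + 30 ∧
      s'.mem 36 0 = ((sensCount f ω S * w : ℕ) : ℤ) ∧ s'.mem 32 0 = v + m ∧
      (∀ u : Fin m, s'.mem 4 (v + (u : ℕ)) = altSum f S (ω u)) ∧
      ∀ z < v, s'.mem 4 z = s.mem 4 z) := by
  simp only [tableCmd, assign, runs_seq, runs_set, Expr.val, Expr.cost]
  set s1 : State := ⟨(s.mem.write 35 0 0).write 36 0 0, s.drawn⟩ with hs1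
  have hF1 : Frame [35, 36] s s1 :=
    ((Frame.refl _ s).write (by decide) _ _).write (by decide) _ _
  have hR1 : Ready ω d w cap s1 := hR.of_frame hF1 (by decide)
  set A : Finset (Fin m) := univ.filter fun u => altSum f S (ω u) ≠ 0 with hA
  refine (runs_loop_frame (fun i s' => s'.mem 35 0 = (i : ℤ) * ((n : ℤ) + 1) ∧
    s'.mem 36 0 = (((A.filter fun u : Fin m => (u : ℕ) < i).card * w : ℕ) : ℤ) ∧
    s'.mem 32 0 = v + i ∧
    (∀ u : Fin m, (u : ℕ) < i → s'.mem 4 (v + (u : ℕ)) = altSum f S (ω u)) ∧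
      ∀ z < v, s'.mem 4 z = s.mem 4 z) m (2 ^ S.card * (90 * n + 100) + 90) rfl
    ?_ ?_ ?_).mono ?_
  · refine ⟨by simp [hs1, Mem.write], by simp [hs1, Mem.write], by simp [hs1, Mem.write, hv],
      fun u hu => by omega, fun z _ => by simp [hs1, Mem.write]⟩
  · rintro i hi s' hF ⟨h1, h2, h3, h4, h5⟩
    have hR' : Ready ω d w cap s' := hR1.of_frame hF (by decide)
    have e31 : s'.mem 31 0 = p := by rw [hF.mem 31 (by decide)]; simp [hs1, Mem.write, hp]
    have e21 : s'.mem 21 0 = (subsetList S).length * n := by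
      rw [hF.mem 21 (by decide)]; simp [hs1, Mem.write, h21]
    have e10 : IsRow (s'.mem 10) p S := by
      rw [hF.mem 10 (by decide)]; exact hS.congr fun i => by simp [hs1, Mem.write]
    have e20 : IsRows (s'.mem 20) (subsetList S) := by
      rw [hF.mem 20 (by decide)]; exact h20.congr fun i _ => by simp [hs1, Mem.write]
    refine ⟨?_, ?_⟩
    · simp only [Expr.val, var, hR'.sampleEnd, h1]
      have := row_lt hi (Nat.succ_pos n)
      push_cast at this
      linarith
    rw [runs_seq]
    refine ((runs_altSumCmd (u := ⟨i, hi⟩) hn0 hR'.dim e31 e10 hSr e21 e20 h1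
      (fun j => hR'.sample ⟨i, hi⟩ j) hR'.drawn).frame rfl).mono ?_
    rintro s2 k2 ⟨⟨hk2, hsum⟩, hF2⟩
    have g0 : s2.mem 0 0 = n := by rw [hF2.mem 0 (by decide), hR'.dim]
    have g8 : s2.mem 8 0 = w := by rw [hF2.mem 8 (by decide), hR'.weight]
    have g35 : s2.mem 35 0 = (i : ℤ) * ((n : ℤ) + 1) := by rw [hF2.mem 35 (by decide), h1]
    have g36 := h2
    rw [← hF2.mem 36 (by decide)] at g36
    have g32 : s2.mem 32 0 = v + i := by rw [hF2.mem 32 (by decide), h3]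
    have g4 : s2.mem 4 = s'.mem 4 := hF2.mem 4 (by decide)
    have hA' : (⟨i, hi⟩ : Fin m) ∈ A ↔ altSum f S (ω ⟨i, hi⟩) ≠ 0 := by simp [hA]
    have c4 : ∀ u : Fin m, (u : ℕ) < i + 1 →
        s2.mem.write 4 (v + i) (altSum f S (ω ⟨i, hi⟩)) 4 (v + (u : ℕ)) = altSum f S (ω u) := by
      intro u hu
      rw [Mem.write_apply]
      rcases Nat.lt_succ_iff_lt_or_eq.1 hu with hu | hu
      · rw [if_neg (by omega), g4, h4 u hu]
      · have : u = ⟨i, hi⟩ := Fin.ext hu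
        subst this
        simp
    have c4' : ∀ z < v, s2.mem.write 4 (v + i) (altSum f S (ω ⟨i, hi⟩)) 4 z = s.mem 4 z := by
      intro z hz
      rw [Mem.write_apply, if_neg (by omega), g4, h5 z hz]
    rw [card_filter_lt_succ _ hi]
    simp only [runs_seq, runs_ite, runs_set, runs_skip, Expr.val, Expr.cost, var, dim, hsum, g32]
    have r37 : ∀ x y : ℤ, ((s2.mem.write 4 (v + i) x).write 32 0 y) 37 0 =
        altSum f S (ω ⟨i, hi⟩) := by
      intro x y; simp [Mem.write, hsum]
    simp only [r37]
    -- Branching can only test positivity, so a nonzero sum is detected by testing it and then its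
    -- negative.
    rcases lt_trichotomy (altSum f S (ω ⟨i, hi⟩)) 0 with hlt | heq | hgt
    · rw [if_neg (by omega), if_pos (by omega)]
      rw [if_pos (hA'.2 hlt.ne)]
      refine ⟨by omega, ?_, ?_, ?_, fun u hu => ?_, fun z hz => ?_⟩
      · simp [Mem.write, g0, g35]; ring
      · simp [Mem.write, g8, g36]; ring
      · simp [Mem.write, g32]; ring
      · rw [← c4 u hu]; simp [Mem.write]
      · rw [← c4' z hz]; simp [Mem.write]
    · rw [if_neg (by omega), if_neg (by omega)]
      rw [if_neg (fun h => hA'.1 h heq)]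
      refine ⟨by omega, ?_, ?_, ?_, fun u hu => ?_, fun z hz => ?_⟩
      · simp [Mem.write, g0, g35]; ring
      · simp [Mem.write, g36]
      · simp [Mem.write, g32]; ring
      · rw [← c4 u hu]; simp [Mem.write]
      · rw [← c4' z hz]; simp [Mem.write]
    · rw [if_pos (by omega)]
      rw [if_pos (hA'.2 hgt.ne')]
      refine ⟨by omega, ?_, ?_, ?_, fun u hu => ?_, fun z hz => ?_⟩
      · simp [Mem.write, g0, g35]; ring
      · simp [Mem.write, g8, g36]; ring
      · simp [Mem.write, g32]; ring
      · rw [← c4 u hu]; simp [Mem.write]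
      · rw [← c4' z hz]; simp [Mem.write]
  · rintro s' hF ⟨h1, -⟩
    have hR' : Ready ω d w cap s' := hR1.of_frame hF (by decide)
    simp [Expr.val, var, hR'.sampleEnd, h1]
  · rintro s' k ⟨hk, ⟨h1, h2, h3, h4, h5⟩, hF⟩
    simp only [Expr.cost, var] at hk
    rw [filter_lt_self] at h2
    refine ⟨?_, h2, h3, fun u => h4 u u.2, h5⟩
    have h6 : m * (2 + 2 + 1 + 1 + (2 ^ S.card * (90 * n + 100) + 90)) ≤
      m * (2 ^ S.card * (90 * n + 100) + 100) := Nat.mul_le_mul_left _ (by omega)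
    simp only [Nat.reduceAdd] at hk h6 ⊢
    omega

/-- A bound on the time of `tallyCmd` on sets of at most `d` elements. -/
def tallyCost (n m d : ℕ) : ℕ :=
  n * (2 ^ d * (40 * n + 100) + 40) + (40 * n + 50) + (m * (2 ^ d * (90 * n + 100) + 100) + 30)

lemma runs_tallyCmd {s : State} {S : Finset (Fin n)} {p v : ℤ} {d w cap : ℕ} (hn0 : 0 < n)
    (hR : Ready ω d w cap s) (hp : s.mem 31 0 = p) (hS : IsRow (s.mem 10) p S)
    (hSr : S.card ≤ r) (hSd : S.card ≤ d) (hv : s.mem 32 0 = v) :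
    Runs f r ω tallyCmd s (fun s' k => k ≤ tallyCost n m d ∧
      s'.mem 36 0 = ((sensCount f ω S * w : ℕ) : ℤ) ∧ s'.mem 32 0 = v + m ∧
      (∀ u : Fin m, s'.mem 4 (v + (u : ℕ)) = altSum f S (ω u)) ∧
      ∀ z < v, s'.mem 4 z = s.mem 4 z) := by
  have h2d : 2 ^ S.card ≤ 2 ^ d := Nat.pow_le_pow_right (by norm_num) hSd
  rw [tallyCmd, runs_seq]
  -- With membership in `S` as the test, the family consists of the subsets of `S`, and its length
  -- never exceeds `2 ^ d`.
  have hgrow := runs_growCmd (f := f) (r := r) (ω := ω) (b := 20) (test := subsetTest) (Bt := 10)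
    (Lmax := 2 ^ d) (ok := fun j _ _ => j ∈ S) (s := s) (by norm_num) rfl (by decide)
    (fun s' j len T hF h1 h2 _ => by
      have e31 : s'.mem 31 0 = p := by rw [hF.mem 31 (by decide), hp]
      have e10 : s'.mem 10 (p + (j : ℕ)) = if j ∈ S then 1 else 0 := by
        rw [hF.mem 10 (by decide)]; exact hS j
      simp only [subsetTest, assign, runs_set, Expr.val, Expr.cost, var]
      refine ⟨by omega, ?_⟩
      have h2' : s'.mem 22 0 = (j : ℕ) := h2
      simp only [Nat.reduceAdd, Mem.write_apply, if_true, e31, h2', e10]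
      split_ifs with h <;> simp [h])
    (fun k => ((length_family_le_length_subsetList S k).trans_eq (length_subsetList S)).trans h2d)
    hR.dim
  refine (hgrow.frame rfl).mono ?_
  rintro s1 k1 ⟨⟨hk1, h21, h20⟩, hF1⟩
  have hR1 : Ready ω d w cap s1 := hR.of_frame hF1 (by decide)
  have e31 : s1.mem 31 0 = p := by rw [hF1.mem 31 (by decide), hp]
  have e10 : IsRow (s1.mem 10) p S := by rw [hF1.mem 10 (by decide)]; exact hS
  have e32 : s1.mem 32 0 = v := by rw [hF1.mem 32 (by decide), hv]
  have e4 : s1.mem 4 = s.mem 4 := hF1.mem 4 (by decide)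
  refine (runs_tableCmd hn0 hR1 e31 e10 hSr e32 h21 h20).mono ?_
  rintro s2 k2 ⟨hk2, q1, q2, q3, q4⟩
  refine ⟨?_, q1, q2, q3, fun z hz => by rw [q4 z hz, e4]⟩
  have h5 : m * (2 ^ S.card * (90 * n + 100) + 100) ≤ m * (2 ^ d * (90 * n + 100) + 100) := by
    gcongr
  have h6 : n * (2 ^ d * (10 + 40 * n + 80) + 40) ≤ n * (2 ^ d * (40 * n + 100) + 40) :=
    Nat.mul_le_mul_left _ (Nat.add_le_add_right (Nat.mul_le_mul_left _ (by omega)) _)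
  unfold tallyCost
  omega

end Tally

/-! ### Collecting the sets -/

section Collect

variable {n m : ℕ} {f : Cube n → ℤˣ} {r : ℕ} {ω : Fin m → Cube n}

lemma runs_sizeCmd {s : State} {S : Finset (Fin n)} {p : ℤ} (hn : s.mem 0 0 = n)
    (hp : s.mem 31 0 = p) (hS : IsRow (s.mem 10) p S) :
    Runs f r ω sizeCmd s (fun s' k => k ≤ 40 * n + 30 ∧ s'.mem 33 0 = S.card) := by
  simp only [sizeCmd, assign, runs_seq, runs_set, Expr.val, Expr.cost]
  set s1 : State := ⟨(s.mem.write 33 0 0).write 34 0 0, s.drawn⟩ with hs1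
  refine (runs_loop_frame (fun i s' => s'.mem 34 0 = i ∧
    s'.mem 33 0 = (S.filter fun v : Fin n => (v : ℕ) < i).card) n 30 rfl ?_ ?_ ?_).mono ?_
  · exact ⟨by simp [hs1, Mem.write], by simp [hs1, Mem.write]⟩
  · rintro i hi s' hF ⟨h1, h2⟩
    have e0 : s'.mem 0 0 = n := by rw [hF.mem 0 (by decide)]; simp [hs1, Mem.write, hn]
    have e31 : s'.mem 31 0 = p := by rw [hF.mem 31 (by decide)]; simp [hs1, Mem.write, hp]
    have e10 : s'.mem 10 (p + i) = if (⟨i, hi⟩ : Fin n) ∈ S then 1 else 0 := by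
      rw [hF.mem 10 (by decide)]; simpa [hs1, Mem.write] using hS ⟨i, hi⟩
    refine ⟨by simp only [Expr.val, dim, var, e0, h1]; omega, ?_⟩
    simp only [runs_seq, runs_set, Expr.val, Expr.cost, var, h1, h2, e31, e10]
    refine ⟨by omega, by simp [Mem.write, h1], ?_⟩
    rw [card_filter_lt_succ _ hi]
    split_ifs with h <;> simp [Mem.write]
  · rintro s' hF ⟨h1, -⟩
    have e0 : s'.mem 0 0 = n := by rw [hF.mem 0 (by decide)]; simp [hs1, Mem.write, hn]
    simp [Expr.val, dim, var, e0, h1]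
  · rintro s' k ⟨hk, ⟨h1, h2⟩, hF⟩
    simp only [Expr.cost, dim, var] at hk
    rw [filter_lt_self] at h2
    exact ⟨by omega, h2⟩

/-- The end pointer is `len * n`, so the storage criterion compares it directly with `cap`. The size
and storage tests come first, hence the costly tally and its queries only occur for sets of at most
`d` elements. The table written here is scratch. -/
lemma runs_acceptTest {s : State} {S : Finset (Fin n)} {d w cap len : ℕ} {j : Fin n}
    (hn0 : 0 < n) (hR : Ready ω d w cap s) (h11 : s.mem 11 0 = len * n)
    (hS : IsRow (s.mem 10) (len * n) S) :
    Runs f d ω acceptTest s (fun s' k => k ≤ tallyCost n m d + 40 * n + 80 ∧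
      (0 < s'.mem 16 0 ↔ accepts f ω d w cap j len S)) := by
  simp only [acceptTest, assign, runs_seq, runs_set, Expr.val, Expr.cost, var, h11]
  set s1 : State := ⟨s.mem.write 31 0 (len * n), s.drawn⟩ with hs1
  have hF1 : Frame [31] s s1 := (Frame.refl _ s).write (by decide) _ _
  have hR1 : Ready ω d w cap s1 := hR.of_frame hF1 (by decide)
  have hS1 : IsRow (s1.mem 10) (len * n) S := by rw [hF1.mem 10 (by decide)]; exact hS
  have e31 : s1.mem 31 0 = len * n := by simp [hs1, Mem.write]
  refine ((runs_sizeCmd hR1.dim e31 hS1).frame rfl).mono ?_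
  rintro s2 k2 ⟨⟨hk2, hsz⟩, hF2⟩
  have hR2 : Ready ω d w cap s2 := hR1.of_frame hF2 (by decide)
  have hS2 : IsRow (s2.mem 10) (len * n) S := by rw [hF2.mem 10 (by decide)]; exact hS1
  have g31 : s2.mem 31 0 = len * n := by rw [hF2.mem 31 (by decide)]; exact e31
  have g11 : s2.mem 11 0 = len * n := by
    rw [hF2.mem 11 (by decide), hF1.mem 11 (by decide), h11]
  simp only [runs_ite, runs_seq, runs_set, Expr.val, Expr.cost, hR2.deg, hsz, hR2.cap, g11]
  by_cases hd : S.card ≤ d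
  · rw [if_pos (by omega)]
    by_cases hcap : len * n < cap
    · have hcap' : (0 : ℤ) < cap - len * n := by
        have : ((len * n : ℕ) : ℤ) < cap := by exact_mod_cast hcap
        push_cast at this
        linarith
      rw [if_pos hcap']
      set s3 : State := ⟨s2.mem.write 32 0 0, s2.drawn⟩ with hs3
      have hF3 : Frame [32] s2 s3 := (Frame.refl _ s2).write (by decide) _ _
      have hR3 : Ready ω d w cap s3 := hR2.of_frame hF3 (by decide)
      have hS3 : IsRow (s3.mem 10) (len * n) S := by rw [hF3.mem 10 (by decide)]; exact hS2
      have i31 : s3.mem 31 0 = len * n := by rw [hF3.mem 31 (by decide)]; exact g31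
      refine ((runs_tallyCmd hn0 hR3 i31 hS3 hd hd (v := 0) (by simp [hs3, Mem.write])).frame
        rfl).mono ?_
      rintro s4 k4 ⟨⟨hk4, hcnt, -, -, -⟩, hF4⟩
      have hR4 : Ready ω d w cap s4 := hR3.of_frame hF4 (by decide)
      refine ⟨by omega, ?_⟩
      rw [Mem.write_apply, if_pos rfl, hcnt, hR4.size, accepts]
      have : (0 : ℤ) < ((sensCount f ω S * w : ℕ) : ℤ) - m ↔ m < sensCount f ω S * w := by
        omega
      rw [this]
      exact ⟨fun h => ⟨hd, hcap, h⟩, fun h => h.2.2⟩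
    · have hcap' : ¬ (0 : ℤ) < cap - len * n := by
        have : (cap : ℤ) ≤ ((len * n : ℕ) : ℤ) := by exact_mod_cast Nat.not_lt.1 hcap
        push_cast at this
        linarith
      rw [if_neg hcap']
      refine ⟨by omega, ?_⟩
      simp [Mem.write, accepts, hcap]
  · rw [if_neg (by omega)]
    refine ⟨by omega, ?_⟩
    simp [Mem.write, accepts, hd]

/-- A bound on the time of the collection phase. -/
def collectCost (n m d cap : ℕ) : ℕ :=
  n * (cap * (tallyCost n m d + 80 * n + 160) + 40) + (40 * n + 50)

lemma runs_collect {s : State} {d w cap : ℕ} (hn0 : 0 < n) (hcap : 1 ≤ cap)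
    (hR : Ready ω d w cap s) :
    Runs f d ω (growCmd 10 acceptTest) s (fun s' k => k ≤ collectCost n m d cap ∧
      s'.mem 11 0 = (accepted f ω d w cap).length * n ∧
      IsRows (s'.mem 10) (accepted f ω d w cap)) := by
  refine (runs_growCmd (Bt := tallyCost n m d + 40 * n + 80) (Lmax := cap)
    (ok := accepts f ω d w cap) (by norm_num) rfl (by decide) ?_
    (fun k => length_accepted_le hn0 hcap k) hR.dim).mono ?_
  · intro s' j len S hF h1 _ hS
    exact runs_acceptTest hn0 (hR.of_frame hF (by decide)) h1 hS
  · rintro s' k ⟨hk, h1, h2⟩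
    refine ⟨hk.trans (le_of_eq ?_), h1, h2⟩
    unfold collectCost
    ring

/-- The memory holds the sample, the collected sets and the table of alternating sums. -/
structure Learned (f : Cube n → ℤˣ) (ω : Fin m → Cube n) (L : List (Finset (Fin n))) (M : Mem) :
    Prop where
  dim : M 0 0 = n
  sample : IsSample (M 3) ω
  sampleEnd : M 6 0 = m * ((n : ℤ) + 1)
  rows : IsRows (M 10) L
  rowsEnd : M 11 0 = L.length * n
  table : ∀ a (h : a < L.length) (u : Fin m), M 4 ((a : ℤ) * m + (u : ℕ)) = altSum f L[a] (ω u)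

lemma runs_finishCmd {s : State} {d w cap : ℕ} {L : List (Finset (Fin n))} (hn0 : 0 < n)
    (hR : Ready ω d w cap s) (hL : ∀ S ∈ L, S.card ≤ d) (h11 : s.mem 11 0 = L.length * n)
    (h10 : IsRows (s.mem 10) L) :
    Runs f d ω finishCmd s (fun s' k => k ≤ L.length * (tallyCost n m d + 20) + 20 ∧
      Learned f ω L s'.mem) := by
  simp only [finishCmd, assign, runs_seq, runs_set, Expr.val, Expr.cost]
  set s1 : State := ⟨(s.mem.write 31 0 0).write 32 0 0, s.drawn⟩ with hs1
  have hF1 : Frame [31, 32] s s1 :=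
    ((Frame.refl _ s).write (by decide) _ _).write (by decide) _ _
  have hR1 : Ready ω d w cap s1 := hR.of_frame hF1 (by decide)
  refine (runs_loop_frame (fun a s' => s'.mem 31 0 = (a : ℤ) * n ∧ s'.mem 32 0 = (a : ℤ) * m ∧
    ∀ a' (h : a' < L.length), a' < a → ∀ u : Fin m,
      s'.mem 4 ((a' : ℤ) * m + (u : ℕ)) = altSum f L[a'] (ω u)) L.length
    (tallyCost n m d + 10) rfl ?_ ?_ ?_).mono ?_
  · exact ⟨by simp [hs1, Mem.write], by simp [hs1, Mem.write], fun a' _ h => by omega⟩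
  · rintro a ha s' hF ⟨h1, h2, h3⟩
    have hR' : Ready ω d w cap s' := hR1.of_frame hF (by decide)
    have e11 : s'.mem 11 0 = L.length * n := by
      rw [hF.mem 11 (by decide), hF1.mem 11 (by decide), h11]
    have e10 : IsRow (s'.mem 10) (a * n) L[a] := by
      rw [hF.mem 10 (by decide), hF1.mem 10 (by decide)]; exact h10 a ha
    have hc : L[a].card ≤ d := hL _ (List.getElem_mem ha)
    refine ⟨?_, ?_⟩
    · simp only [Expr.val, var, e11, h1]
      have := row_lt ha hn0
      simp only [Nat.cast_zero, add_zero] at this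
      linarith
    rw [runs_seq]
    refine ((runs_tallyCmd hn0 hR' h1 e10 hc hc h2).frame rfl).mono ?_
    rintro s2 k2 ⟨⟨hk2, -, q2, q3, q4⟩, hF2⟩
    have g0 : s2.mem 0 0 = n := by rw [hF2.mem 0 (by decide), hR'.dim]
    have g31 : s2.mem 31 0 = (a : ℤ) * n := by rw [hF2.mem 31 (by decide), h1]
    simp only [runs_set, Expr.val, Expr.cost, var, dim, g0, g31]
    refine ⟨by omega, ?_, ?_, fun a' h hlt u => ?_⟩
    · simp [Mem.write]; ring
    · simp [Mem.write, q2]; ring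
    · rw [Mem.write_of_ne (by decide)]
      -- Entries of earlier sets lie below the table pointer and are preserved; those of the current
      -- set have just been written.
      rcases Nat.lt_succ_iff_lt_or_eq.1 hlt with hlt | rfl
      · rw [q4 _ (row_lt hlt u.2), h3 a' h hlt u]
      · exact q3 u
  · rintro s' hF ⟨h1, -⟩
    have e11 : s'.mem 11 0 = L.length * n := by
      rw [hF.mem 11 (by decide), hF1.mem 11 (by decide), h11]
    simp [Expr.val, var, e11, h1]
  · rintro s' k ⟨hk, ⟨h1, h2, h3⟩, hF⟩
    have hR' : Ready ω d w cap s' := hR1.of_frame hF (by decide)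
    simp only [Expr.cost, var] at hk
    refine ⟨?_, hR'.dim, hR'.sample, hR'.sampleEnd, ?_, ?_, fun a h u => h3 a h h u⟩
    · have h6 : L.length * (2 + 2 + 1 + 1 + (tallyCost n m d + 10)) ≤
        L.length * (tallyCost n m d + 20) := Nat.mul_le_mul_left _ (by omega)
      simp only [Nat.reduceAdd] at hk h6 ⊢
      omega
    · rw [hF.mem 10 (by decide), hF1.mem 10 (by decide)]; exact h10
    · rw [hF.mem 11 (by decide), hF1.mem 11 (by decide), h11]

end Collect

/-! ### Computing the parameters and drawing the sample

Scalars: `41` and `42` the sums of the inputs without and with the confidence parameter, `43` a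
power of two, `44` and `45` a factor and a counter for multiplication, `46` a counter. -/

/-- Multiply the scalar `a` by the scalar `b`. -/
def mulCmd (a b : ℕ) : Cmd :=
  .seq (assign 44 (var a))
    (.seq (assign 45 (var b))
      (.seq (assign a (.const 0))
        (.loop (var 45)
          (.seq (assign a (.add (var a) (var 44))) (assign 45 (.sub (var 45) (.const 1)))))))

/-- Set the scalar `a` to the `k`-th power of the scalar `b`. -/
def powCmd (a b : ℕ) : ℕ → Cmd
  | 0 => assign a (.const 1)
  | k + 1 => .seq (powCmd a b k) (mulCmd a b)

/-- Compute the degree bound. -/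
def degCmd (k : ℕ) : Cmd :=
  .seq (assign 43 (.const 1))
    (.seq (assign 7 (.const 0))
      (.loop (.sub (var 41) (var 43))
        (.seq (assign 43 (.add (var 43) (var 43))) (assign 7 (.add (var 7) (.const (k : ℤ)))))))

/-- Draw the sample. -/
def drawCmd : Cmd :=
  .seq (assign 6 (.const 0))
    (.seq (assign 46 (var 30))
      (.loop (var 46)
        (.seq (.ex 3 (var 6))
          (.seq (assign 6 (.add (.add (var 6) dim) (.const 1)))
            (assign 46 (.sub (var 46) (.const 1)))))))

/-- Sum up the inputs. -/
def sumCmd : Cmd :=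
  .seq (assign 41 (.add (.add (.get 0 (.const 0)) (.get 0 (.const 1))) (.get 0 (.const 2))))
    (assign 42 (.add (var 41) (.get 0 (.const 3))))

/-- The learner. -/
def learner (k kw kc km : ℕ) : Cmd :=
  .seq sumCmd
    (.seq (degCmd k)
      (.seq (powCmd 8 41 kw)
        (.seq (powCmd 9 41 kc)
          (.seq (powCmd 30 42 km)
            (.seq drawCmd
              (.seq (growCmd 10 acceptTest) finishCmd))))))

section Setup

variable {n m : ℕ} {f : Cube n → ℤˣ} {r : ℕ} {ω : Fin m → Cube n}

lemma runs_mulCmd {s : State} {a b : ℕ} (ha : a ∉ [44, 45]) (hab : b ∉ [a, 44, 45])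
    {x y : ℕ} (hx : s.mem a 0 = x) (hy : s.mem b 0 = y) :
    Runs f r ω (mulCmd a b) s (fun s' k => k ≤ 30 * y + 30 ∧ s'.mem a 0 = ((x * y : ℕ) : ℤ)) := by
  simp only [List.mem_cons, List.not_mem_nil, or_false, not_or] at ha hab
  obtain ⟨ha1, ha2⟩ := ha
  obtain ⟨hb1, hb2, hb3⟩ := hab
  simp only [mulCmd, assign, runs_seq, runs_set, Expr.val, Expr.cost, var]
  refine (runs_loop (fun i s' => s'.mem 44 0 = x ∧ s'.mem 45 0 = (y : ℤ) - i ∧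
    s'.mem a 0 = (x : ℤ) * i) y 20 ?_ ?_ ?_).mono ?_
  · refine ⟨?_, ?_, ?_⟩
    · simp [Mem.write, Ne.symm ha1, hx]
    · simp [Mem.write, Ne.symm ha2, hb2, hy]
    · simp [Mem.write]
  · rintro i hi s' ⟨h1, h2, h3⟩
    refine ⟨by simp only [Expr.val, h2]; omega, ?_⟩
    simp only [runs_seq, runs_set, Expr.val, Expr.cost, h1, h3]
    refine ⟨by omega, ?_, ?_, ?_⟩
    · simp [Mem.write, Ne.symm ha1, h1]
    · simp [Mem.write, Ne.symm ha2, h2]; ring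
    · simp [Mem.write, ha2]; ring
  · rintro s' ⟨h1, h2, h3⟩
    simp [Expr.val, h2]
  · rintro s' k ⟨hk, h1, h2, h3⟩
    simp only [Expr.cost] at hk
    refine ⟨by omega, by rw [h3]; push_cast; rfl⟩

lemma mods_mulCmd (a b : ℕ) : (mulCmd a b).mods ⊆ [a, 44, 45] := by
  intro z hz
  simp only [mulCmd, assign, Cmd.mods, List.mem_append, List.mem_singleton] at hz
  simp only [List.mem_cons, List.not_mem_nil, or_false]
  tauto

lemma mods_powCmd (a b k : ℕ) : (powCmd a b k).mods ⊆ [a, 44, 45] := by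
  induction k with
  | zero => intro z hz; simp_all [powCmd, assign, Cmd.mods]
  | succ k ih =>
    simp only [powCmd, Cmd.mods]
    exact List.append_subset.2 ⟨ih, mods_mulCmd a b⟩

lemma draws_powCmd (a b k : ℕ) : (powCmd a b k).draws = false := by
  induction k with
  | zero => rfl
  | succ k ih => simp [powCmd, Cmd.draws, ih, mulCmd, assign]

lemma runs_powCmd {s : State} {a b : ℕ} (ha : a ∉ [44, 45]) (hab : b ∉ [a, 44, 45])
    {y : ℕ} (hy : s.mem b 0 = y) (k : ℕ) :
    Runs f r ω (powCmd a b k) s (fun s' l => (l ≤ k * (30 * y + 30) + 10 ∧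
      s'.mem a 0 = ((y ^ k : ℕ) : ℤ)) ∧ Frame [a, 44, 45] s s') := by
  suffices h : Runs f r ω (powCmd a b k) s (fun s' l => l ≤ k * (30 * y + 30) + 10 ∧
      s'.mem a 0 = ((y ^ k : ℕ) : ℤ)) from
    (h.frame (draws_powCmd a b k)).mono fun s' l hl => ⟨hl.1, hl.2.mono (mods_powCmd a b k)⟩
  induction k with
  | zero =>
    simp only [powCmd, assign, runs_set, Expr.cost, Expr.val]
    exact ⟨by omega, by simp [Mem.write]⟩
  | succ k ih =>
    rw [powCmd, runs_seq]
    refine (ih.frame (draws_powCmd a b k)).mono ?_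
    rintro s1 k1 ⟨⟨hk1, h1⟩, hF⟩
    have hy1 : s1.mem b 0 = y := by
      rw [(hF.mono (mods_powCmd a b k)).mem b hab, hy]
    refine (runs_mulCmd ha hab h1 hy1).mono ?_
    rintro s2 k2 ⟨hk2, h2⟩
    refine ⟨?_, by rw [h2, pow_succ]⟩
    rw [Nat.succ_mul]
    omega

/-- The logarithm is found by doubling until the power of two reaches `N`, which happens after
`Nat.clog 2 N` rounds. -/
lemma runs_degCmd {s : State} {N k : ℕ} (hN : s.mem 41 0 = N) :
    Runs f r ω (degCmd k) s (fun s' l => l ≤ 30 * N + 30 ∧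
      s'.mem 7 0 = ((k * Nat.clog 2 N : ℕ) : ℤ)) := by
  simp only [degCmd, assign, runs_seq, runs_set, Expr.val, Expr.cost, var]
  set s1 : State := ⟨(s.mem.write 43 0 1).write 7 0 0, s.drawn⟩ with hs1
  refine (runs_loop_frame (fun i s' => s'.mem 43 0 = ((2 ^ i : ℕ) : ℤ) ∧
    s'.mem 7 0 = ((k * i : ℕ) : ℤ)) (Nat.clog 2 N) 20 rfl ?_ ?_ ?_).mono ?_
  · exact ⟨by simp [hs1, Mem.write], by simp [hs1, Mem.write]⟩
  · rintro i hi s' hF ⟨h1, h2⟩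
    have e : s'.mem 41 0 = N := by rw [hF.mem 41 (by simp [Cmd.mods])]; simp [hs1, Mem.write, hN]
    have hlt : 2 ^ i < N := (Nat.lt_clog_iff_pow_lt (by norm_num)).1 hi
    refine ⟨by simp only [Expr.val, e, h1]; omega, ?_⟩
    simp only [runs_seq, runs_set, Expr.val, Expr.cost, h1]
    refine ⟨by omega, ?_, ?_⟩
    · simp [Mem.write]; ring
    · simp [Mem.write, h2]; ring
  · rintro s' hF ⟨h1, -⟩
    have e : s'.mem 41 0 = N := by rw [hF.mem 41 (by simp [Cmd.mods])]; simp [hs1, Mem.write, hN]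
    have hle : N ≤ 2 ^ Nat.clog 2 N := Nat.le_pow_clog (by norm_num) N
    simp only [Expr.val, e, h1]
    omega
  · rintro s' l ⟨hl, ⟨h1, h2⟩, hF⟩
    simp only [Expr.cost] at hl
    have hle : Nat.clog 2 N ≤ N := Nat.clog_le_of_le_pow (Nat.lt_two_pow_self).le
    exact ⟨by omega, h2⟩

/-- Since the body draws examples, the frame rule is not available, and the invariant itself lists
what stays unchanged. -/
lemma runs_drawCmd {s : State} (hn : s.mem 0 0 = n) (hm : s.mem 30 0 = m) (hd : s.drawn = 0) :
    Runs f r ω drawCmd s (fun s' l => l ≤ m * (n + 50) + 30 ∧ IsSample (s'.mem 3) ω ∧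
      s'.mem 6 0 = m * ((n : ℤ) + 1) ∧ s'.drawn = m ∧
      ∀ a ∉ [3, 6, 46], s'.mem a = s.mem a) := by
  simp only [drawCmd, assign, runs_seq, runs_set, Expr.val, Expr.cost, var]
  refine (runs_loop (fun i s' => s'.mem 46 0 = (m : ℤ) - i ∧ s'.mem 6 0 = i * ((n : ℤ) + 1) ∧
    s'.drawn = i ∧ (∀ (u : Fin m) (v : Fin n), (u : ℕ) < i →
      s'.mem 3 ((u : ℕ) * ((n : ℤ) + 1) + (v : ℕ)) = (ω u v : ℤ)) ∧
    ∀ a ∉ [3, 6, 46], s'.mem a = s.mem a) m (n + 40) ?_ ?_ ?_).mono ?_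
  · refine ⟨by simp [Mem.write, hm], by simp [Mem.write], hd, fun u v h => by omega, ?_⟩
    intro a ha
    simp only [List.mem_cons, List.not_mem_nil, or_false, not_or] at ha
    exact (Mem.write_of_ne ha.2.2 _ _).trans (Mem.write_of_ne ha.2.1 _ _)
  · rintro i hi s' ⟨h1, h2, h3, h4, h5⟩
    have e0 : s'.mem 0 0 = n := by rw [h5 0 (by decide), hn]
    refine ⟨by simp only [Expr.val, h1]; omega, ?_⟩
    rw [runs_seq]
    refine runs_ex (by omega) ?_
    simp only [runs_seq, runs_set, Expr.val, Expr.cost, dim, h2]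
    refine ⟨by omega, ?_, ?_, by simp [h3], fun u v hu => ?_, fun a ha => ?_⟩
    · simp [Mem.write, Mem.writePoint, h1]; ring
    · simp [Mem.write, Mem.writePoint, h2, e0]; ring
    · rw [Mem.write_of_ne (by decide), Mem.write_of_ne (by decide), Mem.write_apply]
      rcases Nat.lt_succ_iff_lt_or_eq.1 hu with hu | hu
      -- With its label a point occupies `n + 1` cells, so the cells of earlier points lie strictly
      -- before those now being written.
      · have hlt := row_lt hu (Nat.succ_lt_succ v.2)
        push_cast at hlt
        rw [if_neg (by omega), Mem.writePoint, dif_neg (by rintro ⟨-, h, -⟩; omega)]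
        exact h4 u v hu
      · have hv := v.2
        rw [hu, if_neg (by omega), Mem.writePoint, dif_pos ⟨rfl, by omega, by omega⟩]
        have e1 : (⟨s'.drawn, by omega⟩ : Fin m) = u := Fin.ext (by simp [h3, hu])
        rw [e1]
        congr 2
        exact Fin.ext (by simp)
    · have ha' := ha
      simp only [List.mem_cons, List.not_mem_nil, or_false, not_or] at ha
      rw [Mem.write_of_ne ha.2.2, Mem.write_of_ne ha.2.1, Mem.write_of_ne ha.1, ← h5 a ha']
      funext z
      rw [Mem.writePoint, dif_neg (fun h => ha.1 h.1)]
  · rintro s' ⟨h1, -⟩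
    simp [Expr.val, h1]
  · rintro s' l ⟨hl, h1, h2, h3, h4, h5⟩
    simp only [Expr.cost] at hl
    refine ⟨?_, fun u v => h4 u v u.2, h2, h3, h5⟩
    have h6 : m * (1 + 1 + 1 + (n + 40)) ≤ m * (n + 50) := Nat.mul_le_mul_left _ (by omega)
    simp only [Nat.reduceAdd] at hl h6 ⊢
    omega

end Setup

/-! ### The complete learning program -/

section Learner

variable {n m : ℕ} {f : Cube n → ℤˣ} {ω : Fin m → Cube n}

/-- The sample, the collected sets and the table are computed by the learner, from inputs whose
sums without and with the confidence parameter are `N` and `M`. -/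
theorem runs_learner {s : State} {N M k kw kc km t e g : ℕ} (hn0 : 0 < n) (hs0 : s.mem 0 0 = n)
    (hs1 : s.mem 0 1 = t) (hs2 : s.mem 0 2 = e) (hs3 : s.mem 0 3 = g) (hd : s.drawn = 0)
    (hN : N = n + t + e) (hM : M = N + g) (hm : m = M ^ km) :
    Runs f (k * Nat.clog 2 N) ω (learner k kw kc km) s (fun s' l =>
      l ≤ (1 + kw + kc + km) * (30 * M + 30) + 150 + m * (n + 50) +
        collectCost n m (k * Nat.clog 2 N) (N ^ kc) +
        N ^ kc * (tallyCost n m (k * Nat.clog 2 N) + 20) ∧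
      Learned f ω (accepted f ω (k * Nat.clog 2 N) (N ^ kw) (N ^ kc)) s'.mem) := by
  set d := k * Nat.clog 2 N with hddef
  have hcap : 1 ≤ N ^ kc := Nat.one_le_pow _ _ (by omega)
  simp only [learner, sumCmd, assign, var, runs_seq, runs_set, Expr.val, Expr.cost, hs0, hs1, hs2]
  set s1 : State := ⟨(s.mem.write 41 0 (n + t + e)).write 42 0
    ((s.mem.write 41 0 (n + t + e)) 41 0 + (s.mem.write 41 0 (n + t + e)) 0 3), s.drawn⟩ with hs1'
  have a0 : s1.mem 0 0 = n := by simp [hs1', Mem.write, hs0]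
  have a41 : s1.mem 41 0 = N := by simp [hs1', Mem.write, hN]
  have a42 : s1.mem 42 0 = M := by simp [hs1', Mem.write, hs3, hM, hN]
  refine ((runs_degCmd a41).frame rfl).mono ?_
  rintro s2 k2 ⟨⟨hk2, b7⟩, hF2⟩
  have hF2' : Frame [43, 7] s1 s2 := hF2.mono (by simp [degCmd, assign, Cmd.mods])
  have b0 : s2.mem 0 0 = n := by rw [hF2'.mem 0 (by decide), a0]
  have b41 : s2.mem 41 0 = N := by rw [hF2'.mem 41 (by decide), a41]
  have b42 : s2.mem 42 0 = M := by rw [hF2'.mem 42 (by decide), a42]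
  refine (runs_powCmd (by decide) (by decide) b41 kw).mono ?_
  rintro s3 k3 ⟨⟨hk3, c8⟩, hF3⟩
  have c0 : s3.mem 0 0 = n := by rw [hF3.mem 0 (by decide), b0]
  have c7 : s3.mem 7 0 = (d : ℕ) := by rw [hF3.mem 7 (by decide), b7]
  have c41 : s3.mem 41 0 = N := by rw [hF3.mem 41 (by decide), b41]
  have c42 : s3.mem 42 0 = M := by rw [hF3.mem 42 (by decide), b42]
  refine (runs_powCmd (by decide) (by decide) c41 kc).mono ?_
  rintro s4 k4 ⟨⟨hk4, d9⟩, hF4⟩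
  have d0 : s4.mem 0 0 = n := by rw [hF4.mem 0 (by decide), c0]
  have d7 : s4.mem 7 0 = (d : ℕ) := by rw [hF4.mem 7 (by decide), c7]
  have d8 : s4.mem 8 0 = (N ^ kw : ℕ) := by rw [hF4.mem 8 (by decide), c8]
  have d42 : s4.mem 42 0 = M := by rw [hF4.mem 42 (by decide), c42]
  refine (runs_powCmd (by decide) (by decide) d42 km).mono ?_
  rintro s5 k5 ⟨⟨hk5, e30⟩, hF5⟩
  have e0 : s5.mem 0 0 = n := by rw [hF5.mem 0 (by decide), d0]
  have e7 : s5.mem 7 0 = (d : ℕ) := by rw [hF5.mem 7 (by decide), d7]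
  have e8 : s5.mem 8 0 = (N ^ kw : ℕ) := by rw [hF5.mem 8 (by decide), d8]
  have e9 : s5.mem 9 0 = (N ^ kc : ℕ) := by rw [hF5.mem 9 (by decide), d9]
  rw [← hm] at e30
  have edr : s5.drawn = 0 := by
    rw [hF5.drawn, hF4.drawn, hF3.drawn, hF2.drawn]
    exact hd
  refine (runs_drawCmd e0 e30 edr).mono ?_
  rintro s6 k6 ⟨hk6, hsam, g6, gd, hun⟩
  have hR : Ready ω d (N ^ kw) (N ^ kc) s6 :=
    { dim := by rw [hun 0 (by decide), e0]
      sample := hsam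
      sampleEnd := g6
      deg := by rw [hun 7 (by decide), e7]
      weight := by rw [hun 8 (by decide), e8]
      cap := by rw [hun 9 (by decide), e9]
      size := by rw [hun 30 (by decide), e30]
      drawn := gd }
  refine ((runs_collect hn0 hcap hR).frame rfl).mono ?_
  rintro s7 k7 ⟨⟨hk7, h11, h10⟩, hF7⟩
  refine (runs_finishCmd hn0 (hR.of_frame hF7 (by decide)) card_le_of_mem_accepted h11 h10).mono ?_
  rintro s8 k8 ⟨hk8, hL⟩
  refine ⟨?_, hL⟩
  have hlen : (accepted f ω d (N ^ kw) (N ^ kc)).length * (tallyCost n m d + 20) ≤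
      N ^ kc * (tallyCost n m d + 20) :=
    Nat.mul_le_mul_right _ (length_accepted_le hn0 hcap n)
  have hNM : 30 * N + 30 ≤ 30 * M + 30 := by omega
  have i1 := Nat.mul_le_mul_left kw hNM
  have i2 := Nat.mul_le_mul_left kc hNM
  have i3 : (1 + kw + kc + km) * (30 * M + 30) = (30 * M + 30) + kw * (30 * M + 30) +
    kc * (30 * M + 30) + km * (30 * M + 30) := by ring
  omega

end Learner

/-! ### Evaluating the hypothesis

Scalars: `31` pointer to the current set, `32` pointer into the table, `34` index, `35` pointer
into the sample, `36` the vote, `37` whether the sample point is opposite to the argument on the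
current set. -/

/-- Decide whether the current sample point and the argument differ everywhere on the current
set. -/
def oppositeCmd : Cmd :=
  .seq (assign 37 (.const 1))
    (.seq (assign 34 (.const 0))
      (.loop (.sub dim (var 34))
        (.seq (.ite (.get 10 (.add (var 31) (var 34)))
            (.ite (.add (.get 3 (.add (var 35) (var 34))) (.get 1 (var 34)))
              (assign 37 (.const 0))
              (.ite (.sub (.const 0) (.add (.get 3 (.add (var 35) (var 34))) (.get 1 (var 34))))
                (assign 37 (.const 0)) .skip))
            .skip)
          (assign 34 (.add (var 34) (.const 1))))))

/-- Add the ballots of the current set to the vote. -/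
def ballotCmd : Cmd :=
  .seq (assign 35 (.const 0))
    (.loop (.sub (var 6) (var 35))
      (.seq oppositeCmd
        (.seq (.ite (var 37) (assign 36 (.add (var 36) (.get 4 (var 32)))) .skip)
          (.seq (assign 32 (.add (var 32) (.const 1)))
            (assign 35 (.add (.add (var 35) dim) (.const 1)))))))

/-- The evaluator. -/
def evaluator : Cmd :=
  .seq (assign 36 (.const 0))
    (.seq (assign 32 (.const 0))
      (.seq (assign 31 (.const 0))
        (.seq (.loop (.sub (var 11) (var 31))
            (.seq ballotCmd (assign 31 (.add (var 31) dim))))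
          (.ite (.add (var 36) (.const 1)) (assign 2 (.const 1))
            (assign 2 (.const (-1)))))))

section Evaluator

variable {n m : ℕ} {f : Cube n → ℤˣ} {r l : ℕ} {ω' : Fin l → Cube n} {g : Cube n → ℤˣ}
  {ω : Fin m → Cube n}

lemma runs_oppositeCmd {s : State} {S : Finset (Fin n)} {x y : Cube n} {p z : ℤ}
    (hn : s.mem 0 0 = n) (hp : s.mem 31 0 = p) (hz : s.mem 35 0 = z)
    (hS : IsRow (s.mem 10) p S) (hy : ∀ i : Fin n, s.mem 3 (z + (i : ℕ)) = (y i : ℤ))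
    (hx : ∀ i : Fin n, s.mem 1 ((i : ℕ) : ℤ) = (x i : ℤ)) :
    Runs g r ω' oppositeCmd s (fun s' k => k ≤ 60 * n + 30 ∧
      s'.mem 37 0 = if ∀ i ∈ S, y i = -x i then 1 else 0) := by
  simp only [oppositeCmd, assign, runs_seq, runs_set, Expr.val, Expr.cost]
  set s1 : State := ⟨(s.mem.write 37 0 1).write 34 0 0, s.drawn⟩ with hs1
  refine (runs_loop_frame (fun i s' => s'.mem 34 0 = i ∧
    s'.mem 37 0 = if ∀ j ∈ S, (j : ℕ) < i → y j = -x j then 1 else 0) n 50 rfl ?_ ?_ ?_).mono ?_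
  · exact ⟨by simp [hs1, Mem.write], by simp [hs1, Mem.write]⟩
  · rintro i hi s' hF ⟨h1, h2⟩
    have e0 : s'.mem 0 0 = n := by rw [hF.mem 0 (by decide)]; simp [hs1, Mem.write, hn]
    have e31 : s'.mem 31 0 = p := by rw [hF.mem 31 (by decide)]; simp [hs1, Mem.write, hp]
    have e35 : s'.mem 35 0 = z := by rw [hF.mem 35 (by decide)]; simp [hs1, Mem.write, hz]
    have e10 : s'.mem 10 (p + i) = if (⟨i, hi⟩ : Fin n) ∈ S then 1 else 0 := by
      rw [hF.mem 10 (by decide)]; simpa [hs1, Mem.write] using hS ⟨i, hi⟩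
    have e3 : s'.mem 3 (z + i) = (y ⟨i, hi⟩ : ℤ) := by
      rw [hF.mem 3 (by decide)]; simpa [hs1, Mem.write] using hy ⟨i, hi⟩
    have e1 : s'.mem 1 i = (x ⟨i, hi⟩ : ℤ) := by
      rw [hF.mem 1 (by decide)]; simpa [hs1, Mem.write] using hx ⟨i, hi⟩
    have hiff : (∀ j ∈ S, (j : ℕ) < i + 1 → y j = -x j) ↔
        (∀ j ∈ S, (j : ℕ) < i → y j = -x j) ∧
        ((⟨i, hi⟩ : Fin n) ∈ S → y ⟨i, hi⟩ = -x ⟨i, hi⟩) := by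
      constructor
      · exact fun h => ⟨fun j hj hlt => h j hj (by omega), fun hj => h _ hj (by simp)⟩
      · rintro ⟨h, h'⟩ j hj hlt
        rcases Nat.lt_succ_iff_lt_or_eq.1 hlt with hlt | hlt
        · exact h j hj hlt
        · have : j = ⟨i, hi⟩ := Fin.ext hlt
          subst this
          exact h' hj
    refine ⟨by simp only [Expr.val, dim, var, e0, h1]; omega, ?_⟩
    simp only [runs_seq, runs_ite, runs_set, runs_skip, Expr.val, Expr.cost, var, h1, e31, e35,
      e10, e3, e1]
    by_cases hm : (⟨i, hi⟩ : Fin n) ∈ S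
    -- Two signs are opposite exactly when their sum is zero; the program excludes a positive and
    -- then a negative sum.
    · have hu : y ⟨i, hi⟩ = -x ⟨i, hi⟩ ↔ (y ⟨i, hi⟩ : ℤ) + x ⟨i, hi⟩ = 0 := by
        rw [← Units.val_inj, Units.val_neg]
        omega
      simp only [hm, if_true, zero_lt_one, forall_const] at hiff ⊢
      by_cases h0 : (y ⟨i, hi⟩ : ℤ) + x ⟨i, hi⟩ = 0
      · rw [if_neg (by omega), if_neg (by omega)]
        refine ⟨by omega, by simp [Mem.write], ?_⟩
        have : (∀ j ∈ S, (j : ℕ) < i + 1 → y j = -x j) ↔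
          (∀ j ∈ S, (j : ℕ) < i → y j = -x j) := by rw [hiff]; exact and_iff_left (hu.2 h0)
        simp only [this, ← h2]
        simp [Mem.write]
      · have hno : ¬ ∀ j ∈ S, (j : ℕ) < i + 1 → y j = -x j := fun h => h0 (hu.1 (hiff.1 h).2)
        rw [if_neg hno]
        split_ifs with h3 h4
        · exact ⟨by omega, by simp [Mem.write, h1], by simp [Mem.write]⟩
        · exact ⟨by omega, by simp [Mem.write, h1], by simp [Mem.write]⟩
        · omega
    · simp only [hm, if_false, lt_irrefl] at hiff ⊢
      refine ⟨by omega, by simp [Mem.write], ?_⟩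
      have : (∀ j ∈ S, (j : ℕ) < i + 1 → y j = -x j) ↔
        (∀ j ∈ S, (j : ℕ) < i → y j = -x j) := by rw [hiff]; simp
      simp only [this, ← h2]
      simp [Mem.write]
  · rintro s' hF ⟨h1, -⟩
    have e0 : s'.mem 0 0 = n := by rw [hF.mem 0 (by decide)]; simp [hs1, Mem.write, hn]
    simp [Expr.val, dim, var, e0, h1]
  · rintro s' k ⟨hk, ⟨h1, h2⟩, hF⟩
    simp only [Expr.cost, dim, var] at hk
    have : (∀ j ∈ S, (j : ℕ) < n → y j = -x j) ↔ ∀ j ∈ S, y j = -x j := by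
      simp
    simp only [this] at h2
    exact ⟨by omega, h2⟩

lemma Learned.of_frame {L : List (Finset (Fin n))} {s s' : State} {W : List ℕ}
    (h : Learned f ω L s.mem) (hF : Frame W s s') (hW : ∀ a ∈ [0, 3, 4, 6, 10, 11], a ∉ W) :
    Learned f ω L s'.mem where
  dim := by rw [hF.mem 0 (hW 0 (by simp)), h.dim]
  sample := by rw [hF.mem 3 (hW 3 (by simp))]; exact h.sample
  sampleEnd := by rw [hF.mem 6 (hW 6 (by simp)), h.sampleEnd]
  rows := by rw [hF.mem 10 (hW 10 (by simp))]; exact h.rows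
  rowsEnd := by rw [hF.mem 11 (hW 11 (by simp)), h.rowsEnd]
  table := by rw [hF.mem 4 (hW 4 (by simp))]; exact h.table

lemma runs_ballotCmd {s : State} {L : List (Finset (Fin n))} {x : Cube n} {a : ℕ} {v : ℤ}
    (h : Learned f ω L s.mem) (ha : a < L.length) (hp : s.mem 31 0 = a * n)
    (h32 : s.mem 32 0 = a * m) (h36 : s.mem 36 0 = v)
    (hx : ∀ i : Fin n, s.mem 1 ((i : ℕ) : ℤ) = (x i : ℤ)) :
    Runs g r ω' ballotCmd s (fun s' k => k ≤ m * (60 * n + 80) + 20 ∧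
      s'.mem 32 0 = a * m + m ∧ s'.mem 36 0 = v + ∑ u, ballot f x (ω u) L[a]) := by
  simp only [ballotCmd, assign, runs_seq, runs_set, Expr.val, Expr.cost]
  set s1 : State := ⟨s.mem.write 35 0 0, s.drawn⟩ with hs1
  have hF1 : Frame [35] s s1 := (Frame.refl _ s).write (by decide) _ _
  have hL1 : Learned f ω L s1.mem := h.of_frame hF1 (by decide)
  refine (runs_loop_frame (fun i s' => s'.mem 35 0 = i * ((n : ℤ) + 1) ∧
    s'.mem 32 0 = a * m + (i : ℤ) ∧
    s'.mem 36 0 = v + ∑ u ∈ univ.filter (fun u : Fin m => (u : ℕ) < i), ballot f x (ω u) L[a]) m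
    (60 * n + 70) rfl ?_ ?_ ?_).mono ?_
  · exact ⟨by simp [hs1, Mem.write], by simp [hs1, Mem.write, h32], by simp [hs1, Mem.write, h36]⟩
  · rintro i hi s' hF ⟨h1, h2, h3⟩
    have hL' : Learned f ω L s'.mem := hL1.of_frame hF (by decide)
    have e31 : s'.mem 31 0 = a * n := by
      rw [hF.mem 31 (by decide), hF1.mem 31 (by decide), hp]
    have ex : ∀ i : Fin n, s'.mem 1 ((i : ℕ) : ℤ) = (x i : ℤ) := by
      rw [hF.mem 1 (by decide), hF1.mem 1 (by decide)]; exact hx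
    refine ⟨?_, ?_⟩
    · simp only [Expr.val, var, hL'.sampleEnd, h1]
      have : (i : ℤ) < m := by exact_mod_cast hi
      nlinarith
    rw [runs_seq]
    refine ((runs_oppositeCmd (y := ω ⟨i, hi⟩) hL'.dim e31 h1 (hL'.rows a ha)
      (fun j => hL'.sample ⟨i, hi⟩ j) ex).frame rfl).mono ?_
    rintro s2 k2 ⟨⟨hk2, h37⟩, hF2⟩
    have hL2 : Learned f ω L s2.mem := hL'.of_frame hF2 (by decide)
    have g32 : s2.mem 32 0 = a * m + (i : ℤ) := by rw [hF2.mem 32 (by decide), h2]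
    have g35 : s2.mem 35 0 = i * ((n : ℤ) + 1) := by rw [hF2.mem 35 (by decide), h1]
    have g36 := h3
    rw [← hF2.mem 36 (by decide)] at g36
    have g4 : s2.mem 4 (a * m + (i : ℤ)) = altSum f L[a] (ω ⟨i, hi⟩) := hL2.table a ha ⟨i, hi⟩
    have hsum : ∑ u ∈ univ.filter (fun u : Fin m => (u : ℕ) < i + 1), ballot f x (ω u) L[a] =
        ∑ u ∈ univ.filter (fun u : Fin m => (u : ℕ) < i), ballot f x (ω u) L[a] +
          ballot f x (ω ⟨i, hi⟩) L[a] := by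
      have : univ.filter (fun u : Fin m => (u : ℕ) < i + 1) =
          insert ⟨i, hi⟩ (univ.filter (fun u : Fin m => (u : ℕ) < i)) := by
        ext u
        simp only [mem_filter, mem_univ, true_and, mem_insert, Fin.ext_iff]
        omega
      rw [this, sum_insert (by simp), add_comm]
    rw [hsum]
    simp only [runs_seq, runs_ite, runs_set, runs_skip, Expr.val, Expr.cost, var, dim, h37, g32,
      g36, g4]
    by_cases hb : ∀ j ∈ L[a], ω ⟨i, hi⟩ j = -x j
    · rw [if_pos hb, if_pos (by norm_num), ballot, if_pos hb]
      refine ⟨by omega, ?_, ?_, ?_⟩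
      · simp [Mem.write, g35, hL2.dim]; ring
      · simp [Mem.write, g32]; ring
      · simp [Mem.write]; ring
    · rw [if_neg hb, if_neg (by norm_num), ballot, if_neg hb]
      refine ⟨by omega, ?_, ?_, ?_⟩
      · simp [Mem.write, g35, hL2.dim]; ring
      · simp [Mem.write]; ring
      · simp [Mem.write, g36]
  · rintro s' hF ⟨h1, -⟩
    have hL' : Learned f ω L s'.mem := hL1.of_frame hF (by decide)
    simp [Expr.val, var, hL'.sampleEnd, h1]
  · rintro s' k ⟨hk, ⟨h1, h2, h3⟩, hF⟩
    simp only [Expr.cost, var] at hk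
    rw [filter_lt_self] at h3
    refine ⟨?_, h2, h3⟩
    have h6 : m * (2 + 2 + 1 + 1 + (60 * n + 70)) ≤ m * (60 * n + 80) :=
      Nat.mul_le_mul_left _ (by omega)
    simp only [Nat.reduceAdd] at hk h6 ⊢
    omega

theorem runs_evaluator {s : State} {L : List (Finset (Fin n))} {x : Cube n} (hn0 : 0 < n)
    (h : Learned f ω L s.mem) (hx : ∀ i : Fin n, s.mem 1 ((i : ℕ) : ℤ) = (x i : ℤ)) :
    Runs g r ω' evaluator s (fun s' k => k ≤ L.length * (m * (60 * n + 80) + 40) + 50 ∧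
      s'.mem 2 0 = if 0 ≤ (L.map fun S => ∑ u, ballot f x (ω u) S).sum then 1 else -1) := by
  simp only [evaluator, assign, runs_seq, runs_set, Expr.val, Expr.cost]
  set s1 : State := ⟨((s.mem.write 36 0 0).write 32 0 0).write 31 0 0, s.drawn⟩ with hs1
  have hF1 : Frame [36, 32, 31] s s1 :=
    (((Frame.refl _ s).write (by decide) _ _).write (by decide) _ _).write (by decide) _ _
  have hL1 : Learned f ω L s1.mem := h.of_frame hF1 (by decide)
  refine (runs_loop_frame (fun a s' => s'.mem 31 0 = (a : ℤ) * n ∧ s'.mem 32 0 = (a : ℤ) * m ∧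
    s'.mem 36 0 = ((L.take a).map fun S => ∑ u, ballot f x (ω u) S).sum) L.length
    (m * (60 * n + 80) + 30) rfl ?_ ?_ ?_).mono ?_
  · exact ⟨by simp [hs1, Mem.write], by simp [hs1, Mem.write], by simp [hs1, Mem.write]⟩
  · rintro a ha s' hF ⟨h1, h2, h3⟩
    have hL' : Learned f ω L s'.mem := hL1.of_frame hF (by decide)
    have ex : ∀ i : Fin n, s'.mem 1 ((i : ℕ) : ℤ) = (x i : ℤ) := by
      rw [hF.mem 1 (by decide), hF1.mem 1 (by decide)]; exact hx
    refine ⟨?_, ?_⟩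
    · simp only [Expr.val, var, hL'.rowsEnd, h1]
      have := row_lt ha hn0
      simp only [Nat.cast_zero, add_zero] at this
      linarith
    rw [runs_seq]
    refine ((runs_ballotCmd hL' ha h1 h2 h3 ex).frame rfl).mono ?_
    rintro s2 k2 ⟨⟨hk2, q2, q3⟩, hF2⟩
    have g0 : s2.mem 0 0 = n := (hL'.of_frame hF2 (by decide)).dim
    have g31 : s2.mem 31 0 = (a : ℤ) * n := by rw [hF2.mem 31 (by decide), h1]
    simp only [runs_set, Expr.val, Expr.cost, var, dim, g0, g31]
    refine ⟨by omega, ?_, ?_, ?_⟩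
    · simp [Mem.write]; ring
    · simp [Mem.write, q2]; ring
    · rw [List.take_succ_eq_append_getElem ha, List.map_append, List.sum_append]
      simp [Mem.write, q3]
  · rintro s' hF ⟨h1, -⟩
    have hL' : Learned f ω L s'.mem := hL1.of_frame hF (by decide)
    simp [Expr.val, var, hL'.rowsEnd, h1]
  · rintro s' k ⟨hk, ⟨h1, h2, h3⟩, hF⟩
    simp only [Expr.cost, var] at hk
    rw [List.take_length] at h3
    have h6 : L.length * (2 + 2 + 1 + 1 + (m * (60 * n + 80) + 30)) ≤
      L.length * (m * (60 * n + 80) + 40) := Nat.mul_le_mul_left _ (by omega)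
    simp only [Nat.reduceAdd] at hk h6 ⊢
    -- Over the integers, positivity of the vote plus one is nonnegativity of the vote, so a tie is
    -- resolved to `1` as in `hypothesis`.
    simp only [runs_ite, runs_set, Expr.val, Expr.cost, var, h3]
    split_ifs with h4 h5 h5
    · exact ⟨by omega, by simp [Mem.write]⟩
    · omega
    · omega
    · exact ⟨by omega, by simp [Mem.write]⟩

/-- The evaluator computes the hypothesis. -/
theorem evaluates_hypothesis {d w cap : ℕ} {M : Mem} {B : ℝ} (hn0 : 0 < n) (hcap : 1 ≤ cap)
    (h : Learned f ω (accepted f ω d w cap) M)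
    (hB : ((cap * (m * (60 * n + 80) + 40) + 50 : ℕ) : ℝ) ≤ B) :
    Evaluates evaluator M (hypothesis f d w cap ω) B := by
  intro x
  -- The argument is written into array `1`, which holds none of the learned data.
  have hne : ∀ a : ℕ, a ≠ 1 → (M.writePoint 1 0 x) a = M a := by
    intro a ha
    funext z
    rw [Mem.writePoint, dif_neg (fun h => ha h.1)]
  have h' : Learned f ω (accepted f ω d w cap) (⟨M.writePoint 1 0 x, 0⟩ : State).mem :=
    h.of_frame (s := ⟨M, 0⟩) (W := [1]) ⟨fun a ha => hne a (by simpa using ha), rfl⟩ (by decide)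
  obtain ⟨s', k, he, hk, hv⟩ := runs_evaluator (g := fun _ => 1) (r := 0)
    (ω' := fun u : Fin 0 => u.elim0) (x := x) hn0 h' (fun i => by simp [Mem.writePoint])
  refine ⟨s', k, he, le_trans ?_ hB, ?_⟩
  · have : (accepted f ω d w cap).length * (m * (60 * n + 80) + 40) ≤
        cap * (m * (60 * n + 80) + 40) :=
      Nat.mul_le_mul_right _ (length_accepted_le hn0 hcap n)
    exact_mod_cast hk.trans (by omega)
  · rw [hv, hypothesis, vote]
    split_ifs <;> simp

end Evaluator

/-! ### The choice of the parameters -/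

section Parameters

/-- Rounding the logarithm up at most doubles the power. -/
lemma two_pow_clog_le {N : ℕ} (hN : 2 ≤ N) : 2 ^ Nat.clog 2 N ≤ 2 * N := by
  have h := Nat.pow_pred_clog_lt_self (b := 2) (by norm_num) (x := N) (by omega)
  have h0 : 0 < Nat.clog 2 N := Nat.clog_pos (by norm_num) hN
  obtain ⟨q, hq⟩ := Nat.exists_eq_succ_of_ne_zero h0.ne'
  rw [hq] at h ⊢
  simp only [Nat.pred_succ] at h
  rw [Nat.pow_succ]
  omega

lemma two_pow_mul_clog_le {N : ℕ} (hN : 2 ≤ N) (k : ℕ) :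
    2 ^ (k * Nat.clog 2 N) ≤ N ^ (2 * k) := by
  rw [mul_comm k, pow_mul, pow_mul]
  refine Nat.pow_le_pow_left ((two_pow_clog_le hN).trans ?_) k
  rw [sq]
  exact Nat.mul_le_mul_right _ hN

/-- Since `16 = 2^4`, each of the `clog` blocks of `k` factors gains `2^{-4}`, and in total
`N^{-4}`. -/
lemma pow_mul_clog_le {N k : ℕ} (hN : 2 ≤ N) {a : ℝ} (ha : 0 ≤ a) (hk : a ^ k ≤ 1 / 16) :
    a ^ (k * Nat.clog 2 N) ≤ 1 / (N : ℝ) ^ 4 := by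
  have hN0 : (0 : ℝ) < N := by exact_mod_cast (by omega : 0 < N)
  have h : (N : ℝ) ≤ 2 ^ Nat.clog 2 N := by exact_mod_cast Nat.le_pow_clog (by norm_num) N
  calc a ^ (k * Nat.clog 2 N) = (a ^ k) ^ Nat.clog 2 N := pow_mul _ _ _
    _ ≤ (1 / 16) ^ Nat.clog 2 N := pow_le_pow_left₀ (by positivity) hk _
    _ = 1 / (2 ^ Nat.clog 2 N : ℝ) ^ 4 := by
      rw [div_pow, one_pow, ← pow_mul, mul_comm, pow_mul]
      norm_num
    _ ≤ 1 / (N : ℝ) ^ 4 := by gcongr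

lemma inv_pow_mul_clog_le {N k l : ℕ} (hN : 2 ≤ N) {c : ℝ} (hc : 0 < c) (hl : 1 / c ≤ 2 ^ l) :
    1 / c ^ (k * Nat.clog 2 N) ≤ (N : ℝ) ^ (2 * k * l) := by
  have h : ((2 : ℝ) ^ (k * Nat.clog 2 N)) ≤ (N : ℝ) ^ (2 * k) := by
    exact_mod_cast two_pow_mul_clog_le hN k
  calc 1 / c ^ (k * Nat.clog 2 N) = (1 / c) ^ (k * Nat.clog 2 N) := by rw [div_pow, one_pow]
    _ ≤ (2 ^ l) ^ (k * Nat.clog 2 N) := pow_le_pow_left₀ (by positivity) hl _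
    _ = (2 ^ (k * Nat.clog 2 N)) ^ l := by rw [← pow_mul, ← pow_mul, mul_comm]
    _ ≤ ((N : ℝ) ^ (2 * k)) ^ l := pow_le_pow_left₀ (by positivity) h _
    _ = (N : ℝ) ^ (2 * k * l) := by rw [← pow_mul]

/-- The exponent of the weight. -/
def weightExp (k : ℕ) : ℕ := 2 * k + 4

/-- The exponent of the bound on the storage. -/
def capExp (k l : ℕ) : ℕ := weightExp k + 2 * k * l + 3

/-- The exponent of the inverse of the accuracy. -/
def accExp (k l : ℕ) : ℕ := capExp k l + 2 * k + 1

/-- The exponent of the sample size. -/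
def sampleExp (k l : ℕ) : ℕ := 2 * accExp k l + 2 * k + 6

variable {n : ℕ} {c ε δ : ℝ} {N M k l : ℕ}

/-- The light coefficients contribute `2/N³` and the truncation `1/N³`; from `N ≥ 4` it follows that
`3/N³ ≤ 3/(16N)`, well below `9ε/16`. The summand `4` in `weightExp` is chosen for this. -/
lemma error_bound (hN : 4 ≤ N) {L : ℕ} (hL : L ≤ N) (hc : 0 ≤ 1 - c) (hk : (1 - c) ^ k ≤ 1 / 16)
    (hε : 1 / (N : ℝ) ≤ ε) :
    L * 2 ^ (k * Nat.clog 2 N) * (2 / ((N ^ weightExp k : ℕ) : ℝ)) +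
      L * (1 - c) ^ (k * Nat.clog 2 N) ≤ 9 / 16 * ε := by
  have hN4 : (4 : ℝ) ≤ N := by exact_mod_cast hN
  have hN0 : (0 : ℝ) < N := by linarith
  have hL' : (L : ℝ) ≤ N := by exact_mod_cast hL
  have h2 : ((2 : ℝ) ^ (k * Nat.clog 2 N)) ≤ (N : ℝ) ^ (2 * k) := by
    exact_mod_cast two_pow_mul_clog_le (by omega) k
  have h16 := pow_mul_clog_le (by omega : 2 ≤ N) hc hk
  have h3 : 1 / (N : ℝ) ^ 3 ≤ 1 / 16 * (1 / N) := by
    rw [div_mul_div_comm, one_mul]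
    apply one_div_le_one_div_of_le (by positivity)
    nlinarith [mul_nonneg hN0.le (sub_nonneg.2 hN4)]
  calc L * 2 ^ (k * Nat.clog 2 N) * (2 / ((N ^ weightExp k : ℕ) : ℝ)) +
      L * (1 - c) ^ (k * Nat.clog 2 N)
      ≤ N * (N : ℝ) ^ (2 * k) * (2 / ((N ^ weightExp k : ℕ) : ℝ)) + N * (1 / (N : ℝ) ^ 4) := by
        gcongr
    _ = 3 * (1 / (N : ℝ) ^ 3) := by
        rw [weightExp]
        push_cast
        field_simp
        ring
    _ ≤ 3 * (1 / 16 * (1 / N)) := by gcongr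
    _ ≤ 9 / 16 * ε := by
        have : 0 < 1 / (N : ℝ) := by positivity
        linarith

/-- The constant `3` is absorbed into one more power of `N ≥ 4`, which gives the summand `3` in
`capExp`. -/
lemma cap_bound (hN : 4 ≤ N) {L : ℕ} (hL : L ≤ N) (hn : n ≤ N) (hc : 0 < c)
    (hl : 1 / c ≤ 2 ^ l) :
    (1 + 2 * ((N ^ weightExp k : ℕ) : ℝ) * L / c ^ (k * Nat.clog 2 N)) * n <
      ((N ^ capExp k l : ℕ) : ℝ) := by
  have hN4 : (4 : ℝ) ≤ N := by exact_mod_cast hN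
  have hN0 : (0 : ℝ) < N := by linarith
  have hL' : (L : ℝ) ≤ N := by exact_mod_cast hL
  have hn' : (n : ℝ) ≤ N := by exact_mod_cast hn
  have h1 := inv_pow_mul_clog_le (k := k) (by omega : 2 ≤ N) hc hl
  have h2 : (1 : ℝ) ≤ (N : ℝ) ^ (weightExp k + 2 * k * l + 1) := one_le_pow₀ (by linarith)
  calc (1 + 2 * ((N ^ weightExp k : ℕ) : ℝ) * L / c ^ (k * Nat.clog 2 N)) * n
      = (1 + 2 * (N : ℝ) ^ weightExp k * L * (1 / c ^ (k * Nat.clog 2 N))) * n := by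
        push_cast; ring
    _ ≤ (1 + 2 * (N : ℝ) ^ weightExp k * N * (N : ℝ) ^ (2 * k * l)) * N := by gcongr
    _ = (1 + 2 * (N : ℝ) ^ (weightExp k + 2 * k * l + 1)) * N := by ring
    _ ≤ (3 * (N : ℝ) ^ (weightExp k + 2 * k * l + 1)) * N := by gcongr; linarith
    _ < (N * (N : ℝ) ^ (weightExp k + 2 * k * l + 1)) * N := by gcongr; linarith
    _ = ((N ^ capExp k l : ℕ) : ℝ) := by rw [capExp]; push_cast; ring

lemma confidence_bound (hN : 4 ≤ N) (hNM : N ≤ M) (hn : n ≤ N) (hδ : 0 < δ)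
    (hδM : 1 / δ ≤ M) :
    4 * ((n : ℝ) + 1) ^ (2 * (k * Nat.clog 2 N)) *
      Real.exp (-(((M ^ sampleExp k l : ℕ) : ℝ) * (1 / (N : ℝ) ^ accExp k l) ^ 2 / 16)) ≤ δ := by
  set d := k * Nat.clog 2 N with hd
  have hM4 : (4 : ℝ) ≤ M := by exact_mod_cast hN.trans hNM
  have hN0 : (0 : ℝ) < N := by exact_mod_cast (by omega : 0 < N)
  have hNM' : (N : ℝ) ≤ M := by exact_mod_cast hNM
  have hnM : (n : ℝ) ≤ M := by exact_mod_cast hn.trans hNM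
  have hdM : (d : ℝ) ≤ k * M := by
    have h1 : Nat.clog 2 N ≤ M :=
      (Nat.clog_le_of_le_pow Nat.lt_two_pow_self.le).trans hNM
    exact_mod_cast Nat.mul_le_mul_left k h1
  -- The size of the union bound is put into exponential form by `n + 1 ≤ exp n` and `4 ≤ exp 2`.
  have hpow : (4 : ℝ) * ((n : ℝ) + 1) ^ (2 * d) ≤ Real.exp (2 + 2 * d * n) := by
    have h4 : (4 : ℝ) ≤ Real.exp 2 := by
      have := Real.add_one_le_exp (1 : ℝ)
      have h2 : Real.exp 2 = Real.exp 1 * Real.exp 1 := by rw [← Real.exp_add]; norm_num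
      nlinarith
    have h5 : ((n : ℝ) + 1) ^ (2 * d) ≤ Real.exp (2 * d * n) := by
      calc ((n : ℝ) + 1) ^ (2 * d) ≤ Real.exp n ^ (2 * d) :=
            pow_le_pow_left₀ (by positivity) (Real.add_one_le_exp _) _
        _ = Real.exp (2 * d * n) := by rw [← Real.exp_nat_mul]; push_cast; rfl
    rw [Real.exp_add]
    gcongr
  have hdelta : Real.exp (-M) ≤ δ := by
    have h1 : 1 / δ ≤ Real.exp M := hδM.trans (by linarith [Real.add_one_le_exp (M : ℝ)])
    rw [Real.exp_neg, inv_eq_one_div, div_le_iff₀ (Real.exp_pos _)]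
    rw [div_le_iff₀ hδ] at h1
    linarith
  -- The exponent of the Chernoff bound must pay for the union bound and leave `M` over, since `exp
  -- (-M) ≤ δ`. As `N ≤ M`, the product `m η²` is at least `M^{2k+6}`, which exceeds what is needed.
  have hmain : 2 + 2 * d * n + (M : ℝ) ≤
      ((M ^ sampleExp k l : ℕ) : ℝ) * (1 / (N : ℝ) ^ accExp k l) ^ 2 / 16 := by
    have e1 : (16 : ℝ) * (2 * k + 2) ≤ (M : ℝ) ^ (2 * k + 4) := by
      have h1 : ((2 * k + 2 : ℕ) : ℝ) ≤ (2 : ℝ) ^ (2 * k + 2) := by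
        exact_mod_cast Nat.lt_two_pow_self.le
      have h2 : (2 : ℝ) ^ (2 * k + 2) ≤ (M : ℝ) ^ (2 * k + 2) :=
        pow_le_pow_left₀ (by norm_num) (by linarith) _
      have h3 : (16 : ℝ) ≤ (M : ℝ) ^ 2 := by nlinarith
      push_cast at h1
      calc (16 : ℝ) * (2 * k + 2) ≤ (M : ℝ) ^ 2 * (M : ℝ) ^ (2 * k + 2) := by
            gcongr; linarith
        _ = (M : ℝ) ^ (2 * k + 4) := by ring
    have e2 : (M : ℝ) ^ (2 * k + 6) ≤
        ((M ^ sampleExp k l : ℕ) : ℝ) * (1 / (N : ℝ) ^ accExp k l) ^ 2 := by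
      have h1 : (N : ℝ) ^ (2 * accExp k l) ≤ (M : ℝ) ^ (2 * accExp k l) :=
        pow_le_pow_left₀ hN0.le hNM' _
      rw [div_pow, one_pow, ← pow_mul, mul_one_div, le_div_iff₀ (by positivity),
        mul_comm (accExp k l)]
      calc (M : ℝ) ^ (2 * k + 6) * (N : ℝ) ^ (2 * accExp k l)
          ≤ (M : ℝ) ^ (2 * k + 6) * (M : ℝ) ^ (2 * accExp k l) := by gcongr
        _ = ((M ^ sampleExp k l : ℕ) : ℝ) := by rw [sampleExp]; push_cast; ring
    have e3 : 2 + 2 * d * n + (M : ℝ) ≤ (2 * k + 2) * (M : ℝ) ^ 2 := by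
      have h1 : (d : ℝ) * n ≤ (k * M) * M := by gcongr
      nlinarith
    rw [le_div_iff₀ (by norm_num)]
    calc (2 + 2 * d * n + (M : ℝ)) * 16 ≤ ((2 * k + 2) * (M : ℝ) ^ 2) * 16 := by gcongr
      _ = (16 * (2 * k + 2)) * (M : ℝ) ^ 2 := by ring
      _ ≤ (M : ℝ) ^ (2 * k + 4) * (M : ℝ) ^ 2 := by gcongr
      _ = (M : ℝ) ^ (2 * k + 6) := by ring
      _ ≤ _ := e2
  calc 4 * ((n : ℝ) + 1) ^ (2 * d) *
      Real.exp (-(((M ^ sampleExp k l : ℕ) : ℝ) * (1 / (N : ℝ) ^ accExp k l) ^ 2 / 16))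
      ≤ Real.exp (2 + 2 * d * n) * Real.exp (-(2 + 2 * d * n + (M : ℝ))) := by gcongr
    _ = Real.exp (-M) := by rw [← Real.exp_add]; congr 1; ring
    _ ≤ δ := hdelta

open Classical in
/-- The learner's hypothesis is accurate with the required probability. -/
theorem le_sum_accurate {μ : Fin n → ℝ} (hc : 0 < c) (hc' : c ≤ 1)
    (hμ : ∀ i, μ i ∈ Set.Icc (-1 + 2 * c) (1 - 2 * c)) (T : DecTree n)
    (hk : (1 - c) ^ k ≤ 1 / 16) (hl : 1 / c ≤ 2 ^ l) (hN : 4 ≤ N) (hNM : N ≤ M) (hn : n ≤ N)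
    (hT : T.leaves ≤ N) (hε : 1 / (N : ℝ) ≤ ε) (hδ : 0 < δ) (hδM : 1 / δ ≤ M) :
    1 - δ ≤ ∑ ω : Fin (M ^ sampleExp k l) → Cube n with
      err (prodDist μ) (hypothesis T.eval (k * Nat.clog 2 N) (N ^ weightExp k)
        (N ^ capExp k l) ω) T.eval ≤ ε, ∏ u, prodDist μ (ω u) := by
  have hN4 : (4 : ℝ) ≤ N := by exact_mod_cast hN
  have hN0 : (0 : ℝ) < N := by linarith
  refine le_sum_good_sample (η := 1 / (N : ℝ) ^ accExp k l) hc hc' hμ T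
    (Nat.pow_pos (by omega)) (Nat.pow_pos (by omega)) (by positivity)
    (confidence_bound hN hNM hn hδ hδM) ?_ ?_ (cap_bound hN hT hn hc hl)
    (error_bound hN hT (by linarith) hk hε)
  · apply one_div_le_one_div_of_le (by positivity)
    have h1 : (1 : ℝ) ≤ (N : ℝ) ^ (2 * k * l + 3 + 2 * k) := one_le_pow₀ (by linarith)
    calc 2 * ((N ^ weightExp k : ℕ) : ℝ) = 1 * 2 * (N : ℝ) ^ weightExp k := by push_cast; ring
      _ ≤ (N : ℝ) ^ (2 * k * l + 3 + 2 * k) * N * (N : ℝ) ^ weightExp k := by gcongr; linarith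
      _ = (N : ℝ) ^ accExp k l := by rw [accExp, capExp]; ring
  · have h2 : ((2 : ℝ) ^ (k * Nat.clog 2 N)) ≤ (N : ℝ) ^ (2 * k) := by
      exact_mod_cast two_pow_mul_clog_le (by omega) k
    calc ((N ^ capExp k l : ℕ) : ℝ) * (2 ^ (k * Nat.clog 2 N) * (1 / (N : ℝ) ^ accExp k l))
        ≤ ((N ^ capExp k l : ℕ) : ℝ) * ((N : ℝ) ^ (2 * k) * (1 / (N : ℝ) ^ accExp k l)) := by
          gcongr
      _ = 1 / N := by rw [accExp]; push_cast; field_simp; ring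
      _ ≤ 1 / 4 := one_div_le_one_div_of_le (by norm_num) hN4

/-- The degree bound is logarithmic. -/
lemma degree_bound {t : ℕ} (hn : 0 < n) (ht : 0 < t) (hε : 0 < ε) (hε' : ε < 1) :
    ((k * Nat.clog 2 (n + t + ⌈1 / ε⌉₊) : ℕ) : ℝ) ≤ 3 * k * Real.logb 2 (2 * n * t / ε) := by
  set N := n + t + ⌈1 / ε⌉₊ with hN
  set A : ℝ := 2 * n * t / ε with hA
  have hA2 : 2 ≤ A := two_le_div hn ht hε hε'
  have hn1 : (1 : ℝ) ≤ n := by exact_mod_cast hn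
  have ht1 : (1 : ℝ) ≤ t := by exact_mod_cast ht
  have he1 : 1 ≤ 1 / ε := by rw [le_div_iff₀ hε]; linarith
  -- Each of `n`, `t`, `1/ε` and the `1` from rounding up is at most `n t / ε = A/2`.
  have hNA : (N : ℝ) ≤ 2 * A := by
    have h1 : (⌈1 / ε⌉₊ : ℝ) ≤ 1 / ε + 1 := (Nat.ceil_lt_add_one (by positivity)).le
    have h2 : 2 * A = 4 * (n * t * (1 / ε)) := by rw [hA]; ring
    have h3 : (n : ℝ) ≤ n * t * (1 / ε) := by
      calc (n : ℝ) = n * 1 * 1 := by ring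
        _ ≤ _ := by gcongr
    have h4 : (t : ℝ) ≤ n * t * (1 / ε) := by
      calc (t : ℝ) = 1 * t * 1 := by ring
        _ ≤ _ := by gcongr
    have h5 : 1 / ε ≤ n * t * (1 / ε) := by
      calc 1 / ε = 1 * 1 * (1 / ε) := by ring
        _ ≤ _ := by gcongr
    rw [hN, h2]
    push_cast
    linarith
  -- The power of two is at most `2N ≤ 4A ≤ A³`, as `A ≥ 2`.
  have hq : ((2 : ℝ) ^ Nat.clog 2 N) ≤ A ^ 3 := by
    have h1 : ((2 : ℝ) ^ Nat.clog 2 N) ≤ 2 * N := by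
      exact_mod_cast two_pow_clog_le (by omega : 2 ≤ N)
    nlinarith [mul_nonneg (by linarith : (0 : ℝ) ≤ A) (by nlinarith : (0 : ℝ) ≤ A ^ 2 - 4)]
  have hq' : (Nat.clog 2 N : ℝ) ≤ 3 * Real.logb 2 A := by
    have h1 := Real.logb_le_logb_of_le (by norm_num : (1 : ℝ) < 2) (by positivity) hq
    rw [Real.logb_pow, Real.logb_pow, Real.logb_self_eq_one (by norm_num)] at h1
    simpa using h1
  push_cast
  calc (k : ℝ) * Nat.clog 2 N ≤ k * (3 * Real.logb 2 A) := by gcongr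
    _ = 3 * k * Real.logb 2 A := by ring

/-- The running time is polynomial. -/
lemma cost_bound {a d m cap X : ℕ} (hX : 1 ≤ X) (hn : n ≤ X) (hm : m ≤ X) (hM : M ≤ X)
    (hcap : cap ≤ X) (hd : 2 ^ d ≤ X) :
    a * (30 * M + 30) + 150 + m * (n + 50) + collectCost n m d cap +
      cap * (tallyCost n m d + 20) ≤ (60 * a + 2000) * X ^ 5 := by
  have p1 : X ≤ X ^ 5 := Nat.le_self_pow (by norm_num) X
  have p2 : X ^ 2 ≤ X ^ 5 := Nat.pow_le_pow_right hX (by norm_num)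
  have p3 : X ^ 4 ≤ X ^ 5 := Nat.pow_le_pow_right hX (by norm_num)
  have p4 : X ≤ X ^ 3 := Nat.le_self_pow (by norm_num) X
  have p5 : X ^ 2 ≤ X ^ 3 := Nat.pow_le_pow_right hX (by norm_num)
  have hT : tallyCost n m d ≤ 590 * X ^ 3 := by
    unfold tallyCost
    calc n * (2 ^ d * (40 * n + 100) + 40) + (40 * n + 50) +
        (m * (2 ^ d * (90 * n + 100) + 100) + 30)
        ≤ X * (X * (40 * X + 100) + 40) + (40 * X + 50) +
          (X * (X * (90 * X + 100) + 100) + 30) := by gcongr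
      _ = 130 * X ^ 3 + 200 * X ^ 2 + 180 * X + 80 := by ring
      _ ≤ 590 * X ^ 3 := by omega
  have hC : collectCost n m d cap ≤ 960 * X ^ 5 := by
    unfold collectCost
    calc n * (cap * (tallyCost n m d + 80 * n + 160) + 40) + (40 * n + 50)
        ≤ X * (X * (590 * X ^ 3 + 80 * X + 160) + 40) + (40 * X + 50) := by gcongr
      _ = 590 * X ^ 5 + 80 * X ^ 3 + 160 * X ^ 2 + 80 * X + 50 := by ring
      _ ≤ 960 * X ^ 5 := by
        have : X ^ 3 ≤ X ^ 5 := Nat.pow_le_pow_right hX (by norm_num)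
        omega
  calc a * (30 * M + 30) + 150 + m * (n + 50) + collectCost n m d cap +
      cap * (tallyCost n m d + 20)
      ≤ a * (60 * X ^ 5) + 150 + X * (X + 50) + 960 * X ^ 5 + X * (590 * X ^ 3 + 20) := by
        gcongr
        omega
    _ = 60 * a * X ^ 5 + 150 + X ^ 2 + 70 * X + 960 * X ^ 5 + 590 * X ^ 4 := by ring
    _ ≤ (60 * a + 2000) * X ^ 5 := by
        rw [add_mul]
        omega

lemma evaluation_cost_bound {m cap X : ℕ} (hX : 1 ≤ X) (hn : n ≤ X) (hm : m ≤ X)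
    (hcap : cap ≤ X) : cap * (m * (60 * n + 80) + 40) + 50 ≤ 2000 * X ^ 5 := by
  have p1 : X ≤ X ^ 5 := Nat.le_self_pow (by norm_num) X
  have p2 : X ^ 2 ≤ X ^ 5 := Nat.pow_le_pow_right hX (by norm_num)
  have p3 : X ^ 3 ≤ X ^ 5 := Nat.pow_le_pow_right hX (by norm_num)
  calc cap * (m * (60 * n + 80) + 40) + 50 ≤ X * (X * (60 * X + 80) + 40) + 50 := by gcongr
    _ = 60 * X ^ 3 + 80 * X ^ 2 + 40 * X + 50 := by ring
    _ ≤ 2000 * X ^ 5 := by omega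

end Parameters

/-- Decision trees are learnable with local membership queries. -/
theorem learnable (c : ℝ) (hc : 0 < c) (hc' : c ≤ 1 / 2) :
    ∃ (K₁ : ℕ) (C₁ : ℝ) (L E : Cmd), ∀ (K : ℕ) (C : ℝ), K₁ ≤ K → C₁ ≤ C →
      ∀ (n t : ℕ) (ε δ : ℝ), 0 < n → 0 < ε → ε < 1 → 0 < δ → δ < 1 →
        ∃ m r : ℕ,
          (m : ℝ) ≤ K * (n + t + 1 / ε + 1 / δ) ^ K ∧
          (r : ℝ) ≤ C * Real.logb 2 (2 * n * t / ε) ∧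
          ∀ (μ : Fin n → ℝ) (T : DecTree n),
            (∀ i, μ i ∈ Set.Icc (-1 + 2 * c) (1 - 2 * c)) → T.leaves ≤ t →
            Learns L E t ε δ m r (K * (n + t + 1 / ε + 1 / δ) ^ K) (prodDist μ) T.eval := by
  obtain ⟨k, hk⟩ := exists_pow_lt_of_lt_one (by norm_num : (0 : ℝ) < 1 / 16)
    (by linarith : 1 - c < 1)
  obtain ⟨l, hl⟩ := pow_unbounded_of_one_lt (1 / c) (by norm_num : (1 : ℝ) < 2)
  set e := sampleExp k l with he
  set a := 1 + weightExp k + capExp k l + sampleExp k l with ha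
  -- All costs are at most `(60a + 2000) X^5` with `X = M^e` and `M ≤ 2P`, where `P` is the sum in
  -- the bound. The extra summand `5e` makes `K` large enough as an exponent too.
  refine ⟨(60 * a + 2000) * 2 ^ (5 * e) + 5 * e, 3 * k,
    learner k (weightExp k) (capExp k l) (sampleExp k l), evaluator, ?_⟩
  intro K C hK hC n t ε δ hn hε hε' hδ hδ'
  set P : ℝ := n + t + 1 / ε + 1 / δ with hP
  have he1 : 1 < 1 / ε := (one_lt_div hε).2 hε'
  have hd1 : 1 < 1 / δ := (one_lt_div hδ).2 hδ'
  have hP1 : 1 ≤ P := by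
    have h1 : (0 : ℝ) ≤ n := by positivity
    have h2 : (0 : ℝ) ≤ t := by positivity
    linarith
  -- Every tree has a leaf, so there are no targets when `t = 0`.
  rcases Nat.eq_zero_or_pos t with rfl | ht
  · refine ⟨0, 0, by rw [Nat.cast_zero]; positivity, by simp, fun μ T _ hT => ?_⟩
    have := T.one_le_leaves
    omega
  set N := n + t + ⌈1 / ε⌉₊ with hN
  set M := N + ⌈1 / δ⌉₊ with hM
  have hce : 2 ≤ ⌈1 / ε⌉₊ := Nat.lt_ceil.2 (by simpa using he1)
  have hN4 : 4 ≤ N := by omega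
  have hNM : N ≤ M := by omega
  have hMP : (M : ℝ) ≤ 2 * P := by
    have h1 : (⌈1 / ε⌉₊ : ℝ) < 1 / ε + 1 := Nat.ceil_lt_add_one (by positivity)
    have h2 : (⌈1 / δ⌉₊ : ℝ) < 1 / δ + 1 := Nat.ceil_lt_add_one (by positivity)
    have h3 : (0 : ℝ) ≤ n := by positivity
    have h4 : (0 : ℝ) ≤ t := by positivity
    rw [hM, hN, hP]
    push_cast
    linarith
  have hεN : 1 / (N : ℝ) ≤ ε := by
    have h1 : 1 / ε ≤ N := (Nat.le_ceil _).trans (by exact_mod_cast (by omega : ⌈1 / ε⌉₊ ≤ N))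
    rw [one_div_le (by exact_mod_cast (by omega : 0 < N)) hε]
    exact h1
  have hδM : 1 / δ ≤ M := (Nat.le_ceil _).trans (by exact_mod_cast (by omega : ⌈1 / δ⌉₊ ≤ M))
  -- `X` is the sample size, and it dominates the storage bound and `2 ^ d` as well, because its
  -- exponent is the largest.
  set X := M ^ e with hX
  have hX1 : 1 ≤ X := Nat.one_le_pow _ _ (by omega)
  have hMX : M ≤ X := Nat.le_self_pow (by rw [he, sampleExp]; omega) M
  have hcapX : N ^ capExp k l ≤ X :=
    (Nat.pow_le_pow_left hNM _).trans
      (Nat.pow_le_pow_right (by omega) (by rw [he, sampleExp, accExp]; omega))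
  have hdX : 2 ^ (k * Nat.clog 2 N) ≤ X :=
    (two_pow_mul_clog_le (by omega) k).trans ((Nat.pow_le_pow_left hNM _).trans
      (Nat.pow_le_pow_right (by omega) (by rw [he, sampleExp]; omega)))
  have hbound : ∀ z : ℕ, z ≤ (60 * a + 2000) * X ^ 5 → (z : ℝ) ≤ K * P ^ K := by
    intro z hz
    have h1 : (X : ℝ) ^ 5 ≤ 2 ^ (5 * e) * P ^ (5 * e) := by
      rw [hX, ← mul_pow]
      push_cast
      rw [← pow_mul, mul_comm e]
      exact pow_le_pow_left₀ (by positivity) hMP _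
    calc (z : ℝ) ≤ ((60 * a + 2000 : ℕ) : ℝ) * (X : ℝ) ^ 5 := by exact_mod_cast hz
      _ ≤ ((60 * a + 2000 : ℕ) : ℝ) * (2 ^ (5 * e) * P ^ (5 * e)) := by gcongr
      _ = (((60 * a + 2000) * 2 ^ (5 * e) : ℕ) : ℝ) * P ^ (5 * e) := by push_cast; ring
      _ ≤ (K : ℝ) * P ^ K := by
        refine mul_le_mul ?_ (pow_le_pow_right₀ hP1 (by omega)) (by positivity) (by positivity)
        exact_mod_cast (by omega : (60 * a + 2000) * 2 ^ (5 * e) ≤ K)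
  refine ⟨M ^ sampleExp k l, k * Nat.clog 2 N, hbound _ ?_, ?_, fun μ T hμ hT => ?_⟩
  · calc M ^ sampleExp k l ≤ X ^ 5 := Nat.le_self_pow (by norm_num) X
      _ ≤ (60 * a + 2000) * X ^ 5 := Nat.le_mul_of_pos_left _ (by omega)
  · refine (degree_bound hn ht hε hε').trans ?_
    exact mul_le_mul_of_nonneg_right hC (zero_le_one.trans (one_le_logb_div hn ht hε hε'))
  refine ⟨hypothesis T.eval (k * Nat.clog 2 N) (N ^ weightExp k) (N ^ capExp k l),
    fun ω => ?_, ?_⟩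
  · obtain ⟨s, j, hex, hj, hL⟩ := runs_learner (f := T.eval) (ω := ω) (s := initial n t ε δ)
      (N := N) (M := M) (k := k) (kw := weightExp k) (kc := capExp k l) (km := sampleExp k l)
      (t := t) (e := ⌈1 / ε⌉₊) (g := ⌈1 / δ⌉₊) hn
      (by simp [initial, Mem.write]) (by simp [initial, Mem.write])
      (by rw [Int.natCast_ceil_eq_ceil (by positivity)]; simp [initial, Mem.write])
      (by rw [Int.natCast_ceil_eq_ceil (by positivity)]; simp [initial, Mem.write]) rfl hN hM rfl
    refine ⟨s, j, hex, hbound j (hj.trans (cost_bound hX1 (by omega) le_rfl hMX hcapX hdX)), ?_⟩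
    refine evaluates_hypothesis hn (Nat.one_le_pow _ _ (by omega)) hL (hbound _ ?_)
    refine (evaluation_cost_bound hX1 (by omega : n ≤ X) le_rfl hcapX).trans ?_
    exact Nat.mul_le_mul_right _ (by omega)
  · have := le_sum_accurate hc (by linarith) hμ T hk.le hl.le hN4 hNM (by omega)
      (by omega) hεN hδ hδM
    convert this

end LocalMQ

/-! ### The main theorem -/

open LocalMQ in
theorem mainTheorem2 (c : ℝ) (hc : 0 < c) (hc' : c ≤ 1 / 2) :
    ∃ (K : ℕ) (C : ℝ) (L E : Cmd),
      -- decision trees are learnable with local membership queries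
      (∀ (n t : ℕ) (ε δ : ℝ), 0 < n → 0 < ε → ε < 1 → 0 < δ → δ < 1 →
        ∃ m r : ℕ,
          (m : ℝ) ≤ K * (n + t + 1 / ε + 1 / δ) ^ K ∧
          (r : ℝ) ≤ C * Real.logb 2 (2 * n * t / ε) ∧
          ∀ (μ : Fin n → ℝ) (T : DecTree n),
            (∀ i, μ i ∈ Set.Icc (-1 + 2 * c) (1 - 2 * c)) → T.leaves ≤ t →
            Learns L E t ε δ m r (K * (n + t + 1 / ε + 1 / δ) ^ K) (prodDist μ) T.eval) ∧
      -- the algorithm with exact expectations and its explicit parameters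
      (∀ (n t : ℕ) (ε : ℝ), 0 < n → 0 < ε → ε < 1 →
        ∀ (μ : Fin n → ℝ) (T : DecTree n),
          (∀ i, μ i ∈ Set.Icc (-1 + 2 * c) (1 - 2 * c)) → T.leaves ≤ t →
          ∀ (θ : ℝ) (d : ℕ), θ = thetaParam c ε t → d = ⌊depthParam c ε t⌋₊ →
            err (prodDist μ) (output μ T.eval θ d) T.eval ≤ ε ∧
            ((collected μ T.eval θ d).card : ℝ) ≤ K * (n + t + 1 / ε) ^ K ∧
            ((tests μ T.eval θ d).card : ℝ) ≤ K * (n + t + 1 / ε) ^ K ∧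
            ∀ p ∈ tests μ T.eval θ d, ∀ x : Cube n,
              fSub μ T.eval (insert p.2 p.1) x = queryAvg μ T.eval (insert p.2 p.1) x ∧
              ((flips (insert p.2 p.1) x).card : ℝ) ≤ K * (n + t + 1 / ε) ^ K ∧
              ∀ y ∈ flips (insert p.2 p.1) x,
                (hammingDist x y : ℝ) ≤ C * Real.logb 2 (2 * n * t / ε)) := by
  obtain ⟨K₀, C₀, h₀⟩ := exact_algorithm c hc hc'
  obtain ⟨K₁, C₁, L, E, h₁⟩ := learnable c hc hc'
  -- Both halves were proved for all sufficiently large constants, so the maxima serve for both at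
  -- once.
  exact ⟨max K₀ K₁, max C₀ C₁, L, E,
    h₁ _ _ (le_max_right _ _) (le_max_right _ _), h₀ _ _ (le_max_left _ _) (le_max_left _ _)⟩
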